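/- **Algorithm.** Let $A\in\mathbb{R}^{n\times d}$ with $n\ge 1$, let $1\le \ell\le d$ and $\delta\in(0,1)$. Write $\operatorname{nnz}(\cdot)$ for the number of nonzero entries. \textsc{SparseFrequentDirections} reads the rows of $A$ once, as a stream of sparse vectors. It keeps a sketch $B\in\mathbb{R}^{\ell\times d}$, initially $0$, and a sparse buffer $A'$, initially without rows. Each arriving row is appended to $A'$; as soon as $\operatorname{nnz}(A')\ge \ell d$ or $A'$ has $d$ rows, it sets $B'=\textsc{BoostedSparseShrink}(A',\ell,\delta)$ and $B=\textsc{DenseShrink}([B;B'],\ell)$ and empties $A'$. At the end of the stream it returns $B$. The subroutines are as follows. * $\textsc{DenseShrink}(M,\ell)$: compute the rank $\ell$ SVD $[H,\Lambda,V]$ of $M$, with singular values $\lambda_1\ge\dots\ge\lambda_\ell$, and return $\sqrt{\Lambda^2-\lambda_\ell^2 I_\ell}\,V^T$. * $\textsc{SimultaneousIteration}(A',\ell,\varepsilon)$, where $A'$ has $m$ rows: draw $G\sim\mathcal N(0,1)^{d\times \ell}$, put $q=\lceil c_1\log(m/\varepsilon)/\varepsilon\rceil$, and return the Gram–Schmidt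 orthonormalization $Z$ of the columns of $A'(A'^TA')^qG$. * $\textsc{SparseShrink}(A',\ell)$: let $Z=\textsc{SimultaneousIteration}(A',\ell,1/4)$ and $P=Z^TA'$, compute the SVD $[H,\Lambda,V]$ of $P$, and return $\sqrt{\Lambda^2-\lambda_\ell^2 I_\ell}\,V^T$. * $\textsc{VerifySpectral}(C,\delta)$, in its $i$-th call during the whole run: put $\delta_i=\delta/(2i^2)$, draw $x$ uniformly from the unit sphere of $\mathbb{R}^d$, and accept if and only if $\|C^{k}x\|\le 1$, where $k=\lceil c_2\log(d/\delta_i)\rceil$. * $\textsc{BoostedSparseShrink}(A',\ell,\delta)$: repeat $B'=\textsc{SparseShrink}(A',\ell)$, $\Delta=(\|A'\|_F^2-\|B'\|_F^2)/(\alpha\ell)$ with $\alpha=6/41$, until $\textsc{VerifySpectral}((A'^TA'-B'^TB')/(\Delta/2),\delta)$ accepts; return $B'$. (If $\Delta=0$, the quotient is read as the zero matrix.) All random draws are independent. **Model.** Exact real arithmetic on a random access machine whose memory is initially zero, in the constant-word-size model: a number occupies $O(1)$ memory; an arithmetic operation, comparison, evaluation of an elementary function, memory access or draw of a standard normal variable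 takes $O(1)$ time. A sparse matrix is stored by its nonzero entries. Multiplying an $m\times d$ sparse matrix $M$, or its transpose, by a dense vector takes $O(\operatorname{nnz}(M)+m)$ or $O(\operatorname{nnz}(M)+d)$ time respectively; Gram–Schmidt on $\ell$ vectors in $\mathbb{R}^m$ takes $O(m\ell^2)$ time; the SVD of a dense $r\times d$ matrix takes $K\,rd\min(r,d)$ time and $K\,rd$ memory, for a constant $K$. The matrix $(A'^TA'-B'^TB')/(\Delta/2)$ is never formed, but applied to vectors through $A'$, $A'^T$, $B'$, $B'^T$. **Claim (time).** There is an absolute constant $c_0>0$ such that, for all constants $c_1\ge c_0$, $c_2>0$ and $K\in\mathbb{N}$, there is a constant $C>0$, depending only on $c_1,c_2,K$, such that for all $n,d,\ell,A,\delta$ as above the running time is a measurable function of the random draws (up to a null set), and its expectation is at most $$C\bigl(\operatorname{nnz}(A)\,\ell\log d+\operatorname{nnz}(A)\log(n/\delta)+n\ell^2+n\ell\log(n/\delta)\bigr).$$ **Claim (memory).** For all constants $c_1,c_2\in\mathbb{R}$ and $K\in\mathbb{N}$ there is a constant $C>0$ such that for all $n,d,\ell,A,\delta$ as above, and for every outcome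 of the random draws, the number of words of memory in use is at most $C\,d\ell$ at every moment of the run. -/

import Mathlib

open MeasureTheory ProbabilityTheory
open scoped Matrix ENNReal

namespace SparseFD

/-! ## The machine

Unit-cost random access machine in the constant-word-size model: a number (integer or real) occupies
one word; an arithmetic operation, comparison, evaluation of an elementary function, access to a word
or draw of a standard normal variable takes one unit of time. Memory is zero when the
computation starts. The working memory is counted; the input is a read-once stream of sparse rows.

An algorithm is a program in the monad `Prog`: it reads an infinite tape of independent random draws
and charges its time and its memory to the `Machine` state. Linear algebra operations on arrays
are charged with the number of scalar operations of the schoolbook implementation on a sparse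
array (one that stores its nonzero entries only) or a dense array, as stated at each of them. -/

/-- The resources used so far, and the persistent counters of random draws. -/
structure Machine where
  /-- elementary operations executed so far -/
  time : ℕ
  /-- words of working memory in use now -/
  live : ℕ
  /-- largest number of words that were in use simultaneously so far -/
  peak : ℕ
  /-- number of Gaussian matrices drawn so far -/
  gaussianCalls : ℕ
  /-- number of calls of VerifySpectral so far, its persistent variable `i` -/
  verifyCalls : ℕ

/-- The state in which a computation starts. -/
def Machine.init : Machine := ⟨0, 0, 0, 0, 0⟩

/-- The unit sphere of `ℝ^d`. -/
abbrev UnitSphere (d : ℕ) : Type := Metric.sphere (0 : EuclideanSpace ℝ (Fin d)) 1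

/-- The source of randomness: a sequence of `d × ℓ` matrices and a sequence of unit vectors. -/
abbrev Tape (d ℓ : ℕ) : Type := (ℕ → Fin d → Fin ℓ → ℝ) × (ℕ → UnitSphere d)

/-- The distribution of a `d × ℓ` matrix with independent standard normal entries. -/
noncomputable def gaussianMatrix (d ℓ : ℕ) : Measure (Fin d → Fin ℓ → ℝ) :=
  Measure.pi fun _ => Measure.pi fun _ => gaussianReal 0 1

instance (d ℓ : ℕ) : IsProbabilityMeasure (gaussianMatrix d ℓ) := by
  unfold gaussianMatrix; infer_instance

/-- The uniform distribution on the unit sphere: normalized surface measure. -/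
noncomputable def uniformSphere (d : ℕ) : Measure (UnitSphere d) :=
  ((volume : Measure (EuclideanSpace ℝ (Fin d))).toSphere Set.univ)⁻¹ •
    (volume : Measure (EuclideanSpace ℝ (Fin d))).toSphere

instance (d : ℕ) [NeZero d] : IsProbabilityMeasure (uniformSphere d) := by
  have : Nonempty (Fin d) := ⟨0⟩
  refine ⟨?_⟩
  rw [uniformSphere, Measure.smul_apply, smul_eq_mul]
  refine ENNReal.inv_mul_cancel ?_ (measure_ne_top _ _)
  rw [Measure.toSphere_apply_univ]
  refine mul_ne_zero ?_ (Metric.measure_ball_pos _ _ one_pos).ne'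
  simp [NeZero.ne d]

/-- The law of the tape: all draws are independent, each matrix is Gaussian and each unit vector is
uniformly distributed. -/
noncomputable def tapeMeasure (d ℓ : ℕ) [NeZero d] : Measure (Tape d ℓ) :=
  (Measure.infinitePi fun _ : ℕ => gaussianMatrix d ℓ).prod
    (Measure.infinitePi fun _ : ℕ => uniformSphere d)

/-- Programs. A program that is cut off (see `boostedSparseShrink`) has no result, but keeps its
final state. -/
abbrev Prog (d ℓ : ℕ) : Type → Type := ReaderT (Tape d ℓ) (OptionT (StateM Machine))

/-- The result, if any, and the final state of a program that is run on the tape `ω`. -/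
def Prog.exec {d ℓ : ℕ} {α : Type} (p : Prog d ℓ α) (ω : Tape d ℓ) (s : Machine) :
    Option α × Machine :=
  StateT.run (OptionT.run (ReaderT.run p ω)) s

section Primitives

variable {d ℓ : ℕ}

/-- Spend `k` units of time. -/
def tick (k : ℕ) : Prog d ℓ Unit :=
  modify fun s => { s with time := s.time + k }

/-- Reserve `k` words of memory. -/
def alloc (k : ℕ) : Prog d ℓ Unit :=
  modify fun s => { s with live := s.live + k, peak := max s.peak (s.live + k) }

/-- Release `k` words of memory. -/
def free (k : ℕ) : Prog d ℓ Unit :=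
  modify fun s => { s with live := s.live - k }

/-- Run `p` while `k` additional words are reserved. -/
def withWords {α : Type} (k : ℕ) (p : Prog d ℓ α) : Prog d ℓ α := do
  alloc k
  let r ← p
  free k
  return r

/-- Execute the loop body `f` exactly `k` times; one unit of time per round for the counter. -/
def repeatTimes {α : Type} (f : α → Prog d ℓ α) : ℕ → α → Prog d ℓ α
  | 0, a => pure a
  | k + 1, a => do
    tick 1
    let b ← f a
    repeatTimes f k b

/-- Number of nonzero entries of a vector. -/
noncomputable def nnzVec (a : Fin d → ℝ) : ℕ := by
  classical exact (Finset.univ.filter fun j => a j ≠ 0).card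

/-- Number of nonzero entries of a matrix. -/
noncomputable def nnz {m d : ℕ} (A : Matrix (Fin m) (Fin d) ℝ) : ℕ :=
  ∑ i, nnzVec (A i)

/-- The squared Frobenius norm. -/
def frobSq {m d : ℕ} (A : Matrix (Fin m) (Fin d) ℝ) : ℝ := ∑ i, ∑ j, A i j ^ 2

/-- Draw `G ∼ N(0,1)^{d × ℓ}`: one unit of time per entry. -/
def drawGaussian : Prog d ℓ (Matrix (Fin d) (Fin ℓ) ℝ) := do
  let ω ← read
  let s ← get
  set { s with gaussianCalls := s.gaussianCalls + 1 }
  tick (d * ℓ)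
  return Matrix.of (ω.1 s.gaussianCalls)

/-- `A x` for a sparse matrix `A` and a dense vector `x`: one multiplication and one addition for
each nonzero entry of `A`, and initialization of the result. -/
noncomputable def sparseMulVec {m : ℕ} (A : Matrix (Fin m) (Fin d) ℝ) (x : Fin d → ℝ) :
    Prog d ℓ (Fin m → ℝ) := do
  tick (2 * nnz A + m)
  return A *ᵥ x

/-- `Aᵀ y` for a sparse matrix `A` and a dense vector `y`. -/
noncomputable def sparseTransposeMulVec {m : ℕ} (A : Matrix (Fin m) (Fin d) ℝ) (y : Fin m → ℝ) :
    Prog d ℓ (Fin d → ℝ) := do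
  tick (2 * nnz A + d)
  return Aᵀ *ᵥ y

/-- `A Y` for a sparse matrix `A` and a dense matrix `Y`, column by column. -/
noncomputable def sparseMul {m k : ℕ} (A : Matrix (Fin m) (Fin d) ℝ)
    (Y : Matrix (Fin d) (Fin k) ℝ) : Prog d ℓ (Matrix (Fin m) (Fin k) ℝ) := do
  tick (k * (2 * nnz A + m))
  return A * Y

/-- `Aᵀ Y` for a sparse matrix `A` and a dense matrix `Y`, column by column. -/
noncomputable def sparseTransposeMul {m k : ℕ} (A : Matrix (Fin m) (Fin d) ℝ)
    (Y : Matrix (Fin m) (Fin k) ℝ) : Prog d ℓ (Matrix (Fin d) (Fin k) ℝ) := do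
  tick (k * (2 * nnz A + d))
  return Aᵀ * Y

/-- `B x` for a dense matrix `B` with `k` rows. -/
def denseMulVec {k : ℕ} (B : Matrix (Fin k) (Fin d) ℝ) (x : Fin d → ℝ) :
    Prog d ℓ (Fin k → ℝ) := do
  tick (2 * (k * d))
  return B *ᵥ x

/-- `Bᵀ y` for a dense matrix `B` with `k` rows. -/
def denseTransposeMulVec {k : ℕ} (B : Matrix (Fin k) (Fin d) ℝ) (y : Fin k → ℝ) :
    Prog d ℓ (Fin d → ℝ) := do
  tick (2 * (k * d))
  return Bᵀ *ᵥ y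

/-- Gram–Schmidt orthonormalization, in place, of the columns of a dense `m × k` matrix (a column
that depends linearly on the previous ones becomes zero). Column `j` takes `j` inner products and
`j` vector updates (`2 m` operations each), one squared norm, a square root and a scaling. -/
noncomputable def gramSchmidtColumns {m k : ℕ} (Y : Matrix (Fin m) (Fin k) ℝ) :
    Prog d ℓ (Matrix (Fin m) (Fin k) ℝ) := do
  tick (∑ j ∈ Finset.range k, (j * (4 * m) + 3 * m + 1))
  return Matrix.of fun i j =>
    InnerProductSpace.gramSchmidtNormed ℝ (fun j' : Fin k => WithLp.toLp 2 (Yᵀ j')) j i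

/-- The matrix whose columns are the right singular vectors of `A` for the `k` largest singular
values, in the order of decreasing singular values. -/
noncomputable def rightSingularVectors {ι : Type} [Fintype ι] (A : Matrix ι (Fin d) ℝ) (k : ℕ) :
    Matrix (Fin d) (Fin k) ℝ :=
  Matrix.of fun i j =>
    if h : (j : ℕ) < d then
      (Matrix.toEuclideanLin A).isSymmetric_adjoint_comp_self.eigenvectorBasis
        (n := d) finrank_euclideanSpace_fin ⟨j, h⟩ i
    else 0

/-- `[H, Λ, V] = SVD(A, k)` for a dense matrix `A` with `d` columns. The factor `H` is used by none
of the algorithms and is not returned; `Λ` is the sequence of all singular values, numbered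
from `0` in decreasing order. On an `r × d` matrix the decomposition takes `K r d min(r, d)` units
of time and `K r d` words of memory, where `K` is the constant of the routine. -/
noncomputable def svd (K : ℕ) {ι : Type} [Fintype ι] (A : Matrix ι (Fin d) ℝ) (k : ℕ) :
    Prog d ℓ ((ℕ → ℝ) × Matrix (Fin d) (Fin k) ℝ) :=
  withWords (K * (Fintype.card ι * d)) do
    tick (K * (Fintype.card ι * d * min (Fintype.card ι) d))
    return (fun i => (Matrix.toEuclideanLin A).singularValues i, rightSingularVectors A k)

end Primitives

/-! ## The algorithms -/

/-- The constants that the description of the algorithms leaves open. -/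
structure Constants where
  /-- the constant in the number `q = Θ(log(m/ε)/ε)` of rounds of SimultaneousIteration -/
  simIter : ℝ
  /-- the constant `c` in the number `c log(d/δᵢ)` of rounds of VerifySpectral -/
  verify : ℝ
  /-- the constant of the dense singular value decomposition -/
  svd : ℕ

section Algorithms

variable {d ℓ : ℕ}

/-- The shrunk sketch `√(Λ² - λ_ℓ² I) Vᵀ`. -/
noncomputable def shrunk (Λ : ℕ → ℝ) (V : Matrix (Fin d) (Fin ℓ) ℝ) : Matrix (Fin ℓ) (Fin d) ℝ :=
  Matrix.diagonal (fun i : Fin ℓ => √(Λ i ^ 2 - Λ (ℓ - 1) ^ 2)) * Vᵀ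

/-- DenseShrink. -/
noncomputable def denseShrink (c : Constants) {ι : Type} [Fintype ι] (A : Matrix ι (Fin d) ℝ) :
    Prog d ℓ (Matrix (Fin ℓ) (Fin d) ℝ) :=
  withWords (2 * ℓ + d * ℓ) do
    let (Λ, V) ← svd c.svd A ℓ
    tick (4 * ℓ + ℓ * d)
    return shrunk Λ V

/-- SimultaneousIteration with rank `ℓ`. The reserved words hold the two blocks of iterates. -/
noncomputable def simultaneousIteration (c : Constants) {m : ℕ} (A : Matrix (Fin m) (Fin d) ℝ)
    (ε : ℝ) : Prog d ℓ (Matrix (Fin m) (Fin ℓ) ℝ) :=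
  withWords (d * ℓ + m * ℓ) do
    let q := ⌈c.simIter * (Real.log (m / ε) / ε)⌉₊
    tick 4
    let G ← drawGaussian
    let Y ← repeatTimes (fun Y => do
      let W ← sparseMul A Y
      sparseTransposeMul A W) q G
    let W ← sparseMul A Y
    gramSchmidtColumns W

/-- SparseShrink. The reserved words hold `Z`, `P`, `Λ`, `√(Λ² - λ_ℓ² I)` and `V`. -/
noncomputable def sparseShrink (c : Constants) {m : ℕ} (A' : Matrix (Fin m) (Fin d) ℝ) :
    Prog d ℓ (Matrix (Fin ℓ) (Fin d) ℝ) :=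
  withWords (m * ℓ + ℓ * d + 2 * ℓ + d * ℓ) do
    let Z ← simultaneousIteration c A' (1 / 4)
    let Pt ← sparseTransposeMul A' Z
    let P := Ptᵀ
    let (Λ, V) ← svd c.svd P ℓ
    tick (4 * ℓ + ℓ * d)
    return shrunk Λ V

open Classical in
/-- VerifySpectral for the matrix `C = (A'ᵀA' - B'ᵀB')/(Δ/2)`, which is only applied to vectors and
never formed (division by zero gives zero; `C` is the zero matrix when `Δ = 0`). A unit vector is
drawn by drawing `d` normal variables and normalizing. The reserved words hold the vectors. -/
noncomputable def verifySpectral (c : Constants) {m : ℕ} (A' : Matrix (Fin m) (Fin d) ℝ)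
    (B' : Matrix (Fin ℓ) (Fin d) ℝ) (Δ δ : ℝ) : Prog d ℓ Bool :=
  withWords (4 * d + m + ℓ) do
    let ω ← read
    let s ← get
    let i := s.verifyCalls + 1
    set { s with verifyCalls := i }
    let δᵢ := δ / (2 * (i : ℝ) ^ 2)
    tick 8
    let x : Fin d → ℝ := fun j => (ω.2 s.verifyCalls : EuclideanSpace ℝ (Fin d)) j
    tick (4 * d + 1)
    let y ← repeatTimes (fun x => do
      let u ← sparseMulVec A' x
      let v ← sparseTransposeMulVec A' u
      let w ← denseMulVec B' x
      let z ← denseTransposeMulVec B' w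
      tick (2 * d)
      return (Δ / 2)⁻¹ • (v - z)) ⌈c.verify * Real.log (d / δᵢ)⌉₊ x
    tick (2 * d + 1)
    return decide (‖WithLp.toLp 2 y‖ ≤ 1)

/-- BoostedSparseShrink. The last argument bounds the number of rounds of the loop: the
computation is cut off when the loop wants to enter one more round. -/
noncomputable def boostedSparseShrink (c : Constants) {m : ℕ} (A' : Matrix (Fin m) (Fin d) ℝ)
    (δ : ℝ) : ℕ → Prog d ℓ (Matrix (Fin ℓ) (Fin d) ℝ)
  | 0 => failure
  | rounds + 1 => do
    let B' ← sparseShrink c A'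
    let Δ := (frobSq A' - frobSq B') / (6 / 41 * ℓ)
    tick (2 * nnz A' + 2 * (ℓ * d) + 4)
    if ← verifySpectral c A' B' Δ δ then
      return B'
    else
      boostedSparseShrink c A' δ rounds

/-- The matrix with the given rows. -/
def ofRows (rows : List (Fin d → ℝ)) : Matrix (Fin rows.length) (Fin d) ℝ :=
  Matrix.of rows.get

/-- Words that a sparse row occupies: a column index and a value for each nonzero entry, and a
pointer to the row. -/
noncomputable def rowWords (a : Fin d → ℝ) : ℕ := 2 * nnzVec a + 1

open Classical in
/-- The loop body of SparseFrequentDirections: one row `a` arrives while the sketch is `B` and the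
buffer `A'` has the given rows. -/
noncomputable def processRow (c : Constants) (δ : ℝ) (rounds : ℕ)
    (state : Matrix (Fin ℓ) (Fin d) ℝ × List (Fin d → ℝ)) (a : Fin d → ℝ) :
    Prog d ℓ (Matrix (Fin ℓ) (Fin d) ℝ × List (Fin d → ℝ)) := do
  let (B, rows) := state
  let rows := rows ++ [a]
  alloc (rowWords a)
  tick (rowWords a + 5)
  let A' := ofRows rows
  if ℓ * d ≤ nnz A' ∨ rows.length = d then
    let B' ← boostedSparseShrink c A' δ rounds
    let B ← denseShrink c (Matrix.fromRows B B')
    free (rows.map rowWords).sum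
    tick 1
    return (B, [])
  else
    return (B, rows)

/-- SparseFrequentDirections on the stream of the rows of `A`, where each loop of
BoostedSparseShrink is cut off after `rounds` rounds. The reserved words hold `B`, `B'` and
the scalar variables. -/
noncomputable def sparseFrequentDirections (c : Constants) {n : ℕ} (A : Matrix (Fin n) (Fin d) ℝ)
    (δ : ℝ) (rounds : ℕ) : Prog d ℓ (Matrix (Fin ℓ) (Fin d) ℝ) :=
  withWords (2 * (ℓ * d) + 16) do
    tick 1
    let (B, _) ← (List.ofFn fun i => A i).foldlM (processRow c δ rounds) (0, [])
    return B

end Algorithms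

/-! ## Resources of a run -/

/-- The running time of SparseFrequentDirections on the tape `ω`, with no bound on the number of
rounds of the loops. It is infinite if a loop never ends, since each round takes time. -/
noncomputable def runningTime (c : Constants) {n d : ℕ} (A : Matrix (Fin n) (Fin d) ℝ) (ℓ : ℕ)
    (δ : ℝ) (ω : Tape d ℓ) : ℝ≥0∞ :=
  ⨆ rounds : ℕ, (((sparseFrequentDirections c A δ rounds).exec ω Machine.init).2.time : ℝ≥0∞)

/-- The memory footprint on the tape `ω`: the largest number of words in use simultaneously. -/
noncomputable def memoryFootprint (c : Constants) {n d : ℕ} (A : Matrix (Fin n) (Fin d) ℝ) (ℓ : ℕ)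
    (δ : ℝ) (ω : Tape d ℓ) : ℝ≥0∞ :=
  ⨆ rounds : ℕ, (((sparseFrequentDirections c A δ rounds).exec ω Machine.init).2.peak : ℝ≥0∞)

end SparseFD

/-! Memory is deterministic. Every subroutine returns the words it reserves, and just before its
last row arrives the buffer has fewer than ℓd nonzero entries and fewer than d rows; hence O(dℓ)
words are in use at any moment (`memoryFootprint_le`).

For the time, the moments at which the buffer is flushed and its contents depend on A alone; only
the numbers of rounds are random. Whatever unit vector is drawn, the Gaussian matrix makes a round
fail with probability at most 1/2 (`measure_not_accepts_le`). Indeed, let P = ZᵀA and let λ be the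
ℓ-th eigenvalue of PᵀP. If PᵀP ≤ AᵀA ≤ PᵀP + (29/12)λ, then the tested operator lies between 0 and
1, so it is a contraction and every unit vector is accepted (`norm_iterate_verifyMap_shrinkOf_le`).
Power iteration produces such a P as soon as, for all a, the part of Ga along the remaining
eigenvectors with nonzero eigenvalue is at most a polynomial factor in m larger than the part along
the top ℓ ones (`accepts_of_wellConditioned`, `powerRounds_bounds`). For Gaussian G, the lower bound
on the top part comes from Cramer's rule: given the other columns, the determinant is a Gaussian
linear form in one column whose coefficients are the cofactors (`measure_det_lt_le`). The upper
bound on the rest is Markov's inequality (`lintegral_sum_inner_sq`).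

A full buffer with m rows and N nonzero entries satisfies ℓd ≤ N + mℓ, and log(k+1) ≤ log n + k/n;
so a round at call k+1 costs a constant times `workload` times 1 + k/n (`roundTime_le`). A potential
that equals the expected remaining cost when each round succeeds with probability exactly 1/2 bounds
the expected total (`tsum_lintegral_progress_le`). Since `workload` is linear in (m, N), the
contributions of the buffers add up to at most that of A.

Measurability is not obvious, because the singular vectors are an arbitrary choice. The verdict
depends on the sketch B only through BᵀB, though, which is the positive part of PᵀP − λ and is
continuous in P (`continuous_gram_shrinkOf`). -/

namespace SparseFD

/-! ### Compositional rules for time, draw counters and memory of programs. -/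

section Semantics

variable {d ℓ : ℕ} {α β : Type}

theorem exec_bind (p : Prog d ℓ α) (f : α → Prog d ℓ β) (ω : Tape d ℓ) (s : Machine) :
    (p >>= f).exec ω s =
      match p.exec ω s with
      | (some a, s') => (f a).exec ω s'
      | (none, s') => (none, s') := by
  change (do
    match ← (ReaderT.run p ω).run with
    | some a => (ReaderT.run (f a) ω).run
    | none => pure none : StateM Machine (Option β)).run s = _
  change (match p.exec ω s with
    | (r, s') => (match r with
      | some a => (ReaderT.run (f a) ω).run
      | none => (pure none : StateM Machine (Option β))) s') = _
  rcases p.exec ω s with ⟨_ | a, s'⟩ <;> rfl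

theorem exec_bind_some {p : Prog d ℓ α} {ω : Tape d ℓ} {s s' : Machine} {a : α}
    (h : p.exec ω s = (some a, s')) (f : α → Prog d ℓ β) :
    (p >>= f).exec ω s = (f a).exec ω s' := by
  rw [exec_bind, h]

/-- Started with the draw counters `i` and `j`, the program `p` returns `r` after `t` units of time,
with the draw counters `i'` and `j'`, releases the memory it reserved, and has never more than `k`
additional words in use. -/
def Runs (p : Prog d ℓ α) (ω : Tape d ℓ) (i j : ℕ) (r : α) (t i' j' k : ℕ) : Prop :=
  ∀ s : Machine, s.gaussianCalls = i → s.verifyCalls = j →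
    ∃ s' : Machine, p.exec ω s = (some r, s') ∧ s'.time = s.time + t ∧ s'.gaussianCalls = i' ∧
      s'.verifyCalls = j' ∧ s'.live = s.live ∧ s'.peak ≤ max s.peak (s.live + k)

variable {ω : Tape d ℓ} {i j i' j' i'' j'' : ℕ}

theorem Runs.pure (r : α) : Runs (pure r) ω i j r 0 i j 0 :=
  fun s hi hj => ⟨s, rfl, rfl, hi, hj, rfl, le_max_left _ _⟩

/-- Times add, but extra memory is only a maximum: `p` has returned its words before `f` starts. -/
theorem Runs.bind {p : Prog d ℓ α} {f : α → Prog d ℓ β} {r : α} {r' : β} {t t' k k' : ℕ}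
    (hp : Runs p ω i j r t i' j' k) (hf : Runs (f r) ω i' j' r' t' i'' j'' k') :
    Runs (p >>= f) ω i j r' (t + t') i'' j'' (max k k') := by
  intro s hi hj
  obtain ⟨s₁, e₁, ht₁, hi₁, hj₁, hl₁, hk₁⟩ := hp s hi hj
  obtain ⟨s₂, e₂, ht₂, hi₂, hj₂, hl₂, hk₂⟩ := hf s₁ hi₁ hj₁
  refine ⟨s₂, by rw [exec_bind_some e₁, e₂], by omega, hi₂, hj₂, by omega, ?_⟩
  rw [hl₁] at hk₂
  omega

theorem Runs.mono {p : Prog d ℓ α} {r : α} {t t' k k' : ℕ} (hp : Runs p ω i j r t i' j' k)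
    (ht : t = t') (hk : k ≤ k') : Runs p ω i j r t' i' j' k' := by
  intro s hi hj
  obtain ⟨s₁, e₁, ht₁, hi₁, hj₁, hl₁, hk₁⟩ := hp s hi hj
  exact ⟨s₁, e₁, by omega, hi₁, hj₁, hl₁, by omega⟩

theorem Runs.tick (t : ℕ) : Runs (tick t : Prog d ℓ Unit) ω i j () t i j 0 :=
  fun s hi hj => ⟨{ s with time := s.time + t }, rfl, rfl, hi, hj, rfl, le_max_left _ _⟩

theorem Runs.withWords {p : Prog d ℓ α} {r : α} {t k : ℕ} (w : ℕ)
    (hp : Runs p ω i j r t i' j' k) : Runs (withWords w p) ω i j r t i' j' (w + k) := by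
  intro s hi hj
  obtain ⟨s₁, e₁, ht₁, hi₁, hj₁, hl₁, hk₁⟩ :=
    hp { s with live := s.live + w, peak := max s.peak (s.live + w) } hi hj
  refine ⟨{ s₁ with live := s₁.live - w }, ?_, ht₁, hi₁, hj₁, ?_, ?_⟩
  · unfold SparseFD.withWords
    rw [exec_bind_some (a := ()) (s' := { s with live := s.live + w, peak := max s.peak (s.live + w) })
      rfl, exec_bind_some e₁]
    rfl
  · simp only at hl₁ ⊢; omega
  · simp only at hk₁ ⊢; omega

theorem Runs.tick_return (t : ℕ) (r : α) :
    Runs (do SparseFD.tick t; return r : Prog d ℓ α) ω i j r t i j 0 :=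
  ((Runs.tick t).bind (f := fun _ => Pure.pure r) (Runs.pure r)).mono rfl le_rfl

/-- The body must leave the draw counters alone. This suffices, since the only loop that draws is
that of BoostedSparseShrink, which is treated separately. -/
theorem Runs.repeatTimes {f : α → Prog d ℓ α} {g : α → α} {t k : ℕ}
    (hf : ∀ a, Runs (f a) ω i j (g a) t i j k) (n : ℕ) (a : α) :
    Runs (repeatTimes f n a) ω i j (g^[n] a) (n * (1 + t)) i j k := by
  induction n generalizing a with
  | zero => exact (Runs.pure a).mono (by simp) (Nat.zero_le _)
  | succ n ih =>
    exact ((Runs.tick 1).bind ((hf a).bind (ih (g a)))).mono (by ring) (by simp)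

end Semantics

/-! ### Exact resources and results of the subroutines. -/

section Subroutines

variable {d ℓ : ℕ} {ω : Tape d ℓ} {i j : ℕ}

/-- Columnwise Gram–Schmidt orthonormalization. -/
noncomputable def orthonormalized {m k : ℕ} (Y : Matrix (Fin m) (Fin k) ℝ) :
    Matrix (Fin m) (Fin k) ℝ :=
  Matrix.of fun i j =>
    InnerProductSpace.gramSchmidtNormed ℝ (fun j' : Fin k => WithLp.toLp 2 (Yᵀ j')) j i

/-- Time of columnwise Gram–Schmidt orthonormalization. -/
def gramSchmidtTime (m k : ℕ) : ℕ := ∑ j ∈ Finset.range k, (j * (4 * m) + 3 * m + 1)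

theorem runs_gramSchmidtColumns {m k : ℕ} (Y : Matrix (Fin m) (Fin k) ℝ) :
    Runs (gramSchmidtColumns Y : Prog d ℓ _) ω i j (orthonormalized Y) (gramSchmidtTime m k) i j 0 :=
  Runs.tick_return _ _

theorem runs_svd (K : ℕ) {ι : Type} [Fintype ι] (A : Matrix ι (Fin d) ℝ) (k : ℕ) :
    Runs (svd K A k : Prog d ℓ _) ω i j
      (fun i => (Matrix.toEuclideanLin A).singularValues i, rightSingularVectors A k)
      (K * (Fintype.card ι * d * min (Fintype.card ι) d)) i j (K * (Fintype.card ι * d)) :=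
  ((Runs.tick_return _ _).withWords _).mono rfl le_rfl

/-- The sketch that is computed from the singular value decomposition of `A`. -/
noncomputable def shrinkOf {ι : Type} [Fintype ι] (ℓ : ℕ) (A : Matrix ι (Fin d) ℝ) :
    Matrix (Fin ℓ) (Fin d) ℝ :=
  shrunk (fun i => (Matrix.toEuclideanLin A).singularValues i) (rightSingularVectors A ℓ)

/-- Time of DenseShrink on a matrix with `r` rows. -/
def denseShrinkTime (K d ℓ r : ℕ) : ℕ := K * (r * d * min r d) + (4 * ℓ + ℓ * d)

theorem runs_denseShrink (c : Constants) {ι : Type} [Fintype ι] (A : Matrix ι (Fin d) ℝ) :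
    Runs (denseShrink c A : Prog d ℓ _) ω i j (shrinkOf ℓ A)
      (denseShrinkTime c.svd d ℓ (Fintype.card ι)) i j
      (2 * ℓ + d * ℓ + c.svd * (Fintype.card ι * d)) :=
  (((runs_svd c.svd A ℓ).bind (Runs.tick_return _ _)).withWords _).mono rfl (by simp)

/-- Number of rounds of SimultaneousIteration with `ε = 1/4` on a matrix with `m` rows. -/
noncomputable def powerRounds (c : Constants) (m : ℕ) : ℕ :=
  ⌈c.simIter * (Real.log (m / (1 / 4)) / (1 / 4))⌉₊

/-- `(AᵀA)^q G`. -/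
def powerIterate {m k : ℕ} (A : Matrix (Fin m) (Fin d) ℝ) (q : ℕ)
    (G : Matrix (Fin d) (Fin k) ℝ) : Matrix (Fin d) (Fin k) ℝ :=
  (fun Y => Aᵀ * (A * Y))^[q] G

theorem runs_drawGaussian :
    Runs (drawGaussian : Prog d ℓ _) ω i j (Matrix.of (ω.1 i)) (d * ℓ) (i + 1) j 0 := by
  intro s hi hj
  refine ⟨⟨s.time + d * ℓ, s.live, s.peak, s.gaussianCalls + 1, s.verifyCalls⟩, ?_, rfl, ?_, hj,
    rfl, le_max_left _ _⟩
  · subst hi; rfl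
  · simp [hi]

/-- Time of SimultaneousIteration. -/
noncomputable def simultaneousIterationTime (c : Constants) (d ℓ m N : ℕ) : ℕ :=
  4 + d * ℓ + powerRounds c m * (1 + (ℓ * (2 * N + m) + ℓ * (2 * N + d))) + ℓ * (2 * N + m) +
    gramSchmidtTime m ℓ

theorem runs_simultaneousIteration (c : Constants) {m : ℕ} (A : Matrix (Fin m) (Fin d) ℝ) :
    Runs (simultaneousIteration c A (1 / 4) : Prog d ℓ _) ω i j
      (orthonormalized (A * powerIterate A (powerRounds c m) (Matrix.of (ω.1 i))))
      (simultaneousIterationTime c d ℓ m (nnz A)) (i + 1) j (d * ℓ + m * ℓ) := by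
  refine (((Runs.tick 4).bind (runs_drawGaussian.bind ((Runs.repeatTimes
    (t := ℓ * (2 * nnz A + m) + ℓ * (2 * nnz A + d)) (k := 0)
    (g := fun Y : Matrix (Fin d) (Fin ℓ) ℝ => Aᵀ * (A * Y)) (fun Y => ?_) (powerRounds c m)
      (Matrix.of (ω.1 i))).bind ((Runs.tick_return (ℓ * (2 * nnz A + m)) (A * powerIterate A
        (powerRounds c m) (Matrix.of (ω.1 i)))).bind
      (runs_gramSchmidtColumns (A * powerIterate A (powerRounds c m) (Matrix.of (ω.1 i)))))))).withWords
    _).mono ?_ ?_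
  · exact ((Runs.tick_return _ _).bind (Runs.tick_return _ _)).mono rfl (by simp)
  · unfold simultaneousIterationTime powerRounds; ring
  · simp

/-- The projection `P = ZᵀA` that SparseShrink decomposes. -/
noncomputable def projected (c : Constants) {m : ℕ} (A : Matrix (Fin m) (Fin d) ℝ)
    (G : Matrix (Fin d) (Fin ℓ) ℝ) : Matrix (Fin ℓ) (Fin d) ℝ :=
  (Aᵀ * orthonormalized (A * powerIterate A (powerRounds c m) G))ᵀ

/-- Time of SparseShrink. -/
noncomputable def sparseShrinkTime (c : Constants) (d ℓ m N : ℕ) : ℕ :=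
  simultaneousIterationTime c d ℓ m N + ℓ * (2 * N + d) + c.svd * (ℓ * d * min ℓ d) +
    (4 * ℓ + ℓ * d)

/-- Memory of SparseShrink. -/
def sparseShrinkWords (K d ℓ m : ℕ) : ℕ :=
  m * ℓ + ℓ * d + 2 * ℓ + d * ℓ + (d * ℓ + m * ℓ + K * (ℓ * d))

theorem runs_sparseShrink (c : Constants) {m : ℕ} (A : Matrix (Fin m) (Fin d) ℝ) :
    Runs (sparseShrink c A : Prog d ℓ _) ω i j (shrinkOf ℓ (projected c A (Matrix.of (ω.1 i))))
      (sparseShrinkTime c d ℓ m (nnz A)) (i + 1) j (sparseShrinkWords c.svd d ℓ m) := by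
  refine (((runs_simultaneousIteration c A).bind ((Runs.tick_return _ _).bind
    ((runs_svd c.svd _ ℓ).bind (Runs.tick_return _ _)))).withWords _).mono ?_ ?_
  · simp only [sparseShrinkTime, Fintype.card_fin]; ring
  · simp only [sparseShrinkWords, Fintype.card_fin]
    have := Nat.zero_le (c.svd * (ℓ * d))
    omega

/-- Number of rounds of VerifySpectral at its call number `i + 1`. -/
noncomputable def verifyRounds (c : Constants) (d : ℕ) (δ : ℝ) (i : ℕ) : ℕ :=
  ⌈c.verify * Real.log (d / (δ / (2 * ((i + 1 : ℕ) : ℝ) ^ 2)))⌉₊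

/-- The action of `(AᵀA - BᵀB)/(Δ/2)` on a vector. -/
noncomputable def verifyMap {m k : ℕ} (A : Matrix (Fin m) (Fin d) ℝ) (B : Matrix (Fin k) (Fin d) ℝ)
    (Δ : ℝ) (x : Fin d → ℝ) : Fin d → ℝ :=
  (Δ / 2)⁻¹ • (Aᵀ *ᵥ (A *ᵥ x) - Bᵀ *ᵥ (B *ᵥ x))

/-- Time of VerifySpectral. -/
noncomputable def verifyTime (c : Constants) (d ℓ m N : ℕ) (δ : ℝ) (i : ℕ) : ℕ :=
  8 + (4 * d + 1) + verifyRounds c d δ i *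
    (1 + (2 * N + m + (2 * N + d) + 2 * (ℓ * d) + 2 * (ℓ * d) + 2 * d)) + (2 * d + 1)

open Classical in
theorem runs_verifySpectral (c : Constants) {m : ℕ} (A : Matrix (Fin m) (Fin d) ℝ)
    (B : Matrix (Fin ℓ) (Fin d) ℝ) (Δ δ : ℝ) :
    Runs (verifySpectral c A B Δ δ : Prog d ℓ _) ω i j
      (decide (‖WithLp.toLp 2 ((verifyMap A B Δ)^[verifyRounds c d δ j]
        (fun j' => (ω.2 j : EuclideanSpace ℝ (Fin d)) j'))‖ ≤ 1))
      (verifyTime c d ℓ m (nnz A) δ j) i (j + 1) (4 * d + m + ℓ) := by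
  refine (Runs.withWords (k := 0) _ ?_).mono rfl (by simp)
  -- The remainder of the program after the counter has been increased: the vector is still the draw
  -- number `j`, while the counter already shows `j + 1`.
  have key : Runs (do
      tick 8
      tick (4 * d + 1)
      let y ← repeatTimes (fun x => do
        let u ← sparseMulVec A x
        let v ← sparseTransposeMulVec A u
        let w ← denseMulVec B x
        let z ← denseTransposeMulVec B w
        tick (2 * d)
        return (Δ / 2)⁻¹ • (v - z)) (verifyRounds c d δ j)
          (fun j' => (ω.2 j : EuclideanSpace ℝ (Fin d)) j')
      tick (2 * d + 1)
      return decide (‖WithLp.toLp 2 y‖ ≤ 1) : Prog d ℓ Bool) ω i (j + 1)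
      (decide (‖WithLp.toLp 2 ((verifyMap A B Δ)^[verifyRounds c d δ j]
        (fun j' => (ω.2 j : EuclideanSpace ℝ (Fin d)) j'))‖ ≤ 1))
      (verifyTime c d ℓ m (nnz A) δ j) i (j + 1) 0 := by
    refine ((Runs.tick _).bind ((Runs.tick _).bind ((Runs.repeatTimes
      (t := 2 * nnz A + m + (2 * nnz A + d) + 2 * (ℓ * d) + 2 * (ℓ * d) + 2 * d) (k := 0)
      (g := verifyMap A B Δ) (fun Y => ?_) _ _).bind (Runs.tick_return _ _)))).mono ?_ ?_
    · exact ((Runs.tick_return _ _).bind ((Runs.tick_return _ _).bind ((Runs.tick_return _ _).bind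
        ((Runs.tick_return _ _).bind (Runs.tick_return _ _))))).mono (by ring) (by simp)
    · unfold verifyTime; ring
    · simp
  intro s hi hj
  obtain ⟨s', e, h⟩ := key { s with verifyCalls := s.verifyCalls + 1 } hi (by simp [hj])
  refine ⟨s', ?_, h⟩
  rw [← e]
  subst hj
  rfl

/-- The verdict of VerifySpectral in a round of BoostedSparseShrink on the draws `G` and `x`, at the
call number `i + 1`. -/
def Accepts (c : Constants) {m : ℕ} (A : Matrix (Fin m) (Fin d) ℝ) (δ : ℝ) (i : ℕ)
    (G : Fin d → Fin ℓ → ℝ) (x : UnitSphere d) : Prop :=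
  ‖WithLp.toLp 2 ((verifyMap A (shrinkOf ℓ (projected c A (Matrix.of G)))
    ((frobSq A - frobSq (shrinkOf ℓ (projected c A (Matrix.of G)))) / (6 / 41 * ℓ)))^[
      verifyRounds c d δ i] (fun j => (x : EuclideanSpace ℝ (Fin d)) j))‖ ≤ 1

/-- Time of a round of BoostedSparseShrink at the call number `i + 1` of VerifySpectral. -/
noncomputable def roundTime (c : Constants) (d ℓ m N : ℕ) (δ : ℝ) (i : ℕ) : ℕ :=
  sparseShrinkTime c d ℓ m N + (2 * N + 2 * (ℓ * d) + 4) + verifyTime c d ℓ m N δ i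

/-- Memory of BoostedSparseShrink. -/
def roundWords (K d ℓ m : ℕ) : ℕ := max (sparseShrinkWords K d ℓ m) (4 * d + m + ℓ)

open Classical in
/-- Where a loop that starts at the index `i` and is cut off after `R` rounds ends, and whether it
ends because of an accepted round. -/
noncomputable def loopEnd (acc : ℕ → Prop) : ℕ → ℕ → ℕ × Bool
  | 0, i => (i, false)
  | R + 1, i => if acc i then (i + 1, true) else loopEnd acc R (i + 1)

theorem le_loopEnd (acc : ℕ → Prop) (R i : ℕ) : i ≤ (loopEnd acc R i).1 := by
  induction R generalizing i with
  | zero => exact le_rfl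
  | succ R ih =>
    rw [loopEnd]
    split_ifs
    · simp
    · exact (Nat.le_succ i).trans (ih _)

-- Each round consumes one Gaussian matrix and one unit vector, so a single index `i` describes both
-- counters. Time and memory are also tracked for a run that is cut off, since the running time is a
-- supremum over cut-off runs.
open Classical in
theorem exec_boostedSparseShrink (c : Constants) {m : ℕ} (A : Matrix (Fin m) (Fin d) ℝ) (δ : ℝ)
    (ω : Tape d ℓ) (R i : ℕ) (s : Machine) (hg : s.gaussianCalls = i) (hv : s.verifyCalls = i) :
    ∃ r s', (boostedSparseShrink c A δ R : Prog d ℓ _).exec ω s = (r, s') ∧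
      r.isSome = (loopEnd (fun k => Accepts c A δ k (ω.1 k) (ω.2 k)) R i).2 ∧
      s'.time = s.time + ∑ k ∈ Finset.Ico i
        (loopEnd (fun k => Accepts c A δ k (ω.1 k) (ω.2 k)) R i).1, roundTime c d ℓ m (nnz A) δ k ∧
      s'.gaussianCalls = (loopEnd (fun k => Accepts c A δ k (ω.1 k) (ω.2 k)) R i).1 ∧
      s'.verifyCalls = (loopEnd (fun k => Accepts c A δ k (ω.1 k) (ω.2 k)) R i).1 ∧
      s'.live = s.live ∧ s'.peak ≤ max s.peak (s.live + roundWords c.svd d ℓ m) := by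
  induction R generalizing i s with
  | zero => exact ⟨none, s, rfl, rfl, by simp [loopEnd], hg, hv, rfl, le_max_left _ _⟩
  | succ R ih =>
    obtain ⟨s₁, e₁, ht₁, hg₁, hv₁, hl₁, hk₁⟩ := runs_sparseShrink (ω := ω) (j := i) c A s hg hv
    obtain ⟨s₂, e₂, ht₂, hg₂, hv₂, hl₂, hk₂⟩ :=
      (Runs.tick (ω := ω) (2 * nnz A + 2 * (ℓ * d) + 4)) s₁ hg₁ hv₁
    obtain ⟨s₃, e₃, ht₃, hg₃, hv₃, hl₃, hk₃⟩ :=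
      (runs_verifySpectral (ω := ω) c A (shrinkOf ℓ (projected c A (Matrix.of (ω.1 i))))
        ((frobSq A - frobSq (shrinkOf ℓ (projected c A (Matrix.of (ω.1 i))))) / (6 / 41 * ℓ)) δ)
        s₂ hg₂ hv₂
    have hpeak : s₃.peak ≤ max s.peak (s.live + roundWords c.svd d ℓ m) := by
      unfold roundWords; omega
    have htime : s₃.time = s.time + roundTime c d ℓ m (nnz A) δ i := by
      unfold roundTime; omega
    have hstep : (boostedSparseShrink c A δ (R + 1) : Prog d ℓ _).exec ω s =
        (if decide (Accepts c A δ i (ω.1 i) (ω.2 i)) = true then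
          (pure (shrinkOf ℓ (projected c A (Matrix.of (ω.1 i)))) : Prog d ℓ _)
          else boostedSparseShrink c A δ R).exec ω s₃ := by
      rw [boostedSparseShrink, exec_bind_some e₁, exec_bind_some e₂, exec_bind_some e₃]
      rfl
    rw [hstep, loopEnd]
    by_cases hacc : Accepts c A δ i (ω.1 i) (ω.2 i)
    · simp only [hacc, if_true]
      exact ⟨some _, s₃, rfl, rfl, by simp [htime], hg₃, hv₃, by omega, hpeak⟩
    · simp only [hacc, decide_false, if_false]
      obtain ⟨r, s', e, hr, ht, hg', hv', hl, hk⟩ := ih (i + 1) s₃ hg₃ hv₃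
      refine ⟨r, s', e, hr, ?_, hg', hv', by omega, by omega⟩
      rw [ht, htime, Finset.sum_eq_sum_Ico_succ_bot
        (Nat.lt_of_succ_le (le_loopEnd _ R (i + 1))), add_assoc]

end Subroutines

/-! ### The main loop: its exact time and the deterministic memory bound. -/

section Stream

variable {d : ℕ}

/-- The buffer with the rows `rows` is ready to be shrunk. -/
def IsFull (ℓ : ℕ) (rows : List (Fin d → ℝ)) : Prop :=
  ℓ * d ≤ nnz (ofRows rows) ∨ rows.length = d

theorem nnz_ofRows (rows : List (Fin d → ℝ)) : nnz (ofRows rows) = (rows.map nnzVec).sum := by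
  unfold nnz ofRows
  rw [← Fin.sum_univ_fun_getElem]
  rfl

theorem nnzVec_le (a : Fin d → ℝ) : nnzVec a ≤ d := by
  unfold nnzVec
  exact (Finset.card_filter_le _ _).trans (by simp)

theorem sum_rowWords (rows : List (Fin d → ℝ)) :
    (rows.map rowWords).sum = 2 * nnz (ofRows rows) + rows.length := by
  rw [nnz_ofRows]
  induction rows with
  | nil => simp
  | cons a rows ih => simp only [List.map_cons, List.sum_cons, ih, rowWords, List.length_cons]; ring

theorem nnz_ofRows_append (rows : List (Fin d → ℝ)) (a : Fin d → ℝ) :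
    nnz (ofRows (rows ++ [a])) = nnz (ofRows rows) + nnzVec a := by
  simp [nnz_ofRows]

open Classical in
/-- Time of SparseFrequentDirections on the rest of the stream when the buffer has the rows `rows`
and `i` rounds of BoostedSparseShrink are over. -/
noncomputable def streamTime {ℓ : ℕ} (c : Constants) (δ : ℝ) (R : ℕ) (ω : Tape d ℓ) :
    List (Fin d → ℝ) → List (Fin d → ℝ) → ℕ → ℕ
  | [], _, _ => 0
  | a :: rest, rows, i =>
    rowWords a + 5 +
      if IsFull ℓ (rows ++ [a]) then
        let e := loopEnd (fun k => Accepts c (ofRows (rows ++ [a])) δ k (ω.1 k) (ω.2 k)) R i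
        ∑ k ∈ Finset.Ico i e.1,
          roundTime c d ℓ (rows ++ [a]).length (nnz (ofRows (rows ++ [a]))) δ k +
        if e.2 then denseShrinkTime c.svd d ℓ (ℓ + ℓ) + 1 + streamTime c δ R ω rest [] e.1 else 0
      else streamTime c δ R ω rest (rows ++ [a]) i

/-- Memory for the buffer and for the subroutines. -/
def streamWords (K d ℓ : ℕ) : ℕ :=
  2 * (ℓ * d) + 3 * d + max (roundWords K d ℓ d) (2 * ℓ + d * ℓ + K * ((ℓ + ℓ) * d))

theorem roundWords_mono {K d ℓ m m' : ℕ} (h : m ≤ m') :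
    roundWords K d ℓ m ≤ roundWords K d ℓ m' := by
  unfold roundWords sparseShrinkWords
  gcongr

/-- The invariant is that the buffer is not full between rows. One more row adds at most d nonzero
entries, so even a full buffer occupies at most 2ℓd + 3d words; the rest of `streamWords` pays for
the subroutine that is running. -/
theorem exec_foldlM_processRow {ℓ : ℕ} (c : Constants) (δ : ℝ) (R : ℕ) (ω : Tape d ℓ) (hd : 0 < d)
    (hℓ : 0 < ℓ) (base : ℕ) (L : List (Fin d → ℝ)) (rows : List (Fin d → ℝ))
    (B : Matrix (Fin ℓ) (Fin d) ℝ) (i : ℕ) (s : Machine) (hg : s.gaussianCalls = i)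
    (hv : s.verifyCalls = i) (hlive : s.live = base + (rows.map rowWords).sum)
    (hnnz : nnz (ofRows rows) < ℓ * d) (hlen : rows.length < d) :
    ∃ r s', (L.foldlM (processRow c δ R) (B, rows) : Prog d ℓ _).exec ω s = (r, s') ∧
      s'.time = s.time + streamTime c δ R ω L rows i ∧
      s'.peak ≤ max s.peak (base + streamWords c.svd d ℓ) := by
  induction L generalizing rows B i s with
  | nil => exact ⟨some (B, rows), s, rfl, rfl, le_max_left _ _⟩
  | cons a L ih =>
    rw [List.foldlM_cons]
    set rows' := rows ++ [a] with hrows'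
    have hsum : (rows'.map rowWords).sum = (rows.map rowWords).sum + rowWords a := by
      simp [hrows']
    have hlen' : rows'.length ≤ d := by simp [hrows']; omega
    have hnnz' : nnz (ofRows rows') < ℓ * d + d := by
      rw [hrows', nnz_ofRows_append]
      have := nnzVec_le a
      omega
    have hwords : (rows'.map rowWords).sum ≤ 2 * (ℓ * d) + 3 * d := by
      rw [sum_rowWords]; omega
    let s₁ : Machine := ⟨s.time + (rowWords a + 5), s.live + rowWords a,
      max s.peak (s.live + rowWords a), s.gaussianCalls, s.verifyCalls⟩
    have hs₁ : s₁.live = base + (rows'.map rowWords).sum := by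
      simp only [s₁]; omega
    have hp₁ : s₁.peak ≤ max s.peak (base + streamWords c.svd d ℓ) := by
      simp only [s₁, streamWords]; omega
    by_cases hfull : ℓ * d ≤ nnz (ofRows rows') ∨ rows'.length = d
    · obtain ⟨r, s₂, e₂, hr₂, ht₂, hg₂, hv₂, hl₂, hk₂⟩ :=
        exec_boostedSparseShrink c (ofRows rows') δ ω R i s₁ hg hv
      have hmono := roundWords_mono (K := c.svd) (ℓ := ℓ) (d := d) hlen'
      have hp₂ : s₂.peak ≤ max s.peak (base + streamWords c.svd d ℓ) := by
        refine hk₂.trans (max_le hp₁ (le_max_of_le_right ?_))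
        simp only [streamWords]; omega
      set e := loopEnd (fun k => Accepts c (ofRows rows') δ k (ω.1 k) (ω.2 k)) R i with he
      have htime : streamTime c δ R ω (a :: L) rows i = rowWords a + 5 +
          (∑ k ∈ Finset.Ico i e.1, roundTime c d ℓ rows'.length (nnz (ofRows rows')) δ k +
            if e.2 then denseShrinkTime c.svd d ℓ (ℓ + ℓ) + 1 + streamTime c δ R ω L [] e.1
            else 0) := by
        rw [streamTime, if_pos (show IsFull ℓ (rows ++ [a]) from hfull)]
      rcases r with _ | B'
      · have hstep : (processRow c δ R (B, rows) a : Prog d ℓ _).exec ω s = (none, s₂) := by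
          unfold processRow
          rw [exec_bind_some (a := ()) (s' := ⟨s.time, s.live + rowWords a,
            max s.peak (s.live + rowWords a), s.gaussianCalls, s.verifyCalls⟩) rfl,
            exec_bind_some (a := ()) (s' := s₁) rfl]
          simp only [← hrows']
          rw [if_pos hfull, exec_bind, e₂]
        refine ⟨none, s₂, ?_, ?_, hp₂⟩
        · rw [exec_bind, hstep]
        · rw [htime, ht₂, ← hr₂]; simp [s₁]; ring
      · obtain ⟨s₃, e₃, ht₃, hg₃, hv₃, hl₃, hk₃⟩ :=
          runs_denseShrink (ω := ω) (ℓ := ℓ) c (Matrix.fromRows B B') s₂ hg₂ hv₂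
        let s₄ : Machine := ⟨s₃.time + 1, s₃.live - (rows'.map rowWords).sum, s₃.peak,
          s₃.gaussianCalls, s₃.verifyCalls⟩
        have hstep : (processRow c δ R (B, rows) a : Prog d ℓ _).exec ω s =
            (some (shrinkOf ℓ (Matrix.fromRows B B'), []), s₄) := by
          unfold processRow
          rw [exec_bind_some (a := ()) (s' := ⟨s.time, s.live + rowWords a,
            max s.peak (s.live + rowWords a), s.gaussianCalls, s.verifyCalls⟩) rfl,
            exec_bind_some (a := ()) (s' := s₁) rfl]
          simp only [← hrows']
          rw [if_pos hfull, exec_bind_some e₂, exec_bind_some e₃]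
          rfl
        have hp₃ : s₃.peak ≤ max s.peak (base + streamWords c.svd d ℓ) := by
          refine hk₃.trans (max_le hp₂ (le_max_of_le_right ?_))
          simp only [streamWords, Fintype.card_sum, Fintype.card_fin]; omega
        rw [exec_bind_some hstep]
        obtain ⟨r, s', e', ht', hk'⟩ := ih [] (shrinkOf ℓ (Matrix.fromRows B B')) e.1 s₄ hg₃ hv₃
          (by simp only [s₄, List.map_nil, List.sum_nil]; omega)
          (by rw [nnz_ofRows]; simpa using ⟨hℓ, hd⟩) (by simpa using hd)
        refine ⟨r, s', e', ?_, hk'.trans (max_le hp₃ (le_max_right _ _))⟩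
        have he2 : e.2 = true := by rw [← hr₂]; rfl
        rw [ht', htime, if_pos he2]
        simp only [s₄, ht₃, ht₂, s₁, Fintype.card_sum, Fintype.card_fin]
        ring
    · have hstep : (processRow c δ R (B, rows) a : Prog d ℓ _).exec ω s =
          (some (B, rows'), s₁) := by
        unfold processRow
        rw [exec_bind_some (a := ()) (s' := ⟨s.time, s.live + rowWords a,
            max s.peak (s.live + rowWords a), s.gaussianCalls, s.verifyCalls⟩) rfl,
            exec_bind_some (a := ()) (s' := s₁) rfl]
        simp only [← hrows']
        rw [if_neg hfull]
        rfl
      rw [exec_bind_some hstep]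
      obtain ⟨r, s', e', ht', hk'⟩ := ih rows' B i s₁ hg hv hs₁ (by omega) (by omega)
      refine ⟨r, s', e', ?_, hk'.trans (max_le hp₁ (le_max_right _ _))⟩
      rw [ht', streamTime, if_neg (show ¬ IsFull ℓ (rows ++ [a]) from hfull)]
      simp only [s₁]
      ring

theorem exec_sparseFrequentDirections {ℓ n : ℕ} (c : Constants) (A : Matrix (Fin n) (Fin d) ℝ)
    (δ : ℝ) (R : ℕ) (ω : Tape d ℓ) (hd : 0 < d) (hℓ : 0 < ℓ) :
    ((sparseFrequentDirections c A δ R : Prog d ℓ _).exec ω Machine.init).2.time =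
        1 + streamTime c δ R ω (List.ofFn fun i => A i) [] 0 ∧
      ((sparseFrequentDirections c A δ R : Prog d ℓ _).exec ω Machine.init).2.peak ≤
        2 * (ℓ * d) + 16 + streamWords c.svd d ℓ := by
  let s₁ : Machine := ⟨1, 2 * (ℓ * d) + 16, 2 * (ℓ * d) + 16, 0, 0⟩
  obtain ⟨r, s', e, ht, hk⟩ := exec_foldlM_processRow c δ R ω hd hℓ (2 * (ℓ * d) + 16)
    (List.ofFn fun i => A i) [] 0 0 s₁ rfl rfl (by simp [s₁])
    (by rw [nnz_ofRows]; simpa using ⟨hℓ, hd⟩) (by simpa using hd)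
  have h : ∃ r' s'', (sparseFrequentDirections c A δ R : Prog d ℓ _).exec ω Machine.init =
      (r', s'') ∧ s''.time = s'.time ∧ s''.peak = s'.peak := by
    unfold sparseFrequentDirections withWords
    rw [exec_bind_some (a := ()) (s' := ⟨0, 2 * (ℓ * d) + 16, 2 * (ℓ * d) + 16, 0, 0⟩)
      (by
        change (some (), (⟨0, 0 + (2 * (ℓ * d) + 16), max 0 (0 + (2 * (ℓ * d) + 16)), 0, 0⟩ :
          Machine)) = _
        simp)]
    rw [exec_bind]
    have inner : (do
        tick 1
        let (B, _) ← (List.ofFn fun i => A i).foldlM (processRow c δ R) (0, [])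
        return B : Prog d ℓ (Matrix (Fin ℓ) (Fin d) ℝ)).exec ω
          ⟨0, 2 * (ℓ * d) + 16, 2 * (ℓ * d) + 16, 0, 0⟩ = (r.map Prod.fst, s') := by
      rw [exec_bind_some (a := ()) (s' := s₁) rfl, exec_bind, e]
      rcases r with _ | ⟨B, rows⟩ <;> rfl
    rw [inner]
    rcases r with _ | ⟨B, rows⟩
    · exact ⟨none, s', rfl, rfl, rfl⟩
    · exact ⟨_, _, rfl, rfl, rfl⟩
  obtain ⟨r', s'', e', ht', hk'⟩ := h
  rw [e']
  refine ⟨by simp only [ht', ht, s₁], ?_⟩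
  simp only [hk']
  refine hk.trans (max_le ?_ le_rfl)
  simp only [s₁]; omega

/-- The memory bound. -/
theorem memoryFootprint_le (c : Constants) {n d ℓ : ℕ} (A : Matrix (Fin n) (Fin d) ℝ) (δ : ℝ)
    (hd : 0 < d) (hℓ : 0 < ℓ) (ω : Tape d ℓ) :
    memoryFootprint c A ℓ δ ω ≤
      ENNReal.ofReal ((3 * c.svd + 40) * ((d : ℝ) * (ℓ : ℝ))) := by
  have h : ∀ R, ((sparseFrequentDirections c A δ R : Prog d ℓ _).exec ω Machine.init).2.peak ≤
      (3 * c.svd + 40) * (d * ℓ) := by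
    intro R
    refine (exec_sparseFrequentDirections c A δ R ω hd hℓ).2.trans ?_
    unfold streamWords roundWords sparseShrinkWords
    have h₁ : d ≤ d * ℓ := Nat.le_mul_of_pos_right d hℓ
    have h₂ : ℓ ≤ d * ℓ := Nat.le_mul_of_pos_left ℓ hd
    have h₃ : 1 ≤ d * ℓ := Nat.mul_pos hd hℓ
    have h₄ : ℓ * d = d * ℓ := mul_comm _ _
    have h₅ : (ℓ + ℓ) * d = 2 * (d * ℓ) := by ring
    rw [h₄, h₅]
    generalize d * ℓ = x at *
    have h₆ : (3 * c.svd + 40) * x = 3 * (c.svd * x) + 40 * x := by ring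
    have h₇ : c.svd * (2 * x) = 2 * (c.svd * x) := by ring
    rw [h₆, h₇]
    generalize c.svd * x = y
    omega
  refine iSup_le fun R => ?_
  rw [← ENNReal.ofReal_natCast]
  refine ENNReal.ofReal_le_ofReal ?_
  exact_mod_cast h R

end Stream

/-! ### Eigenvalues of AᵀA: Courant–Fischer, Weyl, and the spectrum of a shrunk sketch. -/

section Spectral

variable {d : ℕ} {ι : Type} [Fintype ι]

/-- An orthonormal basis of right singular vectors, in the order of decreasing singular values. -/
noncomputable def gramBasis (A : Matrix ι (Fin d) ℝ) :
    OrthonormalBasis (Fin d) ℝ (EuclideanSpace ℝ (Fin d)) :=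
  (Matrix.toEuclideanLin A).isSymmetric_adjoint_comp_self.eigenvectorBasis
    (n := d) finrank_euclideanSpace_fin

/-- The eigenvalues of `AᵀA`, in decreasing order. -/
noncomputable def gramEig (A : Matrix ι (Fin d) ℝ) (i : ℕ) : ℝ :=
  (Matrix.toEuclideanLin A).singularValues i ^ 2

theorem gramEig_nonneg (A : Matrix ι (Fin d) ℝ) (i : ℕ) : 0 ≤ gramEig A i := sq_nonneg _

theorem gramEig_antitone (A : Matrix ι (Fin d) ℝ) : Antitone (gramEig A) := fun _ _ h =>
  pow_le_pow_left₀ (LinearMap.singularValues_nonneg _ _) (LinearMap.singularValues_antitone _ h) 2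

theorem inner_gramBasis (A : Matrix ι (Fin d) ℝ) (i : Fin d) (x : EuclideanSpace ℝ (Fin d)) :
    inner ℝ (Matrix.toEuclideanLin A (gramBasis A i)) (Matrix.toEuclideanLin A x) =
      gramEig A i * inner ℝ (gramBasis A i) x := by
  have h := (Matrix.toEuclideanLin A).isSymmetric_adjoint_comp_self.apply_eigenvectorBasis
    (n := d) finrank_euclideanSpace_fin i
  rw [← LinearMap.adjoint_inner_left, gramEig,
    LinearMap.sq_singularValues_fin _ (finrank_euclideanSpace_fin (𝕜 := ℝ) (n := d)) i]
  change inner ℝ ((LinearMap.adjoint (Matrix.toEuclideanLin A) ∘ₗ Matrix.toEuclideanLin A)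
    (gramBasis A i)) x = _
  rw [gramBasis, h, inner_smul_left]
  simp

theorem inner_toEuclideanLin (A : Matrix ι (Fin d) ℝ) (x y : EuclideanSpace ℝ (Fin d)) :
    inner ℝ (Matrix.toEuclideanLin A x) (Matrix.toEuclideanLin A y) =
      ∑ i : Fin d, gramEig A i * (inner ℝ (gramBasis A i) x * inner ℝ (gramBasis A i) y) := by
  conv_lhs => rw [← (gramBasis A).sum_repr' x]
  rw [map_sum, sum_inner]
  refine Finset.sum_congr rfl fun i _ => ?_
  rw [map_smul, inner_smul_left, inner_gramBasis]
  simp only [conj_trivial]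
  ring

theorem norm_sq_toEuclideanLin (A : Matrix ι (Fin d) ℝ) (x : EuclideanSpace ℝ (Fin d)) :
    ‖Matrix.toEuclideanLin A x‖ ^ 2 = ∑ i : Fin d, gramEig A i * inner ℝ (gramBasis A i) x ^ 2 := by
  rw [← real_inner_self_eq_norm_sq, inner_toEuclideanLin]
  simp only [sq]

theorem norm_sq_eq_sum_gramBasis (A : Matrix ι (Fin d) ℝ) (x : EuclideanSpace ℝ (Fin d)) :
    ‖x‖ ^ 2 = ∑ i, inner ℝ (gramBasis A i) x ^ 2 := by
  rw [← (gramBasis A).sum_sq_norm_inner_right x]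
  simp

/-- The lower bound for an eigenvalue in the theorem of Courant and Fischer. -/
theorem le_gramEig {ℓ : ℕ} (hℓ : 0 < ℓ) (hℓd : ℓ ≤ d) (A : Matrix ι (Fin d) ℝ) (t : ℝ)
    (f : (Fin ℓ → ℝ) →ₗ[ℝ] EuclideanSpace ℝ (Fin d)) (hf : Function.Injective f)
    (h : ∀ a, t * ‖f a‖ ^ 2 ≤ ‖Matrix.toEuclideanLin A (f a)‖ ^ 2) : t ≤ gramEig A (ℓ - 1) := by
  -- Eigenvalues are numbered from 0, so index ℓ − 1 is the ℓ-th largest. The ℓ − 1 conditions of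
  -- orthogonality to the earlier eigenvectors leave a nonzero vector of the ℓ-dimensional test
  -- space.
  let g : (Fin ℓ → ℝ) →ₗ[ℝ] (Fin (ℓ - 1) → ℝ) :=
    LinearMap.pi fun i => (innerₛₗ ℝ (gramBasis A ⟨i, by omega⟩)) ∘ₗ f
  have hker : LinearMap.ker g ≠ ⊥ := LinearMap.ker_ne_bot_of_finrank_lt (by simp; omega)
  obtain ⟨a, ha, ha0⟩ := Submodule.exists_mem_ne_zero_of_ne_bot hker
  have hfa : f a ≠ 0 := fun h0 => ha0 (hf (by rw [h0, map_zero]))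
  have hpos : 0 < ‖f a‖ ^ 2 := by positivity
  have hz : ∀ i : Fin d, (i : ℕ) < ℓ - 1 → inner ℝ (gramBasis A i) (f a) = 0 := by
    intro i hi
    exact congrFun (LinearMap.mem_ker.1 ha) ⟨i, hi⟩
  have hle : ‖Matrix.toEuclideanLin A (f a)‖ ^ 2 ≤ gramEig A (ℓ - 1) * ‖f a‖ ^ 2 := by
    rw [norm_sq_toEuclideanLin, norm_sq_eq_sum_gramBasis A, Finset.mul_sum]
    refine Finset.sum_le_sum fun i _ => ?_
    by_cases hi : (i : ℕ) < ℓ - 1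
    · simp [hz i hi]
    · exact mul_le_mul_of_nonneg_right (gramEig_antitone A (by omega)) (sq_nonneg _)
  exact le_of_mul_le_mul_right ((h a).trans hle) hpos

/-- Weyl's perturbation bound. -/
theorem gramEig_le_add {κ : Type} [Fintype κ] {ℓ : ℕ} (hℓ : 0 < ℓ) (hℓd : ℓ ≤ d)
    (A : Matrix ι (Fin d) ℝ) (B : Matrix κ (Fin d) ℝ) (t : ℝ)
    (h : ∀ x, ‖Matrix.toEuclideanLin A x‖ ^ 2 ≤ ‖Matrix.toEuclideanLin B x‖ ^ 2 + t * ‖x‖ ^ 2) :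
    gramEig A (ℓ - 1) ≤ gramEig B (ℓ - 1) + t := by
  rw [← sub_le_iff_le_add]
  have hin : ∀ (a : Fin ℓ → ℝ) (i : Fin d),
      inner ℝ (gramBasis A i) (∑ j, a j • gramBasis A (Fin.castLE hℓd j)) =
        if h : (i : ℕ) < ℓ then a ⟨i, h⟩ else 0 := by
    intro a i
    rw [inner_sum]
    split_ifs with hi
    · rw [Finset.sum_eq_single ⟨i, hi⟩]
      · change inner ℝ (gramBasis A i) (a ⟨i, hi⟩ • gramBasis A i) = _
        rw [inner_smul_right, real_inner_self_eq_norm_sq]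
        simp
      · intro j _ hj
        rw [inner_smul_right, OrthonormalBasis.inner_eq_zero, mul_zero]
        intro he
        exact hj (Fin.ext (congrArg Fin.val he).symm)
      · simp
    · refine Finset.sum_eq_zero fun j _ => ?_
      rw [inner_smul_right, OrthonormalBasis.inner_eq_zero, mul_zero]
      intro he
      exact hi (by rw [he]; exact j.2)
  -- The test space for B is the span of the top ℓ eigenvectors of AᵀA.
  refine le_gramEig hℓ hℓd B _ (∑ j, (LinearMap.proj j).smulRight
    (gramBasis A (Fin.castLE hℓd j))) ?_ ?_
  · rw [← LinearMap.ker_eq_bot, LinearMap.ker_eq_bot']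
    intro a ha
    ext j
    have := hin a (Fin.castLE hℓd j)
    simp only [LinearMap.sum_apply, LinearMap.smulRight_apply, LinearMap.proj_apply] at ha
    rw [ha, inner_zero_right] at this
    simpa using this.symm
  · intro a
    simp only [LinearMap.sum_apply, LinearMap.smulRight_apply, LinearMap.proj_apply]
    set x := ∑ j, a j • gramBasis A (Fin.castLE hℓd j)
    have : gramEig A (ℓ - 1) * ‖x‖ ^ 2 ≤ ‖Matrix.toEuclideanLin A x‖ ^ 2 := by
      rw [norm_sq_toEuclideanLin, norm_sq_eq_sum_gramBasis A, Finset.mul_sum]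
      refine Finset.sum_le_sum fun i _ => ?_
      by_cases hi : (i : ℕ) < ℓ
      · exact mul_le_mul_of_nonneg_right (gramEig_antitone A (by omega)) (sq_nonneg _)
      · rw [hin a i, dif_neg hi]; simp
    linarith [h x]

/-- The rank is at most the number of rows. This is why bounds in terms of m rather than d are
possible later. -/
theorem gramEig_eq_zero (A : Matrix ι (Fin d) ℝ) {i : ℕ} (hi : Fintype.card ι ≤ i) :
    gramEig A i = 0 := by
  have hr : Module.finrank ℝ (LinearMap.range (Matrix.toEuclideanLin A)) ≤ i :=
    (Submodule.finrank_le _).trans (by simpa using hi)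
  have := LinearMap.support_singularValues (Matrix.toEuclideanLin A)
  have h2 : (Matrix.toEuclideanLin A).singularValues i = 0 := by
    rw [← Finsupp.notMem_support_iff, this]
    simpa using hr
  rw [gramEig, h2]; simp

theorem frobSq_eq_sum_norm_sq {m : ℕ} (A : Matrix (Fin m) (Fin d) ℝ)
    (b : OrthonormalBasis (Fin d) ℝ (EuclideanSpace ℝ (Fin d))) :
    frobSq A = ∑ i, ‖Matrix.toEuclideanLin A (b i)‖ ^ 2 := by
  have : ∀ i, ‖Matrix.toEuclideanLin A (b i)‖ ^ 2 =
      ∑ k, inner ℝ (b i) (WithLp.toLp 2 (A k)) ^ 2 := by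
    intro i
    rw [EuclideanSpace.norm_sq_eq]
    refine Finset.sum_congr rfl fun k _ => ?_
    rw [Real.norm_eq_abs, sq_abs]
    simp [Matrix.mulVec, dotProduct, PiLp.inner_apply]
  simp only [this]
  rw [Finset.sum_comm, frobSq]
  refine Finset.sum_congr rfl fun k _ => ?_
  have := b.sum_sq_norm_inner_right (WithLp.toLp 2 (A k))
  simp only [Real.norm_eq_abs, sq_abs] at this
  rw [this, EuclideanSpace.norm_sq_eq]
  simp

theorem frobSq_eq_sum_gramEig {m : ℕ} (A : Matrix (Fin m) (Fin d) ℝ) :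
    frobSq A = ∑ i : Fin d, gramEig A i := by
  rw [frobSq_eq_sum_norm_sq A (gramBasis A)]
  refine Finset.sum_congr rfl fun i _ => ?_
  rw [← real_inner_self_eq_norm_sq, inner_gramBasis, real_inner_self_eq_norm_sq]
  simp

theorem shrinkOf_apply {ℓ : ℕ} (hℓd : ℓ ≤ d) (A : Matrix ι (Fin d) ℝ) (i : Fin ℓ) (k : Fin d) :
    shrinkOf ℓ A i k =
      √(gramEig A i - gramEig A (ℓ - 1)) * gramBasis A (Fin.castLE hℓd i) k := by
  rw [shrinkOf, shrunk, Matrix.diagonal_mul, Matrix.transpose_apply, rightSingularVectors,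
    Matrix.of_apply, dif_pos (i.2.trans_le hℓd)]
  rfl

theorem toEuclideanLin_shrinkOf_apply {ℓ : ℕ} (hℓd : ℓ ≤ d) (A : Matrix ι (Fin d) ℝ)
    (x : EuclideanSpace ℝ (Fin d)) (i : Fin ℓ) :
    Matrix.toEuclideanLin (shrinkOf ℓ A) x i = √(gramEig A i - gramEig A (ℓ - 1)) *
      inner ℝ (gramBasis A (Fin.castLE hℓd i)) x := by
  simp only [Matrix.toLpLin_apply, Matrix.mulVec, dotProduct, shrinkOf_apply hℓd,
    PiLp.inner_apply, Finset.mul_sum]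
  refine Finset.sum_congr rfl fun k _ => ?_
  simp
  ring

/-- The sketch is diagonal in the singular basis of `A`: the top ℓ eigenvalues are lowered by the
ℓ-th one and the others are dropped. -/
theorem norm_sq_shrinkOf {ℓ : ℕ} (hℓd : ℓ ≤ d) (A : Matrix ι (Fin d) ℝ)
    (x : EuclideanSpace ℝ (Fin d)) :
    ‖Matrix.toEuclideanLin (shrinkOf ℓ A) x‖ ^ 2 = ∑ i : Fin d,
      (if (i : ℕ) < ℓ then gramEig A i - gramEig A (ℓ - 1) else 0) *
        inner ℝ (gramBasis A i) x ^ 2 := by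
  rw [EuclideanSpace.norm_sq_eq]
  have h1 : ∀ i : Fin ℓ, ‖Matrix.toEuclideanLin (shrinkOf ℓ A) x i‖ ^ 2 =
      (gramEig A i - gramEig A (ℓ - 1)) * inner ℝ (gramBasis A (Fin.castLE hℓd i)) x ^ 2 := by
    intro i
    rw [toEuclideanLin_shrinkOf_apply hℓd, Real.norm_eq_abs, sq_abs, mul_pow, Real.sq_sqrt]
    exact sub_nonneg.2 (gramEig_antitone A (by omega))
  simp only [h1]
  symm
  rw [← Finset.sum_subset (Finset.subset_univ (Finset.univ.map (Fin.castLEEmb hℓd)))]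
  · rw [Finset.sum_map]
    refine Finset.sum_congr rfl fun i _ => ?_
    simp
  · intro i _ hi
    have : ¬ (i : ℕ) < ℓ := by
      intro h
      exact hi (Finset.mem_map.2 ⟨⟨i, h⟩, Finset.mem_univ _, Fin.ext rfl⟩)
    simp [this]

theorem frobSq_shrinkOf {ℓ : ℕ} (hℓd : ℓ ≤ d) (A : Matrix ι (Fin d) ℝ) :
    frobSq (shrinkOf ℓ A) = ∑ i : Fin d,
      (if (i : ℕ) < ℓ then gramEig A i - gramEig A (ℓ - 1) else 0) := by
  rw [frobSq_eq_sum_norm_sq _ (gramBasis A)]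
  refine Finset.sum_congr rfl fun i _ => ?_
  rw [norm_sq_shrinkOf hℓd, Finset.sum_eq_single i]
  · simp
  · intro j _ hj
    rw [OrthonormalBasis.inner_eq_zero _ hj]; simp
  · simp

end Spectral

/-! ### Deterministic conditions for acceptance, and scalar inequalities for power iteration. -/

section Acceptance

variable {d : ℕ}

theorem norm_sq_toLp {k : ℕ} (x : Fin k → ℝ) : ‖WithLp.toLp 2 x‖ ^ 2 = x ⬝ᵥ x := by
  rw [EuclideanSpace.norm_sq_eq, dotProduct]
  simp [sq]

theorem mulVec_dotProduct_self {k : ℕ} (A : Matrix (Fin k) (Fin d) ℝ) (x : Fin d → ℝ) :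
    (A *ᵥ x) ⬝ᵥ (A *ᵥ x) = ‖Matrix.toEuclideanLin A (WithLp.toLp 2 x)‖ ^ 2 := by
  rw [← norm_sq_toLp]; rfl

theorem dotProduct_verifyMap {m k : ℕ} (A : Matrix (Fin m) (Fin d) ℝ)
    (B : Matrix (Fin k) (Fin d) ℝ) (Δ : ℝ) (x y : Fin d → ℝ) :
    y ⬝ᵥ verifyMap A B Δ x =
      (Δ / 2)⁻¹ * ((A *ᵥ y) ⬝ᵥ (A *ᵥ x) - (B *ᵥ y) ⬝ᵥ (B *ᵥ x)) := by
  unfold verifyMap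
  rw [dotProduct_smul, dotProduct_sub, Matrix.dotProduct_mulVec y Aᵀ, Matrix.dotProduct_mulVec y Bᵀ,
    Matrix.vecMul_transpose, Matrix.vecMul_transpose, smul_eq_mul]

theorem verifyMap_sub {m k : ℕ} (A : Matrix (Fin m) (Fin d) ℝ)
    (B : Matrix (Fin k) (Fin d) ℝ) (Δ : ℝ) (x y : Fin d → ℝ) :
    verifyMap A B Δ (x - y) = verifyMap A B Δ x - verifyMap A B Δ y := by
  simp only [verifyMap, Matrix.mulVec_sub, ← smul_sub]
  congr 1
  abel

/-- A symmetric operator between `0` and `1` is a contraction. -/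
theorem norm_iterate_verifyMap_le {m k : ℕ} (A : Matrix (Fin m) (Fin d) ℝ)
    (B : Matrix (Fin k) (Fin d) ℝ) (Δ : ℝ) (h0 : ∀ x, 0 ≤ x ⬝ᵥ verifyMap A B Δ x)
    (h1 : ∀ x, x ⬝ᵥ verifyMap A B Δ x ≤ x ⬝ᵥ x) (n : ℕ) (x : Fin d → ℝ)
    (hx : ‖WithLp.toLp 2 x‖ ≤ 1) : ‖WithLp.toLp 2 ((verifyMap A B Δ)^[n] x)‖ ≤ 1 := by
  induction n generalizing x with
  | zero => exact hx
  | succ n ih =>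
    refine ih _ (le_trans ?_ hx)
    refine le_of_sq_le_sq ?_ (norm_nonneg _)
    rw [norm_sq_toLp, norm_sq_toLp]
    -- With T the operator, ⟨x − Tx, T(x − Tx)⟩ ≥ 0 expands to 2‖Tx‖² ≤ ⟨x, Tx⟩ + ⟨Tx, T(Tx)⟩ ≤ ‖x‖²
    -- + ‖Tx‖².
    have h := h0 (x - verifyMap A B Δ x)
    have hs : x ⬝ᵥ verifyMap A B Δ (verifyMap A B Δ x) =
        verifyMap A B Δ x ⬝ᵥ verifyMap A B Δ x := by
      rw [dotProduct_verifyMap, dotProduct_verifyMap, dotProduct_comm (A *ᵥ x),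
        dotProduct_comm (B *ᵥ x)]
    rw [verifyMap_sub, sub_dotProduct, dotProduct_sub, dotProduct_sub, hs] at h
    linarith [h1 x, h1 (verifyMap A B Δ x)]

/-- Along each singular direction at most the ℓ-th eigenvalue is lost: it is subtracted in the
retained directions, and a dropped eigenvalue does not exceed it. -/
theorem norm_sq_le_shrinkOf {ι : Type} [Fintype ι] {ℓ : ℕ} (hℓd : ℓ ≤ d) (P : Matrix ι (Fin d) ℝ)
    (y : EuclideanSpace ℝ (Fin d)) : ‖Matrix.toEuclideanLin P y‖ ^ 2 ≤
      ‖Matrix.toEuclideanLin (shrinkOf ℓ P) y‖ ^ 2 + gramEig P (ℓ - 1) * ‖y‖ ^ 2 := by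
  rw [norm_sq_shrinkOf hℓd, norm_sq_toEuclideanLin, norm_sq_eq_sum_gramBasis P, Finset.mul_sum,
    ← Finset.sum_add_distrib]
  refine Finset.sum_le_sum fun i _ => ?_
  rw [← add_mul]
  refine mul_le_mul_of_nonneg_right ?_ (sq_nonneg _)
  split_ifs with hi
  · linarith
  · simpa using gramEig_antitone P (show ℓ - 1 ≤ (i : ℕ) by omega)

/-- If `P` is close enough to `A`, then the sketch made from `P` passes the verification. -/
theorem norm_iterate_verifyMap_shrinkOf_le {m ℓ : ℕ} (hℓ : 0 < ℓ) (hℓd : ℓ ≤ d)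
    (A : Matrix (Fin m) (Fin d) ℝ) (P : Matrix (Fin ℓ) (Fin d) ℝ)
    (hP : ∀ x, ‖Matrix.toEuclideanLin P x‖ ^ 2 ≤ ‖Matrix.toEuclideanLin A x‖ ^ 2)
    (hE : ∀ x, ‖Matrix.toEuclideanLin A x‖ ^ 2 ≤
      ‖Matrix.toEuclideanLin P x‖ ^ 2 + 29 / 12 * gramEig P (ℓ - 1) * ‖x‖ ^ 2)
    (n : ℕ) (x : Fin d → ℝ) (hx : ‖WithLp.toLp 2 x‖ ≤ 1) :
    ‖WithLp.toLp 2 ((verifyMap A (shrinkOf ℓ P)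
      ((frobSq A - frobSq (shrinkOf ℓ P)) / (6 / 41 * ℓ)))^[n] x)‖ ≤ 1 := by
  set lam := gramEig P (ℓ - 1) with hlam
  have hlam0 : 0 ≤ lam := gramEig_nonneg _ _
  have hℓ' : (0 : ℝ) < ℓ := by exact_mod_cast hℓ
  have hfrob : frobSq P ≤ frobSq A := by
    rw [frobSq_eq_sum_norm_sq P (gramBasis P), frobSq_eq_sum_norm_sq A (gramBasis P)]
    exact Finset.sum_le_sum fun i _ => hP _
  have hcount : ∑ i : Fin d, (if (i : ℕ) < ℓ then lam else 0) = ℓ * lam := by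
    rw [← Finset.sum_filter, Finset.sum_const, nsmul_eq_mul]
    congr 2
    rw [← Finset.card_map Fin.valEmbedding]
    have : (Finset.univ.filter fun i : Fin d => (i : ℕ) < ℓ).map Fin.valEmbedding =
        Finset.range ℓ := by
      ext j
      simp only [Finset.mem_map, Finset.mem_filter, Finset.mem_univ, true_and, Finset.mem_range]
      exact ⟨fun ⟨i, hi, e⟩ => e ▸ hi, fun hj => ⟨⟨j, hj.trans_le hℓd⟩, hj, rfl⟩⟩
    rw [this, Finset.card_range]
  have hfrobB : ℓ * lam ≤ frobSq P - frobSq (shrinkOf ℓ P) := by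
    rw [frobSq_eq_sum_gramEig, frobSq_shrinkOf hℓd, ← Finset.sum_sub_distrib, ← hcount]
    refine Finset.sum_le_sum fun i _ => ?_
    split_ifs
    · linarith
    · simpa using gramEig_nonneg P i
  set D := (frobSq A - frobSq (shrinkOf ℓ P)) / (6 / 41 * ℓ) / 2 with hD
  -- Here D = Δ/2, and 1/(2 · 6/41) = 41/12. Shrinking removes at least `lam` from each of ℓ
  -- eigenvalues, so the squared Frobenius norm falls by at least ℓ · `lam`. Moreover 41/12 = 29/12
  -- + 1, the projection error plus the shrinking error.
  have hDle : 41 / 12 * lam ≤ D := by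
    rw [hD, div_div, le_div_iff₀ (by positivity)]
    linarith
  have hD0 : 0 ≤ D := le_trans (by positivity) hDle
  have hB : ∀ y, ‖Matrix.toEuclideanLin (shrinkOf ℓ P) y‖ ^ 2 ≤
      ‖Matrix.toEuclideanLin P y‖ ^ 2 := by
    intro y
    rw [norm_sq_shrinkOf hℓd, norm_sq_toEuclideanLin]
    refine Finset.sum_le_sum fun i _ => mul_le_mul_of_nonneg_right ?_ (sq_nonneg _)
    split_ifs
    · linarith
    · exact gramEig_nonneg P i
  have hB' := norm_sq_le_shrinkOf hℓd P
  refine norm_iterate_verifyMap_le A _ _ (fun y => ?_) (fun y => ?_) n x hx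
  · rw [dotProduct_verifyMap, mulVec_dotProduct_self, mulVec_dotProduct_self]
    refine mul_nonneg (inv_nonneg.2 hD0) ?_
    linarith [hP (WithLp.toLp 2 y), hB (WithLp.toLp 2 y)]
  · rw [dotProduct_verifyMap, mulVec_dotProduct_self, mulVec_dotProduct_self, ← norm_sq_toLp]
    -- If Δ = 0, the inverse is 0 and the tested operator vanishes.
    rcases hD0.eq_or_lt with h | h
    · rw [← hD, ← h]; simp
    · rw [← hD, inv_mul_le_iff₀ h]
      have := mul_le_mul_of_nonneg_right hDle (sq_nonneg ‖WithLp.toLp 2 y‖)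
      linarith [hE (WithLp.toLp 2 y), hB' (WithLp.toLp 2 y)]

/-- Vectors after power iteration are concentrated on the large eigenvalues. -/
theorem sum_pow_ge {ℓ q : ℕ} (s h : Fin d → ℝ) (S K : ℝ) (hs : ∀ i, 0 ≤ s i) (hS : 0 ≤ S)
    (htop : ∀ i : Fin d, (i : ℕ) < ℓ → S ≤ s i)
    (hK : ∑ i : Fin d, (if ¬ (i : ℕ) < ℓ ∧ s i ≠ 0 then h i ^ 2 else 0) ≤
      K * ∑ i : Fin d, (if (i : ℕ) < ℓ then h i ^ 2 else 0))
    (hq : (3 / 5 : ℝ) ^ (2 * q + 2) * K ≤ 2 / 5) :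
    3 / 5 * S * ∑ i, s i ^ (2 * q + 1) * h i ^ 2 ≤ ∑ i, s i ^ (2 * q + 2) * h i ^ 2 := by
  rw [← sub_nonneg, Finset.mul_sum, ← Finset.sum_sub_distrib]
  -- Termwise bounds for s^(2q+1)(s − 3S/5)h²: a top term gains at least (2/5)S^(2q+2)h², and
  -- another term is negative only for s < 3S/5, where it loses at most (3S/5)^(2q+2)h². The
  -- assumption `hq` makes the gain outweigh the loss.
  have key : ∑ i : Fin d, (2 / 5 * S ^ (2 * q + 2) * (if (i : ℕ) < ℓ then h i ^ 2 else 0) -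
      (3 / 5 * S) ^ (2 * q + 2) * (if ¬ (i : ℕ) < ℓ ∧ s i ≠ 0 then h i ^ 2 else 0)) ≤
      ∑ i, (s i ^ (2 * q + 2) * h i ^ 2 - 3 / 5 * S * (s i ^ (2 * q + 1) * h i ^ 2)) := by
    refine Finset.sum_le_sum fun i _ => ?_
    have e : s i ^ (2 * q + 2) * h i ^ 2 - 3 / 5 * S * (s i ^ (2 * q + 1) * h i ^ 2) =
        s i ^ (2 * q + 1) * (s i - 3 / 5 * S) * h i ^ 2 := by ring
    rw [e]
    by_cases hi : (i : ℕ) < ℓ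
    · rw [if_pos hi, if_neg (by tauto), mul_zero, sub_zero]
      refine mul_le_mul_of_nonneg_right ?_ (sq_nonneg _)
      have h1 : S ^ (2 * q + 1) ≤ s i ^ (2 * q + 1) := pow_le_pow_left₀ hS (htop i hi) _
      calc 2 / 5 * S ^ (2 * q + 2) = S ^ (2 * q + 1) * (2 / 5 * S) := by ring
        _ ≤ s i ^ (2 * q + 1) * (s i - 3 / 5 * S) :=
          mul_le_mul h1 (by linarith [htop i hi]) (by positivity) (pow_nonneg (hs i) _)
    · rw [if_neg hi, mul_zero, zero_sub]
      by_cases h0 : s i = 0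
      · rw [if_neg (by tauto), h0]; simp
      · rw [if_pos ⟨hi, h0⟩, ← neg_mul]
        refine mul_le_mul_of_nonneg_right ?_ (sq_nonneg _)
        rcases le_total (3 / 5 * S) (s i) with hc | hc
        · have h2 : 0 ≤ s i ^ (2 * q + 1) * (s i - 3 / 5 * S) :=
            mul_nonneg (pow_nonneg (hs i) _) (by linarith)
          have h3 : 0 ≤ (3 / 5 * S) ^ (2 * q + 2) := by positivity
          linarith
        · have h2 : s i ^ (2 * q + 1) ≤ (3 / 5 * S) ^ (2 * q + 1) := pow_le_pow_left₀ (hs i) hc _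
          have h3 : s i ^ (2 * q + 1) * (3 / 5 * S - s i) ≤
              (3 / 5 * S) ^ (2 * q + 1) * (3 / 5 * S) :=
            mul_le_mul h2 (by linarith [hs i]) (by linarith) (by positivity)
          have h4 : (3 / 5 * S) ^ (2 * q + 2) = (3 / 5 * S) ^ (2 * q + 1) * (3 / 5 * S) := by ring
          rw [h4]; linarith
  refine le_trans ?_ key
  rw [Finset.sum_sub_distrib, ← Finset.mul_sum, ← Finset.mul_sum]
  set T := ∑ i : Fin d, (if (i : ℕ) < ℓ then h i ^ 2 else 0)
  have hT : 0 ≤ T := Finset.sum_nonneg fun i _ => by split_ifs <;> positivity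
  have h1 := mul_le_mul_of_nonneg_left hK (show 0 ≤ (3 / 5 * S) ^ (2 * q + 2) by positivity)
  have h2 := mul_le_mul_of_nonneg_left hq (show 0 ≤ S ^ (2 * q + 2) * T by positivity)
  have h3 : (3 / 5 * S) ^ (2 * q + 2) * (K * T) =
      S ^ (2 * q + 2) * T * ((3 / 5) ^ (2 * q + 2) * K) := by rw [mul_pow]; ring
  nlinarith

/-- Vectors orthogonal to the result of power iteration are concentrated on the small
eigenvalues. -/
theorem sum_sq_mul_le {ℓ q : ℕ} (s b h : Fin d → ℝ) (τ K : ℝ) (hs : ∀ i, 0 ≤ s i) (hτ : 0 ≤ τ)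
    (htail : ∀ i : Fin d, ¬ (i : ℕ) < ℓ → s i ≤ τ)
    (hh : ∀ i : Fin d, (i : ℕ) < ℓ → h i = s i ^ (q + 1) * b i)
    (hK : τ ≠ 0 → ∑ i : Fin d, (if ¬ (i : ℕ) < ℓ ∧ s i ≠ 0 then h i ^ 2 else 0) ≤
      K * ∑ i : Fin d, (if (i : ℕ) < ℓ then h i ^ 2 else 0))
    (hK0 : 0 ≤ K)
    (hq : τ ≠ 0 → K ≤ 2 / 5 * (7 / 5 : ℝ) ^ (2 * q))
    (horth : ∑ i, s i ^ (q + 1) * b i * h i = 0) :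
    ∑ i, s i ^ 2 * b i ^ 2 ≤ 7 / 5 * τ * ∑ i, s i * b i ^ 2 := by
  set p : Fin d → ℝ := fun i => s i ^ (q + 1) * b i with hp
  set T := ∑ i : Fin d, (if (i : ℕ) < ℓ then p i ^ 2 else 0) with hT
  set U := ∑ i : Fin d, (if ¬ (i : ℕ) < ℓ ∧ s i ≠ 0 then p i ^ 2 else 0) with hU
  have hT0 : 0 ≤ T := Finset.sum_nonneg fun i _ => by split_ifs <;> positivity
  have hU0 : 0 ≤ U := Finset.sum_nonneg fun i _ => by split_ifs <;> positivity
  have hTh : ∑ i : Fin d, (if (i : ℕ) < ℓ then h i ^ 2 else 0) = T := by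
    refine Finset.sum_congr rfl fun i _ => ?_
    split_ifs with hi
    · rw [hh i hi]
    · rfl
  rw [hTh] at hK
  -- On the top indices `h` agrees with `p`, so the orthogonality relation expresses the top mass
  -- `T` of `p` by its remaining coordinates. Cauchy–Schwarz and `hK` then give T ≤ K · U when τ ≠
  -- 0.
  have hsplit : T = - ∑ i : Fin d, (if ¬ (i : ℕ) < ℓ ∧ s i ≠ 0 then p i else 0) *
      (if ¬ (i : ℕ) < ℓ ∧ s i ≠ 0 then h i else 0) := by
    rw [eq_neg_iff_add_eq_zero, hT, ← Finset.sum_add_distrib]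
    refine Eq.trans ?_ horth
    refine Finset.sum_congr rfl fun i _ => ?_
    by_cases hi : (i : ℕ) < ℓ
    · rw [if_pos hi, if_neg (by tauto), zero_mul, add_zero, hh i hi]; simp only [hp]; ring
    · by_cases h0 : s i = 0
      · rw [if_neg hi, if_neg (by tauto), h0]; simp
      · rw [if_neg hi, if_pos ⟨hi, h0⟩, if_pos ⟨hi, h0⟩]; simp only [hp]; ring
  rcases eq_or_ne τ 0 with h0 | h0
  -- For τ = 0 nothing remains outside the top indices, and no conditioning of the starting matrix
  -- is needed.
  · have hTz : T = 0 := by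
      rw [hsplit, neg_eq_zero]
      refine Finset.sum_eq_zero fun i _ => ?_
      rw [if_neg, zero_mul]
      rintro ⟨hi, hne⟩
      exact hne (le_antisymm (h0 ▸ htail i hi) (hs i))
    rw [h0, mul_zero, zero_mul]
    refine le_of_eq (Finset.sum_eq_zero fun i _ => ?_)
    by_cases hi : (i : ℕ) < ℓ
    · have := (Finset.sum_eq_zero_iff_of_nonneg (fun i _ => by split_ifs <;> positivity)).1 hTz i
        (Finset.mem_univ i)
      rw [if_pos hi] at this
      have hp0 : s i ^ (q + 1) * b i = 0 := by simpa [hp] using this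
      rcases mul_eq_zero.1 hp0 with h | h
      · rw [eq_zero_of_pow_eq_zero h]; simp
      · rw [h]; simp
    · have : s i = 0 := le_antisymm (h0 ▸ htail i hi) (hs i)
      rw [this]; simp
  · have hτ' : 0 < τ := lt_of_le_of_ne hτ (Ne.symm h0)
    have hcs : T ^ 2 ≤ U * (K * T) := by
      have hCS := Finset.sum_mul_sq_le_sq_mul_sq Finset.univ
        (fun i : Fin d => if ¬ (i : ℕ) < ℓ ∧ s i ≠ 0 then p i else 0)
        (fun i : Fin d => if ¬ (i : ℕ) < ℓ ∧ s i ≠ 0 then h i else 0)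
      simp only [ite_pow, ne_eq, OfNat.ofNat_ne_zero, not_false_eq_true, zero_pow] at hCS
      rw [hsplit, neg_sq]
      refine hCS.trans ?_
      rw [← hsplit]
      exact mul_le_mul_of_nonneg_left (hK h0) hU0
    have hTU : T ≤ K * U := by
      rcases hT0.eq_or_lt with h | h
      · rw [← h]; positivity
      · refine le_of_mul_le_mul_right ?_ h
        nlinarith
    set W := ∑ i : Fin d, (if ¬ (i : ℕ) < ℓ then s i * b i ^ 2 else 0) with hW
    have hW0 : 0 ≤ W := Finset.sum_nonneg fun i _ => by
      split_ifs <;> first | exact le_rfl | exact mul_nonneg (hs i) (sq_nonneg _)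
    have hUW : U ≤ τ ^ (2 * q + 1) * W := by
      rw [hU, hW, Finset.mul_sum]
      refine Finset.sum_le_sum fun i _ => ?_
      by_cases hi : (i : ℕ) < ℓ
      · rw [if_neg (by tauto), if_neg (by tauto), mul_zero]
      · rw [if_pos hi]
        have e : p i ^ 2 = s i ^ (2 * q + 1) * (s i * b i ^ 2) := by simp only [hp]; ring
        have h1 : s i ^ (2 * q + 1) * (s i * b i ^ 2) ≤ τ ^ (2 * q + 1) * (s i * b i ^ 2) :=
          mul_le_mul_of_nonneg_right (pow_le_pow_left₀ (hs i) (htail i hi) _)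
            (mul_nonneg (hs i) (sq_nonneg _))
        split_ifs
        · rw [e]; exact h1
        · exact mul_nonneg (by positivity) (mul_nonneg (hs i) (sq_nonneg _))
    have hc : (0 : ℝ) < (7 / 5 * τ) ^ (2 * q) := by positivity
    rw [← sub_nonpos, Finset.mul_sum, ← Finset.sum_sub_distrib]
    refine nonpos_of_mul_nonpos_right ?_ hc
    rw [Finset.mul_sum]
    -- After multiplication by (7τ/5)^(2q), a top index with s > 7τ/5 contributes at most p²,
    -- because s^(2q) exceeds that factor; every other index outside the top has slack at least
    -- 2τ/5. The excess is thus at most `T`, which is tiny compared with the slack.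
    have key : ∑ i, (7 / 5 * τ) ^ (2 * q) * (s i ^ 2 * b i ^ 2 - 7 / 5 * τ * (s i * b i ^ 2)) ≤
        ∑ i : Fin d, ((if (i : ℕ) < ℓ then p i ^ 2 else 0) -
          (7 / 5 * τ) ^ (2 * q) * (2 / 5 * τ) * (if ¬ (i : ℕ) < ℓ then s i * b i ^ 2 else 0)) := by
      refine Finset.sum_le_sum fun i _ => ?_
      have hsb : 0 ≤ s i * b i ^ 2 := mul_nonneg (hs i) (sq_nonneg _)
      have e : s i ^ 2 * b i ^ 2 - 7 / 5 * τ * (s i * b i ^ 2) =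
          (s i - 7 / 5 * τ) * (s i * b i ^ 2) := by ring
      rw [e]
      by_cases hi : (i : ℕ) < ℓ
      · rw [if_pos hi, if_neg (by tauto), mul_zero, sub_zero]
        have e2 : p i ^ 2 = s i ^ (2 * q) * (s i * (s i * b i ^ 2)) := by simp only [hp]; ring
        rw [e2]
        rcases le_total (s i) (7 / 5 * τ) with hle | hle
        · have h1 : (s i - 7 / 5 * τ) * (s i * b i ^ 2) ≤ 0 :=
            mul_nonpos_of_nonpos_of_nonneg (by linarith) hsb
          have h2 : 0 ≤ s i ^ (2 * q) * (s i * (s i * b i ^ 2)) :=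
            mul_nonneg (pow_nonneg (hs i) _) (mul_nonneg (hs i) hsb)
          exact (mul_nonpos_of_nonneg_of_nonpos hc.le h1).trans h2
        · refine mul_le_mul (pow_le_pow_left₀ (by positivity) hle _) ?_ ?_ (pow_nonneg (hs i) _)
          · exact mul_le_mul_of_nonneg_right (by linarith) hsb
          · exact mul_nonneg (by linarith) hsb
      · rw [if_neg hi, if_pos hi, zero_sub, mul_assoc, ← mul_neg, ← neg_mul]
        refine mul_le_mul_of_nonneg_left ?_ hc.le
        exact mul_le_mul_of_nonneg_right (by linarith [htail i hi]) hsb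
    refine key.trans ?_
    rw [Finset.sum_sub_distrib, ← Finset.mul_sum]
    change T - (7 / 5 * τ) ^ (2 * q) * (2 / 5 * τ) * W ≤ 0
    have h1 : T ≤ K * (τ ^ (2 * q + 1) * W) := hTU.trans (mul_le_mul_of_nonneg_left hUW hK0)
    have h2 := mul_le_mul_of_nonneg_right (hq h0) (show 0 ≤ τ ^ (2 * q + 1) * W by positivity)
    have h3 : 2 / 5 * (7 / 5 : ℝ) ^ (2 * q) * (τ ^ (2 * q + 1) * W) =
        (7 / 5 * τ) ^ (2 * q) * (2 / 5 * τ) * W := by rw [mul_pow]; ring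
    linarith

end Acceptance

/-! ### Orthogonal projection computed from normalized Gram–Schmidt vectors, some of which may
vanish. -/

section GramSchmidt

open InnerProductSpace

variable {F : Type*} [NormedAddCommGroup F] [InnerProductSpace ℝ F] {k : ℕ}

theorem inner_gramSchmidtNormed_of_ne (f : Fin k → F) {i j : Fin k} (h : i ≠ j) :
    inner ℝ (gramSchmidtNormed ℝ f i) (gramSchmidtNormed ℝ f j) = 0 := by
  rw [gramSchmidtNormed, gramSchmidtNormed, inner_smul_left, inner_smul_right,
    gramSchmidt_orthogonal ℝ f h]
  simp

/-- A dependent column yields the zero vector rather than a unit vector; both sides are then 0, so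
the projection formula persists without linear independence. -/
theorem inner_gramSchmidtNormed_sum (f : Fin k → F) (w : F) (i : Fin k) :
    inner ℝ (gramSchmidtNormed ℝ f i)
      (∑ j, (inner ℝ (gramSchmidtNormed ℝ f j) w : ℝ) • gramSchmidtNormed ℝ f j) =
      inner ℝ (gramSchmidtNormed ℝ f i) w := by
  rw [inner_sum, Finset.sum_eq_single i]
  · rw [inner_smul_right, real_inner_self_eq_norm_sq]
    by_cases h : gramSchmidtNormed ℝ f i = 0
    · simp [h]
    · rw [gramSchmidtNormed_unit_length' h]; simp
  · intro j _ hj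
    rw [inner_smul_right, inner_gramSchmidtNormed_of_ne f hj.symm, mul_zero]
  · simp

theorem norm_sq_sum_gramSchmidtNormed (f : Fin k → F) (w : F) :
    ‖∑ j, (inner ℝ (gramSchmidtNormed ℝ f j) w : ℝ) • gramSchmidtNormed ℝ f j‖ ^ 2 =
      ∑ j, (inner ℝ (gramSchmidtNormed ℝ f j) w : ℝ) ^ 2 := by
  rw [← real_inner_self_eq_norm_sq, sum_inner]
  refine Finset.sum_congr rfl fun i _ => ?_
  rw [inner_smul_left, inner_gramSchmidtNormed_sum]
  simp [sq]

/-- The component of `w` orthogonal to the vectors `f`. -/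
theorem exists_orthogonal_component (f : Fin k → F) (w : F) :
    ∃ r u : F, w = u + r ∧ u ∈ Submodule.span ℝ (Set.range f) ∧
      (∀ y ∈ Submodule.span ℝ (Set.range f), inner ℝ y r = 0) ∧
      ‖u‖ ^ 2 = ∑ j, (inner ℝ (gramSchmidtNormed ℝ f j) w : ℝ) ^ 2 := by
  set u := ∑ j, (inner ℝ (gramSchmidtNormed ℝ f j) w : ℝ) • gramSchmidtNormed ℝ f j with hu
  refine ⟨w - u, u, by abel, ?_, ?_, norm_sq_sum_gramSchmidtNormed f w⟩
  · rw [← span_gramSchmidt ℝ f, ← span_gramSchmidtNormed_range]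
    exact Submodule.sum_mem _ fun j _ => Submodule.smul_mem _ _ (Submodule.subset_span ⟨j, rfl⟩)
  · intro y hy
    rw [← span_gramSchmidt ℝ f, ← span_gramSchmidtNormed_range] at hy
    induction hy using Submodule.span_induction with
    | mem x hx =>
      obtain ⟨i, rfl⟩ := hx
      rw [inner_sub_right, hu, inner_gramSchmidtNormed_sum, sub_self]
    | zero => simp
    | add x y _ _ hx hy => rw [inner_add_left, hx, hy, add_zero]
    | smul a x _ hx => rw [inner_smul_left, hx, mul_zero]

end GramSchmidt

/-! ### Accuracy of simultaneous iteration from a well-conditioned start. -/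

section Accuracy

variable {d : ℕ}

theorem powerIterate_eq {m k : ℕ} (A : Matrix (Fin m) (Fin d) ℝ) (q : ℕ)
    (G : Matrix (Fin d) (Fin k) ℝ) : powerIterate A q G = (Aᵀ * A) ^ q * G := by
  unfold powerIterate
  induction q with
  | zero => simp
  | succ q ih =>
    rw [Function.iterate_succ_apply', ih, pow_succ', Matrix.mul_assoc, Matrix.mul_assoc]

theorem inner_gramBasis_pow {m : ℕ} (A : Matrix (Fin m) (Fin d) ℝ) (q : ℕ) (x : Fin d → ℝ)
    (i : Fin d) : inner ℝ (gramBasis A i) (WithLp.toLp 2 ((Aᵀ * A) ^ q *ᵥ x)) =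
      gramEig A i ^ q * inner ℝ (gramBasis A i) (WithLp.toLp 2 x) := by
  induction q with
  | zero => simp
  | succ q ih =>
    have h : ∀ y : Fin d → ℝ, inner ℝ (gramBasis A i) (WithLp.toLp 2 ((Aᵀ * A) *ᵥ y)) =
        gramEig A i * inner ℝ (gramBasis A i) (WithLp.toLp 2 y) := by
      intro y
      rw [← inner_gramBasis]
      simp only [EuclideanSpace.inner_eq_star_dotProduct, star_trivial, Matrix.toLpLin_apply]
      rw [← Matrix.mulVec_mulVec, dotProduct_comm, Matrix.dotProduct_mulVec,
        Matrix.vecMul_transpose, dotProduct_comm]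
    rw [pow_succ', ← Matrix.mulVec_mulVec, h, ih]
    ring

/-- The decomposition that the projection to the column space of an iterate induces. -/
theorem exists_projected_decomposition {m ℓ : ℕ} (c : Constants) (A : Matrix (Fin m) (Fin d) ℝ)
    (G : Matrix (Fin d) (Fin ℓ) ℝ) (x : EuclideanSpace ℝ (Fin d)) :
    ∃ b e : EuclideanSpace ℝ (Fin d), Matrix.toEuclideanLin A x =
        Matrix.toEuclideanLin A e + Matrix.toEuclideanLin A b ∧
      inner ℝ (Matrix.toEuclideanLin A e) (Matrix.toEuclideanLin A b) = 0 ∧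
      (∀ a : Fin ℓ → ℝ, inner ℝ (Matrix.toEuclideanLin A
        (WithLp.toLp 2 ((Aᵀ * A) ^ powerRounds c m *ᵥ (G *ᵥ a)))) (Matrix.toEuclideanLin A b) = 0) ∧
      ‖Matrix.toEuclideanLin A e‖ ^ 2 = ‖Matrix.toEuclideanLin (projected c A G) x‖ ^ 2 := by
  set Y := powerIterate A (powerRounds c m) G with hY
  set f : Fin ℓ → EuclideanSpace ℝ (Fin m) := fun j => WithLp.toLp 2 ((A * Y)ᵀ j) with hf
  have hfj : ∀ j, f j = Matrix.toEuclideanLin A (WithLp.toLp 2 (Yᵀ j)) := by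
    intro j
    ext i
    simp [hf, Matrix.mul_apply, Matrix.mulVec, dotProduct, mul_comm]
  -- Columns of `A * Y` lie in the range of `A`, so both parts of the projection of `Ax` are again
  -- images under `A` and can be expanded in the eigenbasis of AᵀA.
  have hspan : Submodule.span ℝ (Set.range f) ≤ LinearMap.range (Matrix.toEuclideanLin A) := by
    rw [Submodule.span_le]
    rintro _ ⟨j, rfl⟩
    exact ⟨_, (hfj j).symm⟩
  obtain ⟨r, u, hw, hu, horth, hnorm⟩ := exists_orthogonal_component f (Matrix.toEuclideanLin A x)
  obtain ⟨e, he⟩ := hspan hu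
  have hr : r = Matrix.toEuclideanLin A (x - e) := by
    rw [map_sub, he, hw]; abel
  refine ⟨x - e, e, by rw [← map_add]; congr 1; abel, ?_, ?_, ?_⟩
  · rw [← hr, he]; exact horth u hu
  · intro a
    rw [← hr]
    refine horth _ ?_
    have : Matrix.toEuclideanLin A (WithLp.toLp 2 ((Aᵀ * A) ^ powerRounds c m *ᵥ (G *ᵥ a))) =
        ∑ j, a j • f j := by
      simp only [hfj, ← map_smul, ← map_sum]
      congr 1
      ext i
      rw [Matrix.mulVec_mulVec, ← powerIterate_eq, ← hY]
      simp [Matrix.mulVec, dotProduct, mul_comm]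
    rw [this]
    exact Submodule.sum_mem _ fun j _ => Submodule.smul_mem _ _ (Submodule.subset_span ⟨j, rfl⟩)
  · rw [he, hnorm, EuclideanSpace.norm_sq_eq]
    refine Finset.sum_congr rfl fun j _ => ?_
    rw [Real.norm_eq_abs, sq_abs]
    congr 1
    have hP : projected c A G = (orthonormalized (A * Y))ᵀ * A := by
      rw [projected, Matrix.transpose_mul, Matrix.transpose_transpose]
    rw [hP]
    change _ = (((orthonormalized (A * Y))ᵀ * A) *ᵥ x.ofLp) j
    rw [← Matrix.mulVec_mulVec, Matrix.toLpLin_apply, PiLp.inner_apply]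
    simp only [Matrix.mulVec, dotProduct, orthonormalized, hf]
    refine Finset.sum_congr rfl fun i _ => ?_
    simp [mul_comm]

theorem norm_sq_projected_le {m ℓ : ℕ} (c : Constants) (A : Matrix (Fin m) (Fin d) ℝ)
    (G : Matrix (Fin d) (Fin ℓ) ℝ) (x : EuclideanSpace ℝ (Fin d)) :
    ‖Matrix.toEuclideanLin (projected c A G) x‖ ^ 2 ≤ ‖Matrix.toEuclideanLin A x‖ ^ 2 := by
  obtain ⟨b, e, h1, h2, -, h4⟩ := exists_projected_decomposition c A G x
  rw [h1, norm_add_sq_real, h2, h4]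
  have := sq_nonneg ‖Matrix.toEuclideanLin A b‖
  linarith

/-- The smallest retained eigenvalue is almost as large as it can be. -/
theorem le_gramEig_projected {m ℓ : ℕ} (hℓ : 0 < ℓ) (hℓd : ℓ ≤ d) (c : Constants)
    (A : Matrix (Fin m) (Fin d) ℝ) (G : Matrix (Fin d) (Fin ℓ) ℝ) (K : ℝ)
    (hS : 0 < gramEig A (ℓ - 1))
    (hinj : ∀ a : Fin ℓ → ℝ, (∀ i : Fin d, (i : ℕ) < ℓ →
      inner ℝ (gramBasis A i) (WithLp.toLp 2 (G *ᵥ a)) = 0) → a = 0)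
    (htail : ∀ a : Fin ℓ → ℝ, ∑ i : Fin d, (if ¬ (i : ℕ) < ℓ ∧ gramEig A i ≠ 0 then
        inner ℝ (gramBasis A i) (WithLp.toLp 2 (G *ᵥ a)) ^ 2 else 0) ≤
      K * ∑ i : Fin d, (if (i : ℕ) < ℓ then
        inner ℝ (gramBasis A i) (WithLp.toLp 2 (G *ᵥ a)) ^ 2 else 0))
    (hq : (3 / 5 : ℝ) ^ (2 * powerRounds c m + 2) * K ≤ 2 / 5) :
    3 / 5 * gramEig A (ℓ - 1) ≤ gramEig (projected c A G) (ℓ - 1) := by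
  set q := powerRounds c m with hqdef
  -- Test space for Courant–Fischer, with one power more than the iterate: f(a) = AᵀA y, where Ay
  -- lies in the column space onto which the projection is made. Hence ⟨Ay, A f(a)⟩ = ‖f(a)‖², and
  -- Cauchy–Schwarz bounds ‖P f(a)‖ from below.
  let f : (Fin ℓ → ℝ) →ₗ[ℝ] EuclideanSpace ℝ (Fin d) :=
    (Matrix.toEuclideanLin ((Aᵀ * A) ^ (q + 1) * G)) ∘ₗ
      (WithLp.linearEquiv 2 ℝ (Fin ℓ → ℝ)).symm.toLinearMap
  have hfa : ∀ a, f a = WithLp.toLp 2 ((Aᵀ * A) ^ (q + 1) *ᵥ (G *ᵥ a)) := by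
    intro a
    rw [Matrix.mulVec_mulVec]; rfl
  have hcoord : ∀ a i, inner ℝ (gramBasis A i) (f a) =
      gramEig A i ^ (q + 1) * inner ℝ (gramBasis A i) (WithLp.toLp 2 (G *ᵥ a)) := by
    intro a i
    rw [hfa, inner_gramBasis_pow]
  refine le_gramEig hℓ hℓd _ _ f ?_ ?_
  · rw [← LinearMap.ker_eq_bot, LinearMap.ker_eq_bot']
    intro a ha
    refine hinj a fun i hi => ?_
    have h := hcoord a i
    rw [ha, inner_zero_right] at h
    have hpos : 0 < gramEig A i := hS.trans_le (gramEig_antitone A (by omega))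
    exact (mul_eq_zero.1 h.symm).resolve_left (pow_ne_zero _ hpos.ne')
  · intro a
    set h : Fin d → ℝ := fun i => inner ℝ (gramBasis A i) (WithLp.toLp 2 (G *ᵥ a)) with hh
    have hsum := sum_pow_ge (q := q) (fun i : Fin d => gramEig A i) h (gramEig A (ℓ - 1)) K
      (fun i => gramEig_nonneg A i) hS.le (fun i hi => gramEig_antitone A (by omega)) (htail a) hq
    set N₁ := ∑ i : Fin d, gramEig A i ^ (2 * q + 1) * h i ^ 2 with hN₁
    set N₂ := ∑ i : Fin d, gramEig A i ^ (2 * q + 2) * h i ^ 2 with hN₂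
    have hN₁0 : 0 ≤ N₁ := Finset.sum_nonneg fun i _ =>
      mul_nonneg (pow_nonneg (gramEig_nonneg A i) _) (sq_nonneg _)
    have hnf : ‖f a‖ ^ 2 = N₂ := by
      rw [norm_sq_eq_sum_gramBasis A]
      refine Finset.sum_congr rfl fun i _ => ?_
      rw [hcoord]; ring
    set y := WithLp.toLp 2 ((Aᵀ * A) ^ q *ᵥ (G *ᵥ a)) with hy
    have hyc : ∀ i, inner ℝ (gramBasis A i) y = gramEig A i ^ q * h i := fun i =>
      inner_gramBasis_pow A q _ i
    have hny : ‖Matrix.toEuclideanLin A y‖ ^ 2 = N₁ := by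
      rw [norm_sq_toEuclideanLin]
      refine Finset.sum_congr rfl fun i _ => ?_
      rw [hyc]; ring
    have hyf : inner ℝ (Matrix.toEuclideanLin A y) (Matrix.toEuclideanLin A (f a)) = N₂ := by
      rw [inner_toEuclideanLin]
      refine Finset.sum_congr rfl fun i _ => ?_
      rw [hyc, hcoord]; ring
    obtain ⟨b, e, h1, -, h3, h4⟩ := exists_projected_decomposition c A G (f a)
    have hcs : N₂ ^ 2 ≤ N₁ * ‖Matrix.toEuclideanLin (projected c A G) (f a)‖ ^ 2 := by
      rw [← hyf, h1, inner_add_right, h3 a, add_zero, ← hny, ← h4, ← mul_pow, ← sq_abs]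
      exact pow_le_pow_left₀ (abs_nonneg _) (abs_real_inner_le_norm _ _) 2
    rw [hnf]
    rcases hN₁0.eq_or_lt with h0 | h0
    · have : N₂ = 0 := by
        have := hcs
        rw [← h0, zero_mul] at this
        exact pow_eq_zero_iff (two_ne_zero) |>.1 (le_antisymm this (sq_nonneg _))
      rw [this, mul_zero]; positivity
    · refine le_of_mul_le_mul_left ?_ h0
      refine le_trans ?_ hcs
      have hN₂0 : 0 ≤ N₂ := hnf ▸ sq_nonneg _
      nlinarith

/-- What the projection misses is almost as small as it can be. -/
theorem norm_sq_sub_projected_le {m ℓ : ℕ} (hℓd : ℓ ≤ d) (c : Constants)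
    (A : Matrix (Fin m) (Fin d) ℝ) (G : Matrix (Fin d) (Fin ℓ) ℝ) (K : ℝ) (hK0 : 0 ≤ K)
    (hinj : ∀ a : Fin ℓ → ℝ, (∀ i : Fin d, (i : ℕ) < ℓ →
      inner ℝ (gramBasis A i) (WithLp.toLp 2 (G *ᵥ a)) = 0) → a = 0)
    (htail : gramEig A ℓ ≠ 0 → ∀ a : Fin ℓ → ℝ,
      ∑ i : Fin d, (if ¬ (i : ℕ) < ℓ ∧ gramEig A i ≠ 0 then
        inner ℝ (gramBasis A i) (WithLp.toLp 2 (G *ᵥ a)) ^ 2 else 0) ≤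
      K * ∑ i : Fin d, (if (i : ℕ) < ℓ then
        inner ℝ (gramBasis A i) (WithLp.toLp 2 (G *ᵥ a)) ^ 2 else 0))
    (hq : gramEig A ℓ ≠ 0 → K ≤ 2 / 5 * (7 / 5 : ℝ) ^ (2 * powerRounds c m))
    (x : EuclideanSpace ℝ (Fin d)) :
    ‖Matrix.toEuclideanLin A x‖ ^ 2 ≤ ‖Matrix.toEuclideanLin (projected c A G) x‖ ^ 2 +
      7 / 5 * gramEig A ℓ * ‖x‖ ^ 2 := by
  set q := powerRounds c m with hqdef
  obtain ⟨b, e, h1, h2, h3, h4⟩ := exists_projected_decomposition c A G x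
  set β : Fin d → ℝ := fun i => inner ℝ (gramBasis A i) b with hβ
  let L : (Fin ℓ → ℝ) →ₗ[ℝ] (Fin ℓ → ℝ) := LinearMap.pi fun i =>
    (innerₛₗ ℝ (gramBasis A (Fin.castLE hℓd i))) ∘ₗ (Matrix.toEuclideanLin G) ∘ₗ
      (WithLp.linearEquiv 2 ℝ (Fin ℓ → ℝ)).symm.toLinearMap
  have hL : ∀ a i, L a i = inner ℝ (gramBasis A (Fin.castLE hℓd i)) (WithLp.toLp 2 (G *ᵥ a)) :=
    fun a i => rfl
  have hLinj : Function.Injective L := by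
    rw [← LinearMap.ker_eq_bot, LinearMap.ker_eq_bot']
    intro a ha
    refine hinj a fun i hi => ?_
    have := congrFun ha ⟨i, hi⟩
    rwa [hL] at this
  -- The top ℓ × ℓ block of coordinates of `G` is invertible, so some combination of columns has
  -- exactly the top coordinates needed to compare it with the residual `b`.
  obtain ⟨a, ha⟩ := (LinearMap.injective_iff_surjective.1 hLinj)
    (fun i => gramEig A i ^ (q + 1) * β (Fin.castLE hℓd i))
  set h : Fin d → ℝ := fun i => inner ℝ (gramBasis A i) (WithLp.toLp 2 (G *ᵥ a)) with hh
  have hmain := sum_sq_mul_le (ℓ := ℓ) (q := q) (fun i : Fin d => gramEig A i) β h (gramEig A ℓ) K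
    (fun i => gramEig_nonneg A i) (gramEig_nonneg A ℓ)
    (fun i hi => gramEig_antitone A (by omega))
    (fun i hi => by
      have := congrFun ha ⟨i, hi⟩
      rw [hL] at this
      exact this)
    (fun h0 => htail h0 a) hK0 hq
    (by
      rw [← h3 a, inner_toEuclideanLin]
      refine Finset.sum_congr rfl fun i _ => ?_
      rw [inner_gramBasis_pow]
      simp only [hβ, hh]
      ring)
  set N := ∑ i : Fin d, gramEig A i * β i ^ 2 with hN
  have hnb : ‖Matrix.toEuclideanLin A b‖ ^ 2 = N := norm_sq_toEuclideanLin A b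
  have hN0 : 0 ≤ N := hnb ▸ sq_nonneg _
  have hbx : N = ∑ i : Fin d, (gramEig A i * β i) * inner ℝ (gramBasis A i) x := by
    have h5 : inner ℝ (Matrix.toEuclideanLin A b) (Matrix.toEuclideanLin A x) = N := by
      rw [h1, inner_add_right, real_inner_comm, h2, zero_add, real_inner_self_eq_norm_sq, hnb]
    rw [← h5, inner_toEuclideanLin]
    exact Finset.sum_congr rfl fun i _ => by simp only [hβ]; ring
  -- Cauchy–Schwarz for N = ⟨Ab, Ax⟩ = ⟨AᵀAb, x⟩, where ‖AᵀAb‖² ≤ (7/5)τN by `hmain` with τ the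
  -- eigenvalue at index ℓ. One factor N cancels.
  have hcs : N ^ 2 ≤ 7 / 5 * gramEig A ℓ * N * ‖x‖ ^ 2 := by
    rw [norm_sq_eq_sum_gramBasis A x]
    conv_lhs => rw [hbx]
    refine (Finset.sum_mul_sq_le_sq_mul_sq _ _ _).trans ?_
    refine mul_le_mul_of_nonneg_right ?_ (Finset.sum_nonneg fun _ _ => sq_nonneg _)
    refine le_trans (le_of_eq ?_) hmain
    exact Finset.sum_congr rfl fun i _ => by ring
  rw [h1, norm_add_sq_real, h2, h4, hnb]
  have hpos : 0 ≤ 7 / 5 * gramEig A ℓ * ‖x‖ ^ 2 :=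
    mul_nonneg (mul_nonneg (by norm_num) (gramEig_nonneg A ℓ)) (sq_nonneg _)
  have : N ≤ 7 / 5 * gramEig A ℓ * ‖x‖ ^ 2 := by
    rcases hN0.eq_or_lt with h0 | h0
    · rw [← h0]; exact hpos
    · refine le_of_mul_le_mul_left ?_ h0
      nlinarith
  linarith

/-- A well-conditioned starting matrix leads to acceptance. -/
theorem accepts_of_wellConditioned {m ℓ : ℕ} (hℓ : 0 < ℓ) (hℓd : ℓ ≤ d) (c : Constants)
    (A : Matrix (Fin m) (Fin d) ℝ) (δ : ℝ) (n : ℕ) (G : Fin d → Fin ℓ → ℝ) (x : UnitSphere d)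
    (K : ℝ) (hK0 : 0 ≤ K)
    (hinj : ∀ a : Fin ℓ → ℝ, (∀ i : Fin d, (i : ℕ) < ℓ →
      inner ℝ (gramBasis A i) (WithLp.toLp 2 (Matrix.of G *ᵥ a)) = 0) → a = 0)
    (htail : gramEig A ℓ ≠ 0 → ∀ a : Fin ℓ → ℝ,
      ∑ i : Fin d, (if ¬ (i : ℕ) < ℓ ∧ gramEig A i ≠ 0 then
        inner ℝ (gramBasis A i) (WithLp.toLp 2 (Matrix.of G *ᵥ a)) ^ 2 else 0) ≤
      K * ∑ i : Fin d, (if (i : ℕ) < ℓ then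
        inner ℝ (gramBasis A i) (WithLp.toLp 2 (Matrix.of G *ᵥ a)) ^ 2 else 0))
    (hq : gramEig A ℓ ≠ 0 → (3 / 5 : ℝ) ^ (2 * powerRounds c m + 2) * K ≤ 2 / 5 ∧
      K ≤ 2 / 5 * (7 / 5 : ℝ) ^ (2 * powerRounds c m)) :
    Accepts c A δ n G x := by
  have hlast : 0 ≤ gramEig (projected c A (Matrix.of G)) (ℓ - 1) := gramEig_nonneg _ _
  refine norm_iterate_verifyMap_shrinkOf_le hℓ hℓd A _ (norm_sq_projected_le c A _) (fun y => ?_) _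
    _ ?_
  · refine (norm_sq_sub_projected_le hℓd c A _ K hK0 hinj htail (fun h => (hq h).2) y).trans ?_
    -- The two accuracy bounds combine to (7/5)(5/3) = 28/12 ≤ 29/12.
    have hle : 7 / 5 * gramEig A ℓ ≤ 29 / 12 * gramEig (projected c A (Matrix.of G)) (ℓ - 1) := by
      rcases eq_or_ne (gramEig A ℓ) 0 with h0 | h0
      · rw [h0]; linarith
      · have hanti : gramEig A ℓ ≤ gramEig A (ℓ - 1) := gramEig_antitone A (by omega)
        have hpos : 0 < gramEig A (ℓ - 1) :=
          (lt_of_le_of_ne (gramEig_nonneg A ℓ) h0.symm).trans_le hanti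
        have := le_gramEig_projected hℓ hℓd c A (Matrix.of G) K hpos hinj (htail h0) (hq h0).1
        linarith
    have := mul_le_mul_of_nonneg_right hle (sq_nonneg ‖y‖)
    linarith
  · have := x.2
    rw [mem_sphere_zero_iff_norm] at this
    exact this.le

end Accuracy

/-! ### Small-ball bounds for Gaussian determinants and moments of Gaussian coordinates. -/

section Gaussian

/-- Fubini with coordinate `j` integrated first: a bound on every slice passes to the product
measure. -/
theorem measure_pi_le_of_update {ι : Type*} [Fintype ι] [DecidableEq ι] {X : ι → Type*}
    [∀ i, MeasurableSpace (X i)] (μ : ∀ i, Measure (X i)) [∀ i, IsProbabilityMeasure (μ i)] (j : ι)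
    {S : Set (∀ i, X i)} (hS : MeasurableSet S) (c : ℝ≥0∞)
    (h : ∀ x, μ j {g | Function.update x j g ∈ S} ≤ c) : Measure.pi μ S ≤ c := by
  obtain ⟨x⟩ : Nonempty (∀ i, X i) := (Measure.pi μ).nonempty_of_neZero
  have hf : Measurable (S.indicator (1 : (∀ i, X i) → ℝ≥0∞)) := measurable_one.indicator hS
  rw [← lintegral_indicator_one hS, lintegral_eq_lmarginal_univ x,
    lmarginal_erase' _ hf (Finset.mem_univ j)]
  refine (lmarginal_mono (g := fun _ => c) (fun y => ?_) x).trans ?_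
  · have : ∀ g, S.indicator (1 : (∀ i, X i) → ℝ≥0∞) (Function.update y j g) =
        {g | Function.update y j g ∈ S}.indicator 1 g := fun g => rfl
    simp only [this]
    rw [lintegral_indicator_one]
    · exact h y
    · exact (measurable_update y) hS
  · simp [lmarginal]

variable {d : ℕ}

/-- Rotation invariance of the standard Gaussian vector. -/
theorem map_inner_gaussian (v : EuclideanSpace ℝ (Fin d)) (hv : ‖v‖ = 1) :
    (Measure.pi fun _ : Fin d => gaussianReal 0 1).map (fun g => inner ℝ v (WithLp.toLp 2 g)) =
      gaussianReal 0 1 := by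
  have h : (stdGaussian (EuclideanSpace ℝ (Fin d))).map (innerSL ℝ v) = gaussianReal 0 1 := by
    rw [IsGaussian.map_eq_gaussianReal, integral_strongDual_stdGaussian,
      variance_dual_stdGaussian, innerSL_apply_norm, hv]
    simp
  rw [← map_pi_eq_stdGaussian, Measure.map_map (by fun_prop) (by fun_prop)] at h
  exact h

/-- The density is at most 1/√(2π) ≤ 1/2, and the interval has length 2t. -/
theorem gaussianReal_abs_lt_le (t : ℝ) :
    gaussianReal 0 1 {x | |x| < t} ≤ ENNReal.ofReal t := by
  rw [gaussianReal_apply 0 one_ne_zero]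
  have hpdf : ∀ x, gaussianPDF 0 1 x ≤ ENNReal.ofReal (1 / 2) := by
    intro x
    rw [gaussianPDF]
    refine ENNReal.ofReal_le_ofReal ?_
    rw [gaussianPDFReal]
    have h1 : Real.exp (-(x - 0) ^ 2 / (2 * ((1 : NNReal) : ℝ))) ≤ 1 := by
      rw [Real.exp_le_one_iff]
      have := sq_nonneg (x - 0)
      simp only [NNReal.coe_one]
      linarith
    have h2 : (2 : ℝ) ≤ √(2 * Real.pi * ((1 : NNReal) : ℝ)) := by
      refine Real.le_sqrt_of_sq_le ?_
      have := Real.pi_gt_three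
      simp only [NNReal.coe_one]
      linarith
    have h3 : (√(2 * Real.pi * ((1 : NNReal) : ℝ)))⁻¹ ≤ 1 / 2 := by
      rw [inv_le_comm₀ (by linarith) (by norm_num)]; simpa using h2
    calc _ ≤ (1 / 2 : ℝ) * 1 := mul_le_mul h3 h1 (Real.exp_pos _).le (by norm_num)
      _ = 1 / 2 := by ring
  refine (setLIntegral_mono measurable_const fun x _ => hpdf x).trans ?_
  have hset : {x : ℝ | |x| < t} = Set.Ioo (-t) t := by ext x; simp [abs_lt]
  rw [setLIntegral_const, hset, Real.volume_Ioo, ← ENNReal.ofReal_mul (by norm_num)]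
  exact ENNReal.ofReal_le_ofReal (by linarith)

theorem measurable_det {Ω : Type*} [MeasurableSpace Ω] {ℓ : ℕ} (F : Ω → Matrix (Fin ℓ) (Fin ℓ) ℝ)
    (hF : ∀ i k, Measurable fun H => F H i k) : Measurable fun H => (F H).det := by
  have hc : Continuous fun M : Fin ℓ → Fin ℓ → ℝ => (Matrix.of M).det :=
    Continuous.matrix_det (continuous_matrix fun i j => by simp only [Matrix.of_apply]; fun_prop)
  exact hc.measurable.comp (measurable_pi_lambda _ fun i => measurable_pi_lambda _ fun k => hF i k)

theorem measurable_adjugate {Ω : Type*} [MeasurableSpace Ω] {ℓ : ℕ}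
    (F : Ω → Matrix (Fin ℓ) (Fin ℓ) ℝ) (hF : ∀ i k, Measurable fun H => F H i k) (i j : Fin ℓ) :
    Measurable fun H => (F H).adjugate i j := by
  simp only [Matrix.adjugate_apply]
  refine measurable_det _ fun a b => ?_
  by_cases h : a = j
  · subst h; simp
  · simpa [Matrix.updateRow_ne h] using hF a b

/-- Row `j` of the adjugate consists of the cofactors along column `j`, which do not involve that
column. Given the other columns they are constants. -/
theorem adjugate_updateCol_row {ℓ : ℕ} (M : Matrix (Fin ℓ) (Fin ℓ) ℝ) (j : Fin ℓ) (b : Fin ℓ → ℝ)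
    (i : Fin ℓ) : (M.updateCol j b).adjugate j i = M.adjugate j i := by
  have h : ∀ N : Matrix (Fin ℓ) (Fin ℓ) ℝ,
      N.adjugate j i = (N.updateCol j (Pi.single i 1)).det := by
    intro N
    rw [← Matrix.cramer_apply, Matrix.cramer_eq_adjugate_mulVec]
    simp
  rw [h, h, Matrix.updateCol_idem]

theorem det_updateCol_eq_sum {ℓ : ℕ} (M : Matrix (Fin ℓ) (Fin ℓ) ℝ) (j : Fin ℓ) (b : Fin ℓ → ℝ) :
    (M.updateCol j b).det = ∑ i, M.adjugate j i * b i := by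
  rw [← Matrix.cramer_apply, Matrix.cramer_eq_adjugate_mulVec]; rfl

/-- A determinant that is linear in a Gaussian vector is not small compared to its cofactors. -/
theorem measure_det_lt_le {ℓ : ℕ} (V : Fin ℓ → EuclideanSpace ℝ (Fin d)) (hV : Orthonormal ℝ V)
    (j : Fin ℓ) (F : (Fin ℓ → Fin d → ℝ) → Matrix (Fin ℓ) (Fin ℓ) ℝ)
    (hFm : ∀ i k, Measurable fun H => F H i k)
    (hF : ∀ H g, F (Function.update H j g) =
      (F H).updateCol j (fun i => inner ℝ (V i) (WithLp.toLp 2 g))) (t : ℝ) (ht : 0 ≤ t) :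
    gaussianMatrix ℓ d {H | (F H).det ^ 2 < t ^ 2 * ∑ i, (F H).adjugate j i ^ 2} ≤
      ENNReal.ofReal t := by
  unfold gaussianMatrix
  refine measure_pi_le_of_update _ j ?_ _ fun H => ?_
  · exact measurableSet_lt ((measurable_det F hFm).pow_const 2) (measurable_const.mul
      (Finset.measurable_fun_sum _ fun i _ => (measurable_adjugate F hFm j i).pow_const 2))
  -- Expanding along column `j` gives det = ⟨u, g⟩, where ‖u‖² is the sum of the squared cofactors.
  -- For u = 0 the event is empty because its inequality is strict.
  · set u := ∑ i, (F H).adjugate j i • V i with hu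
    have hun : ‖u‖ ^ 2 = ∑ i, (F H).adjugate j i ^ 2 := by
      rw [← real_inner_self_eq_norm_sq, hu, hV.inner_sum]
      simp [sq]
    have hset : {g | Function.update H j g ∈
        {H | (F H).det ^ 2 < t ^ 2 * ∑ i, (F H).adjugate j i ^ 2}} =
        {g | inner ℝ u (WithLp.toLp 2 g) ^ 2 < t ^ 2 * ‖u‖ ^ 2} := by
      ext g
      simp only [Set.mem_ofPred_eq, hF, adjugate_updateCol_row, det_updateCol_eq_sum, hun]
      rw [hu, sum_inner]
      simp only [inner_smul_left, conj_trivial]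
    rw [hset]
    rcases eq_or_ne u 0 with h0 | h0
    · simp [h0]
    · have hpos : 0 < ‖u‖ := norm_pos_iff.2 h0
      set v := ‖u‖⁻¹ • u with hv
      have hv1 : ‖v‖ = 1 := by
        rw [hv, norm_smul, norm_inv, norm_norm, inv_mul_cancel₀ hpos.ne']
      have huv : u = ‖u‖ • v := by rw [hv, smul_smul, mul_inv_cancel₀ hpos.ne', one_smul]
      have hset' : {g : Fin d → ℝ | inner ℝ u (WithLp.toLp 2 g) ^ 2 < t ^ 2 * ‖u‖ ^ 2} =
          (fun g => inner ℝ v (WithLp.toLp 2 g)) ⁻¹' {x : ℝ | |x| < t} := by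
        ext g
        simp only [Set.mem_ofPred_eq, Set.mem_preimage]
        have e : (inner ℝ u (WithLp.toLp 2 g) : ℝ) = ‖u‖ * inner ℝ v (WithLp.toLp 2 g) := by
          conv_lhs => rw [huv]
          rw [inner_smul_left]; simp
        rw [e, mul_pow, mul_comm, mul_lt_mul_iff_left₀ (by positivity), sq_lt_sq, abs_of_nonneg ht]
      rw [hset', ← Measure.map_apply (by fun_prop) (measurableSet_lt (by fun_prop) (by fun_prop)),
        map_inner_gaussian v hv1]
      exact gaussianReal_abs_lt_le t

/-- The matrix of the coordinates of the vectors `H k` along the vectors `V i`. -/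
noncomputable def coordMatrix {ℓ : ℕ} (V : Fin ℓ → EuclideanSpace ℝ (Fin d))
    (H : Fin ℓ → Fin d → ℝ) : Matrix (Fin ℓ) (Fin ℓ) ℝ :=
  Matrix.of fun i k => inner ℝ (V i) (WithLp.toLp 2 (H k))

theorem coordMatrix_update {ℓ : ℕ} (V : Fin ℓ → EuclideanSpace ℝ (Fin d))
    (H : Fin ℓ → Fin d → ℝ) (j : Fin ℓ) (g : Fin d → ℝ) :
    coordMatrix V (Function.update H j g) =
      (coordMatrix V H).updateCol j (fun i => inner ℝ (V i) (WithLp.toLp 2 g)) := by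
  ext i k
  by_cases h : k = j
  · subst h; simp [coordMatrix]
  · simp [coordMatrix, h]

theorem measurable_coordMatrix {ℓ : ℕ} (V : Fin ℓ → EuclideanSpace ℝ (Fin d)) (i k : Fin ℓ) :
    Measurable fun H => coordMatrix V H i k := by
  simp only [coordMatrix, Matrix.of_apply]
  fun_prop

/-- The first `n` columns of the matrix `coordMatrix V H`, completed by unit vectors. -/
noncomputable def partialMatrix {ℓ : ℕ} (V : Fin ℓ → EuclideanSpace ℝ (Fin d)) (n : ℕ)
    (H : Fin ℓ → Fin d → ℝ) : Matrix (Fin ℓ) (Fin ℓ) ℝ :=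
  Matrix.of fun i k => if (k : ℕ) < n then coordMatrix V H i k else (1 : Matrix _ _ ℝ) i k

/-- Insert the Gaussian columns one at a time: if the matrix was invertible, its new determinant is
a nonzero linear form in the inserted column. -/
theorem measure_det_partialMatrix_eq_zero {ℓ : ℕ} (V : Fin ℓ → EuclideanSpace ℝ (Fin d))
    (hV : Orthonormal ℝ V) (n : ℕ) (hn : n ≤ ℓ) :
    gaussianMatrix ℓ d {H | (partialMatrix V n H).det = 0} = 0 := by
  induction n with
  | zero =>
    have : ∀ H : Fin ℓ → Fin d → ℝ, partialMatrix V 0 H = 1 := by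
      intro H; ext i k; simp [partialMatrix]
    simp [this]
  | succ n ih =>
    let j : Fin ℓ := ⟨n, hn⟩
    have hF : ∀ H g, partialMatrix V (n + 1) (Function.update H j g) =
        (partialMatrix V (n + 1) H).updateCol j (fun i => inner ℝ (V i) (WithLp.toLp 2 g)) := by
      intro H g
      ext i k
      by_cases h : k = j
      · subst h; simp [partialMatrix, coordMatrix_update, j]
      · simp [partialMatrix, coordMatrix_update, h]
    have hm : ∀ i k, Measurable fun H => partialMatrix V (n + 1) H i k := by
      intro i k
      simp only [partialMatrix, Matrix.of_apply]
      split_ifs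
      · exact measurable_coordMatrix V i k
      · exact measurable_const
    -- The column replaced at this step was the unit vector number `j`, so the cofactor at (j, j) is
    -- the previous determinant.
    have hadj : ∀ H, (partialMatrix V (n + 1) H).adjugate j j = (partialMatrix V n H).det := by
      intro H
      have : partialMatrix V n H = (partialMatrix V (n + 1) H).updateCol j (Pi.single j 1) := by
        ext i k
        by_cases h : k = j
        · subst h; simp [partialMatrix, j, Matrix.one_apply, Pi.single_apply]
        · have hk : (k : ℕ) ≠ n := fun e => h (Fin.ext e)
          have : (k : ℕ) ≤ n ↔ (k : ℕ) < n := by omega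
          simp [partialMatrix, h, this]
      rw [this, det_updateCol_eq_sum]
      simp [Pi.single_apply]
    have hsub : {H | (partialMatrix V (n + 1) H).det = 0} ⊆ {H | (partialMatrix V n H).det = 0} ∪
        {H | (partialMatrix V (n + 1) H).det = 0 ∧ (partialMatrix V n H).det ≠ 0} := by
      intro H hH
      by_cases h : (partialMatrix V n H).det = 0
      · exact Or.inl h
      · exact Or.inr ⟨hH, h⟩
    refine measure_mono_null hsub (measure_union_null (ih (by omega)) ?_)
    -- A vanishing determinant with a nonzero cofactor lies in the small-ball event for every t > 0,
    -- whose probability is at most t.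
    refine le_antisymm (le_of_forall_pos_le_add fun ε hε => ?_) zero_le
    obtain ⟨t, ht, htε⟩ : ∃ t : ℝ, 0 < t ∧ ENNReal.ofReal t ≤ ε := by
      rcases eq_or_ne ε ⊤ with h | h
      · exact ⟨1, one_pos, h ▸ le_top⟩
      · exact ⟨ε.toReal, ENNReal.toReal_pos hε.ne' h, by rw [ENNReal.ofReal_toReal h]⟩
    rw [zero_add]
    refine le_trans ?_ ((measure_det_lt_le V hV j _ hm hF t ht.le).trans htε)
    refine measure_mono fun H hH => ?_
    simp only [Set.mem_ofPred_eq] at hH ⊢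
    rw [hH.1, ← hadj] at *
    have h1 : 0 < (partialMatrix V (n + 1) H).adjugate j j ^ 2 := by
      have := hH.2; positivity
    have h2 : (partialMatrix V (n + 1) H).adjugate j j ^ 2 ≤
        ∑ i, (partialMatrix V (n + 1) H).adjugate j i ^ 2 :=
      Finset.single_le_sum (f := fun i => (partialMatrix V (n + 1) H).adjugate j i ^ 2)
        (fun i _ => sq_nonneg _) (Finset.mem_univ j)
    have : 0 < ∑ i, (partialMatrix V (n + 1) H).adjugate j i ^ 2 := h1.trans_le h2
    simp only [ne_eq, OfNat.ofNat_ne_zero, not_false_eq_true, zero_pow]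
    positivity

theorem measure_det_coordMatrix_eq_zero {ℓ : ℕ} (V : Fin ℓ → EuclideanSpace ℝ (Fin d))
    (hV : Orthonormal ℝ V) : gaussianMatrix ℓ d {H | (coordMatrix V H).det = 0} = 0 := by
  have : ∀ H, partialMatrix V ℓ H = coordMatrix V H := by
    intro H; ext i k; simp [partialMatrix]
  simpa [this] using measure_det_partialMatrix_eq_zero V hV ℓ le_rfl

/-- The expected squared length of a Gaussian matrix in some directions. -/
theorem lintegral_sum_inner_sq {ℓ : ℕ} (b : OrthonormalBasis (Fin d) ℝ (EuclideanSpace ℝ (Fin d)))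
    (s : Finset (Fin d)) :
    ∫⁻ H, ENNReal.ofReal (∑ i ∈ s, ∑ k : Fin ℓ, inner ℝ (b i) (WithLp.toLp 2 (H k)) ^ 2)
      ∂(gaussianMatrix ℓ d) = s.card * ℓ := by
  have h1 : ∀ i k, ∫⁻ H : Fin ℓ → Fin d → ℝ, ENNReal.ofReal (inner ℝ (b i) (WithLp.toLp 2 (H k)) ^ 2)
      ∂(gaussianMatrix ℓ d) = 1 := by
    intro i k
    unfold gaussianMatrix
    rw [(measurePreserving_eval (fun _ : Fin ℓ => Measure.pi fun _ : Fin d => gaussianReal 0 1)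
      k).lintegral_comp (f := fun g => ENNReal.ofReal (inner ℝ (b i) (WithLp.toLp 2 g) ^ 2))
      (by fun_prop)]
    have h2 := lintegral_map (μ := Measure.pi fun _ : Fin d => gaussianReal 0 1)
      (f := fun x : ℝ => ENNReal.ofReal (x ^ 2))
      (g := fun g => (inner ℝ (b i) (WithLp.toLp 2 g) : ℝ)) (by fun_prop) (by fun_prop)
    rw [← h2, map_inner_gaussian _ (b.norm_eq_one i)]
    have hvar : ∫ x, x ^ 2 ∂(gaussianReal 0 1) = 1 := by
      have := variance_id_gaussianReal (μ := 0) (v := 1)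
      rw [variance_eq_integral (by fun_prop)] at this
      simpa using this
    rw [← ofReal_integral_eq_lintegral_ofReal, hvar, ENNReal.ofReal_one]
    · exact (memLp_id_gaussianReal 2).integrable_sq
    · exact ae_of_all _ fun x => sq_nonneg x
  have h3 : ∀ H : Fin ℓ → Fin d → ℝ,
      ENNReal.ofReal (∑ i ∈ s, ∑ k : Fin ℓ, inner ℝ (b i) (WithLp.toLp 2 (H k)) ^ 2) =
      ∑ i ∈ s, ∑ k : Fin ℓ, ENNReal.ofReal (inner ℝ (b i) (WithLp.toLp 2 (H k)) ^ 2) := by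
    intro H
    rw [ENNReal.ofReal_sum_of_nonneg fun i _ => Finset.sum_nonneg fun k _ => sq_nonneg _]
    exact Finset.sum_congr rfl fun i _ => ENNReal.ofReal_sum_of_nonneg fun k _ => sq_nonneg _
  simp only [h3]
  rw [lintegral_finsetSum _ (fun i _ => by fun_prop)]
  have h4 : ∀ i ∈ s, ∫⁻ H : Fin ℓ → Fin d → ℝ, ∑ k : Fin ℓ,
      ENNReal.ofReal (inner ℝ (b i) (WithLp.toLp 2 (H k)) ^ 2) ∂(gaussianMatrix ℓ d) = ℓ := by
    intro i _
    rw [lintegral_finsetSum _ (fun k _ => by fun_prop)]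
    simp [h1]
  rw [Finset.sum_congr rfl h4]
  simp

/-- The algorithm indexes the entries of a draw by rows, whereas the probability estimates resample
whole columns. -/
theorem map_transpose_gaussianMatrix (ℓ : ℕ) :
    (gaussianMatrix d ℓ).map (fun G k i => G i k) = gaussianMatrix ℓ d := by
  have h : ∀ a b : ℕ, gaussianMatrix a b =
      (Measure.infinitePi fun _ : Fin a × Fin b => gaussianReal 0 1).map
        (MeasurableEquiv.curry (Fin a) (Fin b) ℝ) := by
    intro a b
    rw [Measure.infinitePi_map_curry (fun (_ : Fin a) (_ : Fin b) => gaussianReal 0 1)]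
    simp only [Measure.infinitePi_eq_pi]
    rfl
  rw [h d ℓ, h ℓ d, ← Measure.infinitePi_map_piCongrLeft (fun _ : Fin ℓ × Fin d => gaussianReal 0 1)
    (Equiv.prodComm (Fin d) (Fin ℓ)), Measure.map_map (by fun_prop) (by fun_prop),
    Measure.map_map (by fun_prop) (by fun_prop)]
  rfl

end Gaussian

/-! ### A round of BoostedSparseShrink succeeds with probability at least 1/2. -/

section SuccessProbability

variable {d : ℕ}

/-- With ε = 1/4 and c₁ ≥ 3 there are q ≥ 12 log(4m) rounds. As e ≤ (7/5)⁴, it follows that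
(7/5)^(4q) ≥ (4m)^12, so (7/5)^(2q) ≥ 4096 m⁶. The first bound reduces to the second by 3/5 ≤ 5/7.
-/
theorem powerRounds_bounds (c : Constants) (hc : 3 ≤ c.simIter) {m : ℕ} (hm : 1 ≤ m) :
    (3 / 5 : ℝ) ^ (2 * powerRounds c m + 2) * (64 * (m : ℝ) ^ 5) ≤ 2 / 5 ∧
      64 * (m : ℝ) ^ 5 ≤ 2 / 5 * (7 / 5 : ℝ) ^ (2 * powerRounds c m) := by
  set q := powerRounds c m with hqdef
  have hm' : (1 : ℝ) ≤ m := by exact_mod_cast hm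
  have hlog : 0 ≤ Real.log (4 * m) := Real.log_nonneg (by linarith)
  have hq : 12 * Real.log (4 * m) ≤ q := by
    refine le_trans ?_ (Nat.le_ceil _)
    have e : c.simIter * (Real.log (m / (1 / 4)) / (1 / 4)) =
        4 * c.simIter * Real.log (4 * m) := by
      have : (m : ℝ) / (1 / 4) = 4 * m := by ring
      rw [this]; ring
    rw [e]
    exact mul_le_mul_of_nonneg_right (by linarith) hlog
  have hexp : (4 * m : ℝ) ^ 6 ≤ (7 / 5 : ℝ) ^ (2 * q) := by
    have h1 : Real.exp 1 ≤ (7 / 5 : ℝ) ^ 4 := by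
      have := Real.exp_one_lt_d9
      norm_num
      linarith
    have h2 : (4 * m : ℝ) ^ 12 ≤ ((7 / 5 : ℝ) ^ (2 * q)) ^ 2 := by
      calc (4 * m : ℝ) ^ 12 = Real.exp (12 * Real.log (4 * m)) := by
            rw [← Real.exp_log (show (0 : ℝ) < 4 * m by linarith), Real.log_exp, ← Real.exp_nat_mul]
            norm_num
        _ ≤ Real.exp q := Real.exp_le_exp.2 hq
        _ = Real.exp 1 ^ q := by rw [← Real.exp_nat_mul, mul_one]
        _ ≤ ((7 / 5 : ℝ) ^ 4) ^ q := pow_le_pow_left₀ (Real.exp_pos 1).le h1 q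
        _ = ((7 / 5 : ℝ) ^ (2 * q)) ^ 2 := by rw [← pow_mul, ← pow_mul]; congr 1; ring
    refine le_of_sq_le_sq ?_ (by positivity)
    rwa [← pow_mul]
  have h3 : 64 * (m : ℝ) ^ 5 ≤ 2 / 5 * (7 / 5 : ℝ) ^ (2 * q) := by
    have h4 : (m : ℝ) ^ 5 ≤ (m : ℝ) ^ 6 := pow_le_pow_right₀ hm' (by norm_num)
    have h5 : (4 * m : ℝ) ^ 6 = 4096 * (m : ℝ) ^ 6 := by rw [mul_pow]; norm_num
    have h6 : (0 : ℝ) ≤ (m : ℝ) ^ 5 := by positivity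
    linarith
  refine ⟨?_, h3⟩
  have h4 : (3 / 5 : ℝ) ^ (2 * q + 2) ≤ (5 / 7) ^ (2 * q) :=
    (pow_le_pow_left₀ (by norm_num) (by norm_num) _).trans
      (pow_le_pow_of_le_one (by norm_num) (by norm_num) (by omega))
  calc (3 / 5 : ℝ) ^ (2 * q + 2) * (64 * (m : ℝ) ^ 5)
      ≤ (5 / 7) ^ (2 * q) * (2 / 5 * (7 / 5 : ℝ) ^ (2 * q)) :=
        mul_le_mul h4 h3 (by positivity) (by positivity)
    _ = 2 / 5 * ((5 / 7) * (7 / 5)) ^ (2 * q) := by rw [mul_pow]; ring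
    _ = 2 / 5 := by norm_num

theorem sum_ite_lt {ℓ : ℕ} (hℓd : ℓ ≤ d) (f : Fin d → ℝ) :
    ∑ i : Fin d, (if (i : ℕ) < ℓ then f i else 0) = ∑ i : Fin ℓ, f (Fin.castLE hℓd i) := by
  rw [← Finset.sum_subset (Finset.subset_univ (Finset.univ.map (Fin.castLEEmb hℓd)))]
  · rw [Finset.sum_map]
    exact Finset.sum_congr rfl fun i _ => by simp
  · intro i _ hi
    rw [if_neg]
    intro h
    exact hi (Finset.mem_map.2 ⟨⟨i, h⟩, Finset.mem_univ _, Fin.ext rfl⟩)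

/-- The positions of the nonzero singular values after the first `ℓ`. -/
noncomputable def tailIndices {m : ℕ} (A : Matrix (Fin m) (Fin d) ℝ) (ℓ : ℕ) : Finset (Fin d) := by
  classical exact Finset.univ.filter fun i => ¬ (i : ℕ) < ℓ ∧ gramEig A i ≠ 0

theorem card_tailIndices_le {m : ℕ} (A : Matrix (Fin m) (Fin d) ℝ) (ℓ : ℕ) :
    (tailIndices A ℓ).card ≤ m := by
  classical
  rw [← Finset.card_map Fin.valEmbedding]
  refine (Finset.card_le_card (t := Finset.range m) ?_).trans (by simp)
  intro j hj
  obtain ⟨i, hi, rfl⟩ := Finset.mem_map.1 hj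
  rw [tailIndices, Finset.mem_filter] at hi
  rw [Finset.mem_range]
  by_contra h
  exact hi.2.2 (gramEig_eq_zero A (by simpa using h))

theorem inner_mulVec_eq {ℓ : ℕ} (G : Fin d → Fin ℓ → ℝ) (a : Fin ℓ → ℝ)
    (v : EuclideanSpace ℝ (Fin d)) : inner ℝ v (WithLp.toLp 2 (Matrix.of G *ᵥ a)) =
      ∑ k, inner ℝ v (WithLp.toLp 2 fun i => G i k) * a k := by
  simp only [PiLp.inner_apply, Matrix.mulVec, dotProduct, Matrix.of_apply, Finset.sum_mul]
  rw [Finset.sum_comm]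
  refine Finset.sum_congr rfl fun i _ => ?_
  simp [Finset.sum_mul]
  exact Finset.sum_congr rfl fun k _ => by ring

/-- Solving a linear system whose determinant is not small compared to the cofactors. -/
theorem sum_sq_le_of_det {ℓ : ℕ} (M : Matrix (Fin ℓ) (Fin ℓ) ℝ) (t : ℝ) (ht : 0 < t)
    (hdet : M.det ≠ 0) (hM : ∀ j, t ^ 2 * ∑ i, M.adjugate j i ^ 2 ≤ M.det ^ 2) (a : Fin ℓ → ℝ) :
    ∑ k, a k ^ 2 ≤ ℓ / t ^ 2 * ∑ i, (M *ᵥ a) i ^ 2 := by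
  have hj : ∀ j, a j ^ 2 ≤ 1 / t ^ 2 * ∑ i, (M *ᵥ a) i ^ 2 := by
    intro j
    have h1 : M.det * a j = ∑ i, M.adjugate j i * (M *ᵥ a) i := by
      have : M.adjugate *ᵥ (M *ᵥ a) = M.det • a := by
        rw [Matrix.mulVec_mulVec, Matrix.adjugate_mul, Matrix.smul_mulVec, Matrix.one_mulVec]
      have h := congrFun this j
      simpa [Matrix.mulVec, dotProduct] using h.symm
    have h2 : (M.det * a j) ^ 2 ≤ (∑ i, M.adjugate j i ^ 2) * ∑ i, (M *ᵥ a) i ^ 2 := by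
      rw [h1]; exact Finset.sum_mul_sq_le_sq_mul_sq _ _ _
    have h0 : 0 ≤ ∑ i, (M *ᵥ a) i ^ 2 := Finset.sum_nonneg fun i _ => sq_nonneg _
    have h3 := mul_le_mul_of_nonneg_right (hM j) h0
    have hd : 0 < M.det ^ 2 := by positivity
    rw [one_div, inv_mul_eq_div, le_div_iff₀ (by positivity)]
    refine le_of_mul_le_mul_left ?_ hd
    have h4 := mul_le_mul_of_nonneg_left h2 (sq_nonneg t)
    rw [mul_pow] at h4
    linarith
  calc ∑ k, a k ^ 2 ≤ ∑ _k : Fin ℓ, 1 / t ^ 2 * ∑ i, (M *ᵥ a) i ^ 2 :=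
        Finset.sum_le_sum fun k _ => hj k
    _ = ℓ / t ^ 2 * ∑ i, (M *ᵥ a) i ^ 2 := by simp; ring

open Classical in
/-- Starting matrices, given by their columns, for which the iteration may fail. -/
noncomputable def badStart {m ℓ : ℕ} (hℓd : ℓ ≤ d) (A : Matrix (Fin m) (Fin d) ℝ) :
    Set (Fin ℓ → Fin d → ℝ) :=
  {H | (coordMatrix (fun i => gramBasis A (Fin.castLE hℓd i)) H).det = 0} ∪
    ((⋃ j : Fin ℓ, {H | (coordMatrix (fun i => gramBasis A (Fin.castLE hℓd i)) H).det ^ 2 <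
      (1 / (4 * ℓ)) ^ 2 * ∑ i,
        (coordMatrix (fun i => gramBasis A (Fin.castLE hℓd i)) H).adjugate j i ^ 2}) ∪
    {H | gramEig A ℓ ≠ 0 ∧ 4 * m * ℓ ≤
      ∑ i ∈ tailIndices A ℓ, ∑ k, inner ℝ (gramBasis A i) (WithLp.toLp 2 (H k)) ^ 2})

theorem lt_of_gramEig_ne_zero {m ℓ : ℕ} {A : Matrix (Fin m) (Fin d) ℝ} (h : gramEig A ℓ ≠ 0) :
    ℓ < m := by
  by_contra hm
  exact h (gramEig_eq_zero A (by simpa using hm))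

/-- Cramer's rule with t = 1/(4ℓ) gives ‖a‖² ≤ 16ℓ³‖Ma‖², and the tail of Ga is at most 4mℓ‖a‖². The
product 64mℓ⁴ is at most 64m⁵, because ℓ < m whenever the eigenvalue at index ℓ is nonzero. -/
theorem accepts_of_notMem_badStart {m ℓ : ℕ} (hℓ : 0 < ℓ) (hℓd : ℓ ≤ d) (c : Constants)
    (hc : 3 ≤ c.simIter) (A : Matrix (Fin m) (Fin d) ℝ) (δ : ℝ) (n : ℕ) (G : Fin d → Fin ℓ → ℝ)
    (x : UnitSphere d) (hG : (fun k i => G i k) ∉ badStart hℓd A) : Accepts c A δ n G x := by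
  classical
  simp only [badStart, Set.mem_union, Set.mem_iUnion, Set.mem_ofPred_eq, not_or, not_exists,
    not_and, not_lt, not_le] at hG
  obtain ⟨hdet, hcof, htail⟩ := hG
  set M := coordMatrix (fun i => gramBasis A (Fin.castLE hℓd i)) (fun k i => G i k) with hM
  have htop : ∀ (a : Fin ℓ → ℝ) (i : Fin ℓ), inner ℝ (gramBasis A (Fin.castLE hℓd i))
      (WithLp.toLp 2 (Matrix.of G *ᵥ a)) = (M *ᵥ a) i := by
    intro a i
    rw [inner_mulVec_eq]; rfl
  have hℓ' : (0 : ℝ) < ℓ := by exact_mod_cast hℓ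
  refine accepts_of_wellConditioned hℓ hℓd c A δ n G x (64 * (m : ℝ) ^ 5) (by positivity) ?_ ?_ ?_
  · intro a ha
    have h0 : M *ᵥ a = 0 := by
      ext i
      rw [← htop]; exact ha _ (by simp)
    have h1 := sum_sq_le_of_det M (1 / (4 * ℓ)) (by positivity) hdet hcof a
    rw [h0] at h1
    simp only [Pi.zero_apply, ne_eq, OfNat.ofNat_ne_zero, not_false_eq_true, zero_pow,
      Finset.sum_const_zero, mul_zero] at h1
    have h2 := (Finset.sum_eq_zero_iff_of_nonneg (fun k _ => sq_nonneg (a k))).1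
      (le_antisymm h1 (Finset.sum_nonneg fun k _ => sq_nonneg (a k)))
    ext k
    exact pow_eq_zero_iff two_ne_zero |>.1 (h2 k (Finset.mem_univ k))
  · intro hne a
    have hlt := lt_of_gramEig_ne_zero hne
    have hℓm : (ℓ : ℝ) ≤ m := by exact_mod_cast hlt.le
    rw [sum_ite_lt hℓd (fun i => inner ℝ (gramBasis A i) (WithLp.toLp 2 (Matrix.of G *ᵥ a)) ^ 2)]
    simp only [htop]
    set S := ∑ i, (M *ᵥ a) i ^ 2 with hS
    have hS0 : 0 ≤ S := Finset.sum_nonneg fun k _ => sq_nonneg _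
    have h1 := sum_sq_le_of_det M (1 / (4 * ℓ)) (by positivity) hdet hcof a
    have h2 := (htail hne).le
    have h3 : ∑ i : Fin d, (if ¬ (i : ℕ) < ℓ ∧ gramEig A i ≠ 0 then
        inner ℝ (gramBasis A i) (WithLp.toLp 2 (Matrix.of G *ᵥ a)) ^ 2 else 0) ≤
        (∑ i ∈ tailIndices A ℓ, ∑ k, inner ℝ (gramBasis A i) (WithLp.toLp 2 fun j => G j k) ^ 2) *
          ∑ k, a k ^ 2 := by
      rw [tailIndices, ← Finset.sum_filter, Finset.sum_mul]
      refine le_trans (le_of_eq ?_) (Finset.sum_le_sum fun i _ => Finset.sum_mul_sq_le_sq_mul_sq _ _ _)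
      refine Finset.sum_congr (by congr) fun i _ => ?_
      rw [inner_mulVec_eq]
    have hT0 : 0 ≤ ∑ i ∈ tailIndices A ℓ, ∑ k,
        inner ℝ (gramBasis A i) (WithLp.toLp 2 fun j => G j k) ^ 2 :=
      Finset.sum_nonneg fun i _ => Finset.sum_nonneg fun k _ => sq_nonneg _
    calc _ ≤ _ := h3
      _ ≤ (4 * m * ℓ) * (ℓ / (1 / (4 * ℓ)) ^ 2 * S) :=
        mul_le_mul h2 h1 (Finset.sum_nonneg fun k _ => sq_nonneg _) (by positivity)
      _ = 64 * (m * (ℓ : ℝ) ^ 4) * S := by field_simp; ring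
      _ ≤ 64 * (m * (m : ℝ) ^ 4) * S := by gcongr
      _ = 64 * (m : ℝ) ^ 5 * S := by ring
  · intro hne
    exact powerRounds_bounds c hc (Nat.one_le_of_lt (lt_of_gramEig_ne_zero hne))

/-- Singular matrices form a null set. The ℓ small-ball events contribute ℓ · 1/(4ℓ) = 1/4. At most
m directions have nonzero eigenvalues, so the expected tail is at most mℓ, and Markov's inequality
at 4mℓ contributes the other 1/4. -/
theorem measure_badStart_le {m ℓ : ℕ} (hℓ : 0 < ℓ) (hℓd : ℓ ≤ d) (A : Matrix (Fin m) (Fin d) ℝ) :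
    gaussianMatrix ℓ d (badStart hℓd A) ≤ 1 / 2 := by
  have hV : Orthonormal ℝ fun i : Fin ℓ => gramBasis A (Fin.castLE hℓd i) :=
    (gramBasis A).orthonormal.comp _ (Fin.castLE_injective hℓd)
  have hℓ' : (0 : ℝ) < ℓ := by exact_mod_cast hℓ
  have h2 : gaussianMatrix ℓ d (⋃ j : Fin ℓ,
      {H | (coordMatrix (fun i => gramBasis A (Fin.castLE hℓd i)) H).det ^ 2 <
      (1 / (4 * ℓ)) ^ 2 * ∑ i,
        (coordMatrix (fun i => gramBasis A (Fin.castLE hℓd i)) H).adjugate j i ^ 2}) ≤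
      ENNReal.ofReal (1 / 4) := by
    refine (measure_iUnion_fintype_le _ _).trans ((Finset.sum_le_sum fun j _ =>
      measure_det_lt_le _ hV j _ (measurable_coordMatrix _) (fun H g => coordMatrix_update _ H j g)
        (1 / (4 * ℓ)) (by positivity)).trans (le_of_eq ?_))
    rw [Finset.sum_const, Finset.card_univ, Fintype.card_fin, nsmul_eq_mul,
      ← ENNReal.ofReal_natCast, ← ENNReal.ofReal_mul (by positivity)]
    congr 1
    field_simp
  have h3 : gaussianMatrix ℓ d {H | gramEig A ℓ ≠ 0 ∧ 4 * m * ℓ ≤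
      ∑ i ∈ tailIndices A ℓ, ∑ k, inner ℝ (gramBasis A i) (WithLp.toLp 2 (H k)) ^ 2} ≤
      ENNReal.ofReal (1 / 4) := by
    by_cases hne : gramEig A ℓ = 0
    · simp [hne]
    · have hm : (0 : ℝ) < m := by exact_mod_cast hℓ.trans (lt_of_gramEig_ne_zero hne)
      have hint := lintegral_sum_inner_sq (ℓ := ℓ) (gramBasis A) (tailIndices A ℓ)
      have hmar := mul_meas_ge_le_lintegral (μ := gaussianMatrix ℓ d)
        (f := fun H => ENNReal.ofReal (∑ i ∈ tailIndices A ℓ, ∑ k : Fin ℓ,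
          inner ℝ (gramBasis A i) (WithLp.toLp 2 (H k)) ^ 2)) (by fun_prop)
        (ENNReal.ofReal (4 * m * ℓ))
      rw [hint] at hmar
      have hcard : ((tailIndices A ℓ).card : ℝ≥0∞) * ℓ ≤
          ENNReal.ofReal (4 * m * ℓ) * ENNReal.ofReal (1 / 4) := by
        rw [← ENNReal.ofReal_mul (by positivity), show (4 * m * ℓ * (1 / 4) : ℝ) = m * ℓ by ring,
          ENNReal.ofReal_mul hm.le, ENNReal.ofReal_natCast, ENNReal.ofReal_natCast]
        gcongr
        exact card_tailIndices_le A ℓ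
      have hle := (ENNReal.mul_le_mul_iff_right (a := ENNReal.ofReal (4 * m * ℓ))
        (ENNReal.ofReal_pos.2 (by positivity)).ne' ENNReal.ofReal_ne_top).1
        (hmar.trans hcard)
      refine (measure_mono fun H hH => ?_).trans hle
      exact ENNReal.ofReal_le_ofReal hH.2
  unfold badStart
  refine (measure_union_le _ _).trans ?_
  rw [measure_det_coordMatrix_eq_zero _ hV, zero_add]
  refine (measure_union_le _ _).trans ((add_le_add h2 h3).trans (le_of_eq ?_))
  rw [← ENNReal.ofReal_add (by norm_num) (by norm_num)]
  rw [show (1 / 4 + 1 / 4 : ℝ) = 2⁻¹ by norm_num, ENNReal.ofReal_inv_of_pos (by norm_num), one_div,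
    ENNReal.ofReal_ofNat]

/-- A round of BoostedSparseShrink is rejected with probability at most `1/2`. -/
theorem measure_not_accepts_le {m ℓ : ℕ} (hℓ : 0 < ℓ) (hℓd : ℓ ≤ d) (c : Constants)
    (hc : 3 ≤ c.simIter) (A : Matrix (Fin m) (Fin d) ℝ) (δ : ℝ) (n : ℕ) (x : UnitSphere d) :
    gaussianMatrix d ℓ {G | ¬ Accepts c A δ n G x} ≤ 1 / 2 := by
  refine le_trans ?_ (measure_badStart_le hℓ hℓd A)
  rw [← map_transpose_gaussianMatrix (d := d) ℓ]
  -- This inequality holds for arbitrary sets, so the measurability of `badStart` is not needed.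
  refine le_trans (measure_mono fun G hG => ?_) (Measure.le_map_apply (μ := gaussianMatrix d ℓ)
    (f := fun (G : Fin d → Fin ℓ → ℝ) k i => G i k)
    (measurable_pi_lambda _ fun k => measurable_pi_lambda _ fun i => by fun_prop).aemeasurable _)
  by_contra h
  exact hG (accepts_of_notMem_badStart hℓ hℓd c hc A δ n G x h)

end SuccessProbability

/-! ### Measurability of the verdict, although singular vectors are chosen arbitrarily. -/

section Measurability

variable {d : ℕ}

/-- The trace pairing of a Gram matrix with N reduces to the quadratic form of N on the rows, which
gives the signs and zeros needed for the Moreau decomposition. -/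
theorem sum_gram_mul {r : ℕ} (B : Matrix (Fin r) (Fin d) ℝ) (N : Matrix (Fin d) (Fin d) ℝ) :
    ∑ i, ∑ j, (Bᵀ * B) i j * N i j = ∑ k, B k ⬝ᵥ (N *ᵥ B k) := by
  have h : ∀ k, B k ⬝ᵥ (N *ᵥ B k) = ∑ i, ∑ j, B k i * B k j * N i j := by
    intro k
    simp only [dotProduct, Matrix.mulVec, Finset.mul_sum]
    exact Finset.sum_congr rfl fun i _ => Finset.sum_congr rfl fun j _ => by ring
  simp only [h, Matrix.mul_apply, Matrix.transpose_apply, Finset.sum_mul]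
  rw [Finset.sum_comm]
  simp only [Finset.sum_comm (s := (Finset.univ : Finset (Fin d))) (t := (Finset.univ : Finset (Fin r)))]
  exact Finset.sum_congr rfl fun k _ => Finset.sum_comm

/-- The negative part of `PᵀP - λ`, where `λ` is the smallest retained eigenvalue. -/
noncomputable def shrinkDefect {ℓ r : ℕ} (P : Matrix (Fin r) (Fin d) ℝ) :
    Matrix (Fin d) (Fin d) ℝ :=
  (shrinkOf ℓ P)ᵀ * shrinkOf ℓ P - Pᵀ * P + gramEig P (ℓ - 1) • (1 : Matrix (Fin d) (Fin d) ℝ)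

theorem dotProduct_shrinkDefect {ℓ r : ℕ} (P : Matrix (Fin r) (Fin d) ℝ) (x : Fin d → ℝ) :
    x ⬝ᵥ (shrinkDefect (ℓ := ℓ) P *ᵥ x) =
      ‖Matrix.toEuclideanLin (shrinkOf ℓ P) (WithLp.toLp 2 x)‖ ^ 2 -
        ‖Matrix.toEuclideanLin P (WithLp.toLp 2 x)‖ ^ 2 +
        gramEig P (ℓ - 1) * ‖WithLp.toLp 2 x‖ ^ 2 := by
  have h : ∀ {k : ℕ} (B : Matrix (Fin k) (Fin d) ℝ),
      x ⬝ᵥ ((Bᵀ * B) *ᵥ x) = ‖Matrix.toEuclideanLin B (WithLp.toLp 2 x)‖ ^ 2 := by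
    intro k B
    rw [← mulVec_dotProduct_self, ← Matrix.mulVec_mulVec, Matrix.dotProduct_mulVec,
      Matrix.vecMul_transpose]
  rw [shrinkDefect, Matrix.add_mulVec, Matrix.sub_mulVec, dotProduct_add, dotProduct_sub, h, h,
    Matrix.smul_mulVec, Matrix.one_mulVec, dotProduct_smul, norm_sq_toLp x, smul_eq_mul]

theorem shrinkDefect_nonneg {ℓ r : ℕ} (hℓd : ℓ ≤ d) (P : Matrix (Fin r) (Fin d) ℝ)
    (x : Fin d → ℝ) : 0 ≤ x ⬝ᵥ (shrinkDefect (ℓ := ℓ) P *ᵥ x) := by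
  rw [dotProduct_shrinkDefect]
  linarith [norm_sq_le_shrinkOf hℓd P (WithLp.toLp 2 x)]

/-- Complementarity: the rows of the sketch are multiples of the top ℓ singular vectors, and on
these the quadratic form of the defect is μ − λ − μ + λ = 0, with μ the eigenvalue of the vector. -/
theorem shrinkDefect_row {ℓ r : ℕ} (hℓd : ℓ ≤ d) (P : Matrix (Fin r) (Fin d) ℝ) (k : Fin ℓ) :
    shrinkOf ℓ P k ⬝ᵥ (shrinkDefect (ℓ := ℓ) P *ᵥ shrinkOf ℓ P k) = 0 := by
  set v := gramBasis P (Fin.castLE hℓd k) with hv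
  have hrow : shrinkOf ℓ P k = √(gramEig P k - gramEig P (ℓ - 1)) • (v : Fin d → ℝ) := by
    ext i
    rw [shrinkOf_apply hℓd]; rfl
  have h : (v : Fin d → ℝ) ⬝ᵥ (shrinkDefect (ℓ := ℓ) P *ᵥ (v : Fin d → ℝ)) = 0 := by
    have e : WithLp.toLp 2 (v : Fin d → ℝ) = v := rfl
    rw [dotProduct_shrinkDefect, e, norm_sq_shrinkOf hℓd, norm_sq_toEuclideanLin,
      (gramBasis P).norm_eq_one, Finset.sum_eq_single (Fin.castLE hℓd k),
      Finset.sum_eq_single (Fin.castLE hℓd k)]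
    · simp [hv]
    · intro j _ hj
      rw [hv, OrthonormalBasis.inner_eq_zero _ hj]; simp
    · simp
    · intro j _ hj
      rw [hv, OrthonormalBasis.inner_eq_zero _ hj]; simp
    · simp
  rw [hrow, Matrix.mulVec_smul, smul_dotProduct, dotProduct_smul, h]
  simp

/-- The positive part of a symmetric matrix is nonexpansive in the Frobenius norm. -/
theorem sum_sq_shrinkOf_sub_le {ℓ r : ℕ} (hℓd : ℓ ≤ d) (P Q : Matrix (Fin r) (Fin d) ℝ) :
    ∑ i, ∑ j, (((shrinkOf ℓ P)ᵀ * shrinkOf ℓ P) i j - ((shrinkOf ℓ Q)ᵀ * shrinkOf ℓ Q) i j) ^ 2 ≤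
      ∑ i, ∑ j, ((Pᵀ * P - Qᵀ * Q - (gramEig P (ℓ - 1) - gramEig Q (ℓ - 1)) •
        (1 : Matrix (Fin d) (Fin d) ℝ)) i j) ^ 2 := by
  set X := (shrinkOf ℓ P)ᵀ * shrinkOf ℓ P with hX
  set Y := (shrinkOf ℓ Q)ᵀ * shrinkOf ℓ Q with hY
  set D := Pᵀ * P - Qᵀ * Q - (gramEig P (ℓ - 1) - gramEig Q (ℓ - 1)) •
        (1 : Matrix (Fin d) (Fin d) ℝ) with hD
  set M := shrinkDefect (ℓ := ℓ) P with hM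
  set N := shrinkDefect (ℓ := ℓ) Q with hN
  have hXM : ∑ i, ∑ j, X i j * M i j = 0 := by
    rw [hX, sum_gram_mul]
    exact Finset.sum_eq_zero fun k _ => shrinkDefect_row hℓd P k
  have hYN : ∑ i, ∑ j, Y i j * N i j = 0 := by
    rw [hY, sum_gram_mul]
    exact Finset.sum_eq_zero fun k _ => shrinkDefect_row hℓd Q k
  have hXN : 0 ≤ ∑ i, ∑ j, X i j * N i j := by
    rw [hX, sum_gram_mul]
    exact Finset.sum_nonneg fun k _ => shrinkDefect_nonneg hℓd Q _
  have hYM : 0 ≤ ∑ i, ∑ j, Y i j * M i j := by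
    rw [hY, sum_gram_mul]
    exact Finset.sum_nonneg fun k _ => shrinkDefect_nonneg hℓd P _
  have hDe : ∀ i j, D i j = X i j - Y i j - (M i j - N i j) := by
    intro i j
    have hm : D = X - Y - (M - N) := by
      rw [hM, hN, shrinkDefect, shrinkDefect, ← hX, ← hY, hD, sub_smul]
      abel
    rw [hm]; rfl
  -- D is the difference of X − M and Y − N, the decompositions of two symmetric matrices into
  -- positive and negative parts. In the expansion ⟨X, M⟩ and ⟨Y, N⟩ vanish while ⟨X, N⟩ and ⟨Y, M⟩
  -- are nonnegative, so ‖D‖ ≥ ‖X − Y‖.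
  have hexp : ∑ i, ∑ j, D i j ^ 2 = ∑ i, ∑ j, (X i j - Y i j) ^ 2 + ∑ i, ∑ j, (M i j - N i j) ^ 2 +
      2 * (∑ i, ∑ j, X i j * N i j + ∑ i, ∑ j, Y i j * M i j) -
      2 * (∑ i, ∑ j, X i j * M i j + ∑ i, ∑ j, Y i j * N i j) := by
    simp only [Finset.mul_sum, ← Finset.sum_add_distrib, ← Finset.sum_sub_distrib]
    refine Finset.sum_congr rfl fun i _ => Finset.sum_congr rfl fun j _ => ?_
    rw [hDe]; ring
  have hMN : 0 ≤ ∑ i, ∑ j, (M i j - N i j) ^ 2 :=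
    Finset.sum_nonneg fun i _ => Finset.sum_nonneg fun j _ => sq_nonneg _
  rw [hexp, hXM, hYN]
  linarith

/-- Weyl's bound, with the quadratic form of the difference estimated by the sum of the absolute
values of its entries. -/
theorem gramEig_sub_le {ℓ r : ℕ} (hℓ : 0 < ℓ) (hℓd : ℓ ≤ d) (P Q : Matrix (Fin r) (Fin d) ℝ) :
    gramEig P (ℓ - 1) - gramEig Q (ℓ - 1) ≤ ∑ i, ∑ j, |(Pᵀ * P - Qᵀ * Q) i j| := by
  rw [sub_le_iff_le_add']
  refine gramEig_le_add hℓ hℓd P Q _ fun x => ?_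
  set y : Fin d → ℝ := x.ofLp with hy
  have hx : x = WithLp.toLp 2 y := rfl
  rw [hx, ← mulVec_dotProduct_self, ← mulVec_dotProduct_self]
  have h : ∀ {k : ℕ} (B : Matrix (Fin k) (Fin d) ℝ),
      (B *ᵥ y) ⬝ᵥ (B *ᵥ y) = y ⬝ᵥ ((Bᵀ * B) *ᵥ y) := by
    intro k B
    rw [← Matrix.mulVec_mulVec, Matrix.dotProduct_mulVec y, Matrix.vecMul_transpose]
  rw [h, h, ← sub_le_iff_le_add', ← dotProduct_sub, ← Matrix.sub_mulVec]
  simp only [dotProduct, Matrix.mulVec, Finset.mul_sum, Finset.sum_mul]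
  refine Finset.sum_le_sum fun i _ => Finset.sum_le_sum fun j _ => ?_
  have hb : ∀ i, |y i| ≤ ‖WithLp.toLp 2 y‖ := fun i => by
    have := PiLp.norm_apply_le (WithLp.toLp 2 y) i
    simpa using this
  calc y i * ((Pᵀ * P - Qᵀ * Q) i j * y j) ≤ |y i * ((Pᵀ * P - Qᵀ * Q) i j * y j)| := le_abs_self _
    _ = |(Pᵀ * P - Qᵀ * Q) i j| * (|y i| * |y j|) := by rw [abs_mul, abs_mul]; ring
    _ ≤ |(Pᵀ * P - Qᵀ * Q) i j| * ‖WithLp.toLp 2 y‖ ^ 2 := by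
      rw [sq]
      gcongr
      · exact hb i
      · exact hb j

open Filter Topology in
theorem continuous_gramEig {ℓ r : ℕ} (hℓ : 0 < ℓ) (hℓd : ℓ ≤ d) :
    Continuous fun P : Matrix (Fin r) (Fin d) ℝ => gramEig P (ℓ - 1) := by
  rw [continuous_iff_continuousAt]
  intro Q
  rw [ContinuousAt, tendsto_iff_dist_tendsto_zero]
  have hb : ∀ P : Matrix (Fin r) (Fin d) ℝ, dist (gramEig P (ℓ - 1)) (gramEig Q (ℓ - 1)) ≤
      ∑ i, ∑ j, |(Pᵀ * P - Qᵀ * Q) i j| := by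
    intro P
    rw [Real.dist_eq, abs_le]
    refine ⟨?_, gramEig_sub_le hℓ hℓd P Q⟩
    have := gramEig_sub_le hℓ hℓd Q P
    have e : ∑ i, ∑ j, |(Qᵀ * Q - Pᵀ * P) i j| = ∑ i, ∑ j, |(Pᵀ * P - Qᵀ * Q) i j| :=
      Finset.sum_congr rfl fun i _ => Finset.sum_congr rfl fun j _ => abs_sub_comm _ _
    linarith
  have hc : Continuous fun P : Matrix (Fin r) (Fin d) ℝ => ∑ i, ∑ j, |(Pᵀ * P - Qᵀ * Q) i j| :=
    continuous_finsetSum _ fun i _ => continuous_finsetSum _ fun j _ =>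
      (((continuous_id.matrix_transpose.matrix_mul continuous_id).sub continuous_const).matrix_elem
        i j).abs
  have h0 := hc.tendsto Q
  simp only [sub_self, Matrix.zero_apply, abs_zero, Finset.sum_const_zero] at h0
  exact squeeze_zero (fun _ => dist_nonneg) hb h0

open Filter Topology in
/-- The Gram matrix of the sketch depends continuously on the decomposed matrix. -/
theorem continuous_gram_shrinkOf {ℓ r : ℕ} (hℓ : 0 < ℓ) (hℓd : ℓ ≤ d) (i j : Fin d) :
    Continuous fun P : Matrix (Fin r) (Fin d) ℝ => ((shrinkOf ℓ P)ᵀ * shrinkOf ℓ P) i j := by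
  rw [continuous_iff_continuousAt]
  intro Q
  rw [ContinuousAt, tendsto_iff_dist_tendsto_zero]
  set F : Matrix (Fin r) (Fin d) ℝ → ℝ := fun P => √(∑ i, ∑ j,
    ((Pᵀ * P - Qᵀ * Q - (gramEig P (ℓ - 1) - gramEig Q (ℓ - 1)) •
      (1 : Matrix (Fin d) (Fin d) ℝ)) i j) ^ 2) with hF
  have hb : ∀ P : Matrix (Fin r) (Fin d) ℝ, dist (((shrinkOf ℓ P)ᵀ * shrinkOf ℓ P) i j)
      (((shrinkOf ℓ Q)ᵀ * shrinkOf ℓ Q) i j) ≤ F P := by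
    intro P
    rw [Real.dist_eq, hF]
    refine Real.abs_le_sqrt ((le_trans ?_ (sum_sq_shrinkOf_sub_le hℓd P Q)))
    refine le_trans ?_ (Finset.single_le_sum (f := fun i => ∑ j,
      (((shrinkOf ℓ P)ᵀ * shrinkOf ℓ P) i j - ((shrinkOf ℓ Q)ᵀ * shrinkOf ℓ Q) i j) ^ 2)
      (fun i _ => Finset.sum_nonneg fun j _ => sq_nonneg _) (Finset.mem_univ i))
    exact Finset.single_le_sum (f := fun j =>
      (((shrinkOf ℓ P)ᵀ * shrinkOf ℓ P) i j - ((shrinkOf ℓ Q)ᵀ * shrinkOf ℓ Q) i j) ^ 2)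
      (fun j _ => sq_nonneg _) (Finset.mem_univ j)
  have hc : Continuous F := by
    refine Real.continuous_sqrt.comp (continuous_finsetSum _ fun i _ =>
      continuous_finsetSum _ fun j _ => Continuous.pow ?_ 2)
    exact (((continuous_id.matrix_transpose.matrix_mul continuous_id).sub continuous_const).sub
      (((continuous_gramEig hℓ hℓd).sub continuous_const).smul continuous_const)).matrix_elem i j
  have h0 := hc.tendsto Q
  have h1 : F Q = 0 := by simp [hF]
  rw [h1] at h0
  exact squeeze_zero (fun _ => dist_nonneg) hb h0

-- Gram–Schmidt need not be continuous where the vectors become dependent; measurability survives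
-- because division with 1/0 = 0 is measurable.
open InnerProductSpace in
theorem measurable_gramSchmidt {Ω : Type*} [MeasurableSpace Ω] {m k : ℕ}
    (f : Ω → Fin k → EuclideanSpace ℝ (Fin m)) (hf : ∀ j, Measurable fun ω => f ω j) (n : Fin k) :
    Measurable fun ω => gramSchmidt ℝ (f ω) n := by
  induction n using WellFoundedLT.induction with
  | ind n ih =>
    simp only [gramSchmidt_def ℝ _ n, Submodule.starProjection_singleton]
    refine (hf n).sub (Finset.measurable_fun_sum _ fun i hi => ?_)
    have h := ih i (Finset.mem_Iio.1 hi)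
    have hn := hf n
    simp only [RCLike.ofReal_real_eq_id, id_eq]
    exact ((h.inner hn).div (h.norm.pow_const 2)).smul h

theorem measurable_projected {ℓ m : ℕ} (c : Constants) (A : Matrix (Fin m) (Fin d) ℝ) :
    Measurable fun (G : Fin d → Fin ℓ → ℝ) (i : Fin ℓ) (j : Fin d) =>
      projected c A (Matrix.of G) i j := by
  refine measurable_pi_lambda _ fun i => measurable_pi_lambda _ fun j => ?_
  simp only [projected, Matrix.transpose_apply, Matrix.mul_apply]
  refine Finset.measurable_fun_sum _ fun k _ => measurable_const.mul ?_
  simp only [orthonormalized, Matrix.of_apply, InnerProductSpace.gramSchmidtNormed]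
  have h := measurable_gramSchmidt (fun (G : Fin d → Fin ℓ → ℝ) (j' : Fin ℓ) =>
    WithLp.toLp 2 ((A * powerIterate A (powerRounds c m) (Matrix.of G))ᵀ j')) (fun j' => by
      have h2 : Measurable fun G : Fin d → Fin ℓ → ℝ =>
          (A * powerIterate A (powerRounds c m) (Matrix.of G))ᵀ j' := by
        refine measurable_pi_lambda _ fun k => ?_
        simp only [powerIterate_eq, Matrix.transpose_apply, Matrix.mul_apply, Matrix.of_apply]
        fun_prop
      fun_prop) i
  have h3 := h.norm
  simp only [RCLike.ofReal_real_eq_id, id_eq]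
  have h4 : Measurable fun v : EuclideanSpace ℝ (Fin m) => v k := by fun_prop
  exact h4.comp (h3.inv.smul h)

theorem verifyMap_eq {m k : ℕ} (A : Matrix (Fin m) (Fin d) ℝ) (B : Matrix (Fin k) (Fin d) ℝ)
    (Δ : ℝ) (x : Fin d → ℝ) (i : Fin d) : verifyMap A B Δ x i =
      (Δ / 2)⁻¹ * ∑ j, ((Aᵀ * A) i j - (Bᵀ * B) i j) * x j := by
  rw [verifyMap, Matrix.mulVec_mulVec, Matrix.mulVec_mulVec, ← Matrix.sub_mulVec]
  rfl

theorem frobSq_eq_trace {k : ℕ} (B : Matrix (Fin k) (Fin d) ℝ) :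
    frobSq B = ∑ j, (Bᵀ * B) j j := by
  simp only [frobSq, Matrix.mul_apply, Matrix.transpose_apply]
  rw [Finset.sum_comm]
  exact Finset.sum_congr rfl fun _ _ => Finset.sum_congr rfl fun _ _ => sq _

/-- Both Δ and the tested operator involve the sketch only through its Gram matrix, so no measurable
choice of singular vectors is required. -/
theorem measurableSet_accepts {ℓ m : ℕ} (hℓ : 0 < ℓ) (hℓd : ℓ ≤ d) (c : Constants)
    (A : Matrix (Fin m) (Fin d) ℝ) (δ : ℝ) (n : ℕ) :
    MeasurableSet {p : (Fin d → Fin ℓ → ℝ) × UnitSphere d | Accepts c A δ n p.1 p.2} := by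
  set B : (Fin d → Fin ℓ → ℝ) → Matrix (Fin ℓ) (Fin d) ℝ :=
    fun G => shrinkOf ℓ (projected c A (Matrix.of G)) with hB
  have hgram : ∀ i j, Measurable fun G => ((B G)ᵀ * B G) i j := by
    intro i j
    have hc : Continuous fun P : Fin ℓ → Fin d → ℝ =>
        ((shrinkOf ℓ (Matrix.of P))ᵀ * shrinkOf ℓ (Matrix.of P)) i j :=
      (continuous_gram_shrinkOf hℓ hℓd i j).comp
        (continuous_matrix fun i j => by simp only [Matrix.of_apply]; fun_prop)
    exact hc.measurable.comp (measurable_projected c A)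
  have hΔ : Measurable fun G => (frobSq A - frobSq (B G)) / (6 / 41 * ℓ) := by
    simp only [frobSq_eq_trace (B _)]
    exact (measurable_const.sub (Finset.measurable_fun_sum _ fun j _ => hgram j j)).div_const _
  have hiter : ∀ k : ℕ, Measurable fun p : (Fin d → Fin ℓ → ℝ) × UnitSphere d =>
      (verifyMap A (B p.1) ((frobSq A - frobSq (B p.1)) / (6 / 41 * ℓ)))^[k]
        (fun j => (p.2 : EuclideanSpace ℝ (Fin d)) j) := by
    intro k
    induction k with
    | zero =>
      simp only [Function.iterate_zero, id_eq]
      exact measurable_pi_lambda _ fun j => by fun_prop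
    | succ k ih =>
      simp only [Function.iterate_succ_apply']
      refine measurable_pi_lambda _ fun i => ?_
      simp only [verifyMap_eq]
      refine ((hΔ.comp measurable_fst).div_const 2).inv.mul (Finset.measurable_fun_sum _ fun j _ => ?_)
      exact (measurable_const.sub ((hgram i j).comp measurable_fst)).mul
        ((measurable_pi_apply j).comp ih)
  refine measurableSet_le (Measurable.norm ?_) measurable_const
  have h5 : Measurable fun y : Fin d → ℝ => WithLp.toLp 2 y := by fun_prop
  exact h5.comp (hiter _)

end Measurability

/-- Substitution of a measurable random variable with countably many values. -/
theorem measurable_apply_countable {Ω β γ : Type*} [MeasurableSpace Ω] [MeasurableSpace β]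
    [MeasurableSpace γ] [Countable β] [MeasurableSingletonClass β] {F : Ω → β → γ} {e : Ω → β}
    (hF : ∀ b, Measurable fun ω => F ω b) (he : Measurable e) : Measurable fun ω => F ω (e ω) :=
  (measurable_from_prod_countable_left (f := fun p : Ω × β => F p.1 p.2) hF).comp
    (measurable_id.prodMk he)

/-! ### Independent trials with adaptive success sets, and a potential-function bound. -/

section Progress

variable {X : Type*}

open Classical in
/-- The number of successes before trial `k` when trial `k` succeeds after `f` successes if and
only if the draw `ω k` lies in `acc f k`. -/
noncomputable def progress (acc : ℕ → ℕ → Set X) (ω : ℕ → X) : ℕ → ℕ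
  | 0 => 0
  | k + 1 => if ω k ∈ acc (progress acc ω k) k then progress acc ω k + 1 else progress acc ω k

theorem progress_congr (acc : ℕ → ℕ → Set X) {ω ω' : ℕ → X} (k : ℕ)
    (h : ∀ i < k, ω i = ω' i) : progress acc ω k = progress acc ω' k := by
  induction k with
  | zero => rfl
  | succ k ih =>
    rw [progress, progress, ih fun i hi => h i (by omega), h k (by omega)]

variable [MeasurableSpace X]

theorem measurable_progress {acc : ℕ → ℕ → Set X} (hacc : ∀ f k, MeasurableSet (acc f k)) (k : ℕ) :
    Measurable fun ω => progress acc ω k := by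
  induction k with
  | zero => exact measurable_const
  | succ k ih =>
    classical
    simp only [progress]
    exact measurable_apply_countable
      (F := fun (ω : ℕ → X) f => if ω k ∈ acc f k then f + 1 else f)
      (fun f => Measurable.ite (measurableSet_preimage (measurable_pi_apply k) (hacc f k))
        measurable_const measurable_const) ih

variable [Nonempty X] (μ : Measure X) [IsProbabilityMeasure μ]

theorem indepFun_progress {acc : ℕ → ℕ → Set X} (hacc : ∀ f k, MeasurableSet (acc f k)) (k : ℕ) :
    IndepFun (fun ω => progress acc ω k) (fun ω => ω k) (Measure.infinitePi fun _ : ℕ => μ) := by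
  classical
  have h := (iIndepFun_infinitePi (P := fun _ : ℕ => μ) (X := fun _ x => x)
    fun _ => measurable_id).indepFun_finset (Finset.range k) {k} (by simp) measurable_pi_apply
  -- Filling the draws from `k` on with an arbitrary value exhibits the number of earlier successes
  -- as a function of the first `k` draws, which are independent of draw `k`.
  let extend : ((i : Finset.range k) → X) → ℕ → X := fun y i =>
    if hi : i ∈ Finset.range k then y ⟨i, hi⟩ else Classical.arbitrary X
  have hextend : Measurable extend := by
    refine measurable_pi_lambda _ fun i => ?_
    by_cases hi : i ∈ Finset.range k
    · simp only [extend, dif_pos hi]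
      exact measurable_pi_apply _
    · simp only [extend, dif_neg hi]
      exact measurable_const
  have h' := h.comp ((measurable_progress hacc k).comp hextend)
    (measurable_pi_apply (⟨k, by simp⟩ : ({k} : Finset ℕ)))
  have e : (fun ω => progress acc ω k) = (fun ω => progress acc ω k) ∘ extend ∘
      fun (ω : ℕ → X) (i : Finset.range k) => ω i := by
    funext ω
    refine progress_congr acc k fun i hi => ?_
    simp [extend, hi]
  rw [e]
  exact h'

/-- One step of the inhomogeneous Markov chain: the success count before trial `k` is independent of
the draw that decides the trial, so the latter can be integrated first. -/
theorem lintegral_progress_succ {acc : ℕ → ℕ → Set X} (hacc : ∀ f k, MeasurableSet (acc f k))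
    (k : ℕ) (g : ℕ → ℝ≥0∞) :
    ∫⁻ ω, g (progress acc ω (k + 1)) ∂(Measure.infinitePi fun _ : ℕ => μ) =
      ∫⁻ ω, (g (progress acc ω k + 1) * μ (acc (progress acc ω k) k) +
        g (progress acc ω k) * μ (acc (progress acc ω k) k)ᶜ)
        ∂(Measure.infinitePi fun _ : ℕ => μ) := by
  classical
  let ν := Measure.infinitePi fun _ : ℕ => μ
  have hp := measurable_progress hacc k
  have hmap : ν.map (fun ω => (progress acc ω k, ω k)) =
      (ν.map fun ω => progress acc ω k).prod μ := by
    rw [(indepFun_iff_map_prod_eq_prod_map_map hp.aemeasurable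
      (measurable_pi_apply k).aemeasurable).1 (indepFun_progress μ hacc k)]
    congr 1
    exact (measurePreserving_eval_infinitePi (fun _ : ℕ => μ) k).map_eq
  let F : ℕ × X → ℝ≥0∞ := fun p => if p.2 ∈ acc p.1 k then g (p.1 + 1) else g p.1
  have hF : Measurable F := by
    refine measurable_from_prod_countable_right fun f => ?_
    exact Measurable.ite (hacc f k) (measurable_const (a := g (f + 1)))
      (measurable_const (a := g f))
  have h₁ : ∫⁻ ω, g (progress acc ω (k + 1)) ∂ν = ∫⁻ p, F p
      ∂(ν.map fun ω => (progress acc ω k, ω k)) := by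
    rw [lintegral_map hF (hp.prodMk (measurable_pi_apply k))]
    refine lintegral_congr fun ω => ?_
    simp only [F, progress]
    split_ifs <;> rfl
  rw [h₁, hmap, lintegral_prod _ hF.aemeasurable, lintegral_map (by fun_prop) hp]
  refine lintegral_congr fun ω => ?_
  generalize progress acc ω k = f
  have h₂ : ∀ x, F (f, x) = (acc f k).indicator (fun _ => g (f + 1)) x +
      (acc f k)ᶜ.indicator (fun _ => g f) x := by
    intro x
    by_cases hx : x ∈ acc f k <;> simp [F, hx]
  simp_rw [h₂]
  rw [lintegral_add_left (measurable_const.indicator (hacc f k)),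
    lintegral_indicator_const (hacc f k), lintegral_indicator_const (hacc f k).compl]

/-- If every trial succeeds with probability at least `1 / 2`, a potential that pays for the cost of
each trial bounds the expected total cost. -/
theorem tsum_lintegral_progress_le {acc : ℕ → ℕ → Set X} (hacc : ∀ f k, MeasurableSet (acc f k))
    (hhalf : ∀ f k, μ (acc f k)ᶜ ≤ 1 / 2) (V cost : ℕ → ℕ → ℝ) (hV : ∀ f k, 0 ≤ V f k)
    (hcost : ∀ f k, 0 ≤ cost f k) (hmono : ∀ f k, V (f + 1) (k + 1) ≤ V f (k + 1))
    (hstep : ∀ f k, cost f k + (V (f + 1) (k + 1) + V f (k + 1)) / 2 ≤ V f k) :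
    ∑' k, ∫⁻ ω, ENNReal.ofReal (cost (progress acc ω k) k)
      ∂(Measure.infinitePi fun _ : ℕ => μ) ≤ ENNReal.ofReal (V 0 0) := by
  let ν := Measure.infinitePi fun _ : ℕ => μ
  -- A success can only lower the potential, so success probability exactly 1/2 is the worst case.
  have hpoint : ∀ f k, ENNReal.ofReal (V (f + 1) (k + 1)) * μ (acc f k) +
      ENNReal.ofReal (V f (k + 1)) * μ (acc f k)ᶜ ≤
        ENNReal.ofReal ((V (f + 1) (k + 1) + V f (k + 1)) / 2) := by
    intro f k
    set D := V f (k + 1) - V (f + 1) (k + 1) with hD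
    have hD0 : 0 ≤ D := sub_nonneg.2 (hmono f k)
    have e₁ : V f (k + 1) = V (f + 1) (k + 1) + D := by ring
    have e₂ : (V (f + 1) (k + 1) + V f (k + 1)) / 2 = V (f + 1) (k + 1) + D * (1 / 2) := by
      rw [e₁]; ring
    rw [e₂, e₁, ENNReal.ofReal_add (hV _ _) hD0, ENNReal.ofReal_add (hV _ _) (by positivity),
      add_mul, ← add_assoc, ← mul_add, prob_add_prob_compl (hacc f k), mul_one,
      ENNReal.ofReal_mul hD0]
    gcongr
    refine (hhalf f k).trans (le_of_eq ?_)
    rw [one_div, one_div, ENNReal.ofReal_inv_of_pos two_pos]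
    simp
  have hdecr : ∀ k, ∫⁻ ω, ENNReal.ofReal (cost (progress acc ω k) k) ∂ν +
      ∫⁻ ω, ENNReal.ofReal (V (progress acc ω (k + 1)) (k + 1)) ∂ν ≤
        ∫⁻ ω, ENNReal.ofReal (V (progress acc ω k) k) ∂ν := by
    intro k
    have hm : Measurable fun ω => ENNReal.ofReal (cost (progress acc ω k) k) :=
      (measurable_of_countable fun f => ENNReal.ofReal (cost f k)).comp
        (measurable_progress hacc k)
    rw [lintegral_progress_succ μ hacc k (fun f => ENNReal.ofReal (V f (k + 1))),
      ← lintegral_add_left hm]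
    refine lintegral_mono fun ω => ?_
    refine (add_le_add le_rfl (hpoint (progress acc ω k) k)).trans ?_
    rw [← ENNReal.ofReal_add (hcost _ _) (div_nonneg (add_nonneg (hV _ _) (hV _ _)) two_pos.le)]
    exact ENNReal.ofReal_le_ofReal (hstep _ _)
  -- Telescoping: the costs paid so far plus the expected remaining potential never exceed the
  -- initial potential.
  have hsum : ∀ n, ∑ k ∈ Finset.range n, ∫⁻ ω, ENNReal.ofReal (cost (progress acc ω k) k) ∂ν +
      ∫⁻ ω, ENNReal.ofReal (V (progress acc ω n) n) ∂ν ≤ ENNReal.ofReal (V 0 0) := by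
    intro n
    induction n with
    | zero => simp [progress]
    | succ n ih =>
      rw [Finset.sum_range_succ, add_assoc]
      exact (add_le_add le_rfl (hdecr n)).trans ih
  refine ENNReal.tsum_le_of_sum_range_le fun n => le_self_add.trans (hsum n)

end Progress

/-! ### Comparison of the running time with the trial process. -/

section Domination

variable {d ℓ : ℕ}

open Classical in
/-- The contents of the buffer at the moments when it is full, for a stream with the rows given by
the first argument and a buffer that holds the rows given by the second one. -/
noncomputable def flushes (ℓ : ℕ) :
    List (Fin d → ℝ) → List (Fin d → ℝ) → List (List (Fin d → ℝ))
  | [], _ => []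
  | a :: rest, rows =>
    if IsFull ℓ (rows ++ [a]) then (rows ++ [a]) :: flushes ℓ rest []
    else flushes ℓ rest (rows ++ [a])

/-- While a loop is running, the success count stays at the number of the current flush; acceptance
is exactly what increases it. -/
theorem loopEnd_progress {X : Type*} (acc : ℕ → ℕ → Set X) (ω : ℕ → X) (f R i : ℕ)
    (h : progress acc ω i = f) :
    (∀ k ∈ Finset.Ico i (loopEnd (fun k => ω k ∈ acc f k) R i).1, progress acc ω k = f) ∧
      ((loopEnd (fun k => ω k ∈ acc f k) R i).2 = true →
        progress acc ω (loopEnd (fun k => ω k ∈ acc f k) R i).1 = f + 1) := by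
  induction R generalizing i with
  | zero => simp [loopEnd]
  | succ R ih =>
    rw [loopEnd]
    split_ifs with hi
    · refine ⟨fun k hk => ?_, fun _ => ?_⟩
      · simp only [Finset.mem_Ico] at hk
        obtain rfl : k = i := by omega
        exact h
      · rw [progress, h, if_pos hi]
    · obtain ⟨h₁, h₂⟩ := ih (i + 1) (by rw [progress, h, if_neg hi])
      refine ⟨fun k hk => ?_, h₂⟩
      rcases eq_or_ne k i with rfl | hne
      · exact h
      · simp only [Finset.mem_Ico] at hk
        exact h₁ k (by simp only [Finset.mem_Ico]; omega)

/-- The draws of SimultaneousIteration that VerifySpectral accepts at the call number `k + 1`, if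
the buffer of the flush number `f` is processed. -/
def accepted (c : Constants) (δ : ℝ) (x : ℕ → UnitSphere d) (bufs : List (List (Fin d → ℝ)))
    (f k : ℕ) : Set (Fin d → Fin ℓ → ℝ) :=
  {G | Accepts c (ofRows (bufs.getD f [])) δ k G (x k)}

/-- Time of a round at the call number `k + 1` for the buffer of the flush number `f`. -/
noncomputable def roundCost (c : Constants) (ℓ : ℕ) (δ : ℝ) (bufs : List (List (Fin d → ℝ)))
    (f k : ℕ) : ℕ :=
  if f < bufs.length then
    roundTime c d ℓ (bufs.getD f []).length (nnz (ofRows (bufs.getD f []))) δ k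
  else 0

/-- The contents of the buffers are fixed in advance, so the success count identifies the buffer in
use. The right-hand side lets all rounds continue without a cut-off and is therefore independent of
`R`; once all buffers are processed, `roundCost` is 0. -/
theorem streamTime_le (c : Constants) (δ : ℝ) (R : ℕ) (ω : Tape d ℓ)
    (bufs : List (List (Fin d → ℝ))) (L rows : List (Fin d → ℝ)) (i f : ℕ)
    (hf : progress (accepted c δ ω.2 bufs) ω.1 i = f) (hbufs : bufs.drop f = flushes ℓ L rows) :
    (streamTime c δ R ω L rows i : ℝ≥0∞) ≤
      (((L.map fun a => rowWords a + 5).sum +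
        (flushes ℓ L rows).length * (denseShrinkTime c.svd d ℓ (ℓ + ℓ) + 1) : ℕ) : ℝ≥0∞) +
      ∑' j, (roundCost c ℓ δ bufs (progress (accepted c δ ω.2 bufs) ω.1 (j + i)) (j + i) :
        ℝ≥0∞) := by
  induction L generalizing rows i f with
  | nil => simp [streamTime]
  | cons a L ih =>
    by_cases hfull : IsFull ℓ (rows ++ [a])
    · rw [flushes, if_pos hfull] at hbufs
      have hlen : f < bufs.length := by
        by_contra hcon
        rw [List.drop_eq_nil_of_le (not_lt.1 hcon)] at hbufs
        simp at hbufs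
      have hget : bufs.getD f [] = rows ++ [a] := by
        rw [List.drop_eq_getElem_cons hlen] at hbufs
        rw [List.getD_eq_getElem _ _ hlen]
        exact (List.cons.inj hbufs).1
      have hdrop : bufs.drop (f + 1) = flushes ℓ L [] := by
        rw [List.drop_eq_getElem_cons hlen] at hbufs
        exact (List.cons.inj hbufs).2
      have hacc : (fun k => Accepts c (ofRows (rows ++ [a])) δ k (ω.1 k) (ω.2 k)) =
          fun k => ω.1 k ∈ accepted c δ ω.2 bufs f k := by
        funext k
        rw [accepted, hget]
        rfl
      rw [streamTime, if_pos hfull, hacc, flushes, if_pos hfull]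
      set e := loopEnd (fun k => ω.1 k ∈ accepted c δ ω.2 bufs f k) R i with he
      obtain ⟨h₁, h₂⟩ := loopEnd_progress (accepted c δ ω.2 bufs) ω.1 f R i hf
      rw [← he] at h₁ h₂
      have hie : i ≤ e.1 := le_loopEnd _ _ _
      set g : ℕ → ℝ≥0∞ := fun k =>
        (roundCost c ℓ δ bufs (progress (accepted c δ ω.2 bufs) ω.1 k) k : ℝ≥0∞) with hg
      have hsum : ((∑ k ∈ Finset.Ico i e.1, roundTime c d ℓ (rows ++ [a]).length
          (nnz (ofRows (rows ++ [a]))) δ k : ℕ) : ℝ≥0∞) + ∑' j, g (j + e.1) =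
          ∑' j, g (j + i) := by
        rw [← ENNReal.summable.sum_add_tsum_nat_add' (f := fun j => g (j + i)) (k := e.1 - i)]
        congr 1
        · rw [Finset.sum_Ico_eq_sum_range, Nat.cast_sum]
          refine Finset.sum_congr rfl fun j hj => ?_
          have hj' : i + j ∈ Finset.Ico i e.1 := by
            simp only [Finset.mem_range] at hj
            simp only [Finset.mem_Ico]; omega
          rw [hg, add_comm j i]
          simp only [roundCost]
          rw [h₁ _ hj', if_pos hlen, hget]
        · refine tsum_congr fun j => ?_
          rw [add_assoc, Nat.sub_add_cancel hie]
      have hrest : ((if e.2 = true then denseShrinkTime c.svd d ℓ (ℓ + ℓ) + 1 +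
          streamTime c δ R ω L [] e.1 else 0 : ℕ) : ℝ≥0∞) ≤
          (((L.map fun a => rowWords a + 5).sum + (flushes ℓ L []).length *
            (denseShrinkTime c.svd d ℓ (ℓ + ℓ) + 1) +
            (denseShrinkTime c.svd d ℓ (ℓ + ℓ) + 1) : ℕ) : ℝ≥0∞) + ∑' j, g (j + e.1) := by
        split_ifs with h
        · have := ih [] e.1 (f + 1) (h₂ h) hdrop
          push_cast at this ⊢
          calc _ ≤ _ := add_le_add le_rfl this
            _ = _ := by ring
        · simp
      rw [← hsum]
      push_cast at hrest ⊢
      calc _ ≤ _ := add_le_add le_rfl (add_le_add le_rfl hrest)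
        _ = _ := by
          simp only [List.map_cons, List.sum_cons, List.length_cons]
          push_cast
          ring
    · rw [flushes, if_neg hfull] at hbufs
      rw [streamTime, if_neg hfull, flushes, if_neg hfull]
      have := ih (rows ++ [a]) i f hf hbufs
      simp only [List.map_cons, List.sum_cons]
      push_cast at this ⊢
      calc _ ≤ _ := add_le_add le_rfl this
        _ = _ := by ring

end Domination

/-! ### Measurability and expectation of the running time. -/

section Measurability

variable {d ℓ : ℕ}

theorem measurable_loopEnd {Ω : Type*} [MeasurableSpace Ω] {acc : Ω → ℕ → Prop}
    (hacc : ∀ k, MeasurableSet {ω | acc ω k}) (R i : ℕ) :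
    Measurable fun ω => loopEnd (acc ω) R i := by
  classical
  induction R generalizing i with
  | zero => exact measurable_const
  | succ R ih => exact Measurable.ite (hacc i) measurable_const (ih (i + 1))

theorem measurable_streamTime (hℓ : 0 < ℓ) (hℓd : ℓ ≤ d) (c : Constants) (δ : ℝ) (R : ℕ)
    (L rows : List (Fin d → ℝ)) (i : ℕ) :
    Measurable fun ω : Tape d ℓ => streamTime c δ R ω L rows i := by
  induction L generalizing rows i with
  | nil => exact measurable_const
  | cons a L ih =>
    simp only [streamTime]
    by_cases hfull : IsFull ℓ (rows ++ [a])
    · simp only [if_pos hfull]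
      have hacc : ∀ k, MeasurableSet
          {ω : Tape d ℓ | Accepts c (ofRows (rows ++ [a])) δ k (ω.1 k) (ω.2 k)} := fun k =>
        (show Measurable fun ω : Tape d ℓ => (ω.1 k, ω.2 k) by fun_prop)
          (measurableSet_accepts hℓ hℓd c (ofRows (rows ++ [a])) δ k)
      refine Measurable.const_add ?_ _
      refine measurable_apply_countable (F := fun (ω : Tape d ℓ) (e : ℕ × Bool) =>
        ∑ k ∈ Finset.Ico i e.1,
            roundTime c d ℓ (rows ++ [a]).length (nnz (ofRows (rows ++ [a]))) δ k +
          if e.2 = true then denseShrinkTime c.svd d ℓ (ℓ + ℓ) + 1 +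
            streamTime c δ R ω L [] e.1 else 0) (fun e => ?_) (measurable_loopEnd hacc R i)
      refine Measurable.const_add ?_ _
      split_ifs
      · exact (ih [] e.1).const_add _
      · exact measurable_const
    · simp only [if_neg hfull]
      exact (ih (rows ++ [a]) i).const_add _

theorem measurable_runningTime (hℓ : 0 < ℓ) (hℓd : ℓ ≤ d) (c : Constants) {n : ℕ}
    (A : Matrix (Fin n) (Fin d) ℝ) (δ : ℝ) : Measurable (runningTime c A ℓ δ) := by
  refine Measurable.iSup fun R => ?_
  simp_rw [fun ω => (exec_sparseFrequentDirections c A δ R ω (hℓ.trans_le hℓd) hℓ).1]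
  exact (measurable_of_countable fun t : ℕ => (t : ℝ≥0∞)).comp
    ((measurable_streamTime hℓ hℓd c δ R _ _ _).const_add 1)

/-- A potential that pays for the rounds bounds the expected running time. -/
theorem lintegral_runningTime_le [NeZero d] (hℓ : 0 < ℓ) (hℓd : ℓ ≤ d) (c : Constants)
    (hc : 3 ≤ c.simIter) {n : ℕ} (A : Matrix (Fin n) (Fin d) ℝ) (δ : ℝ)
    (bufs : List (List (Fin d → ℝ))) (hbufs : bufs = flushes ℓ (List.ofFn fun i => A i) [])
    (V : ℕ → ℕ → ℝ) (hV : ∀ f k, 0 ≤ V f k) (hmono : ∀ f k, V (f + 1) (k + 1) ≤ V f (k + 1))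
    (hstep : ∀ f k, roundCost c ℓ δ bufs f k + (V (f + 1) (k + 1) + V f (k + 1)) / 2 ≤ V f k) :
    ∫⁻ ω, runningTime c A ℓ δ ω ∂(tapeMeasure d ℓ) ≤
      ENNReal.ofReal (1 + ((((List.ofFn fun i => A i).map fun a => rowWords a + 5).sum +
        bufs.length * (denseShrinkTime c.svd d ℓ (ℓ + ℓ) + 1) : ℕ) : ℝ) + V 0 0) := by
  set base : ℕ := ((List.ofFn fun i => A i).map fun a => rowWords a + 5).sum +
        bufs.length * (denseShrinkTime c.svd d ℓ (ℓ + ℓ) + 1) with hbase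
  have hacc : ∀ x f k, MeasurableSet (accepted (ℓ := ℓ) c δ x bufs f k) := fun x f k =>
    (show Measurable fun G : Fin d → Fin ℓ → ℝ => (G, x k) by fun_prop)
      (measurableSet_accepts hℓ hℓd c (ofRows (bufs.getD f [])) δ k)
  have hpoint : ∀ ω, runningTime c A ℓ δ ω ≤ ((1 + base : ℕ) : ℝ≥0∞) +
      ∑' j, ENNReal.ofReal (roundCost c ℓ δ bufs (progress (accepted c δ ω.2 bufs) ω.1 j) j) := by
    intro ω
    refine iSup_le fun R => ?_
    rw [(exec_sparseFrequentDirections c A δ R ω (hℓ.trans_le hℓd) hℓ).1]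
    have := streamTime_le c δ R ω bufs (List.ofFn fun i => A i) [] 0 0 rfl
      (by rw [List.drop_zero, hbufs])
    rw [← hbufs, ← hbase] at this
    simp only [add_zero] at this
    push_cast
    rw [add_assoc]
    refine add_le_add le_rfl (this.trans (le_of_eq ?_))
    simp only [ENNReal.ofReal_natCast]
  -- The unit vectors are fixed first. Rejection has Gaussian probability at most 1/2 for each of
  -- them, so the inner bound is uniform and the outer integral is trivial.
  rw [tapeMeasure, lintegral_prod_symm _ (measurable_runningTime hℓ hℓd c A δ).aemeasurable]
  have hinner : ∀ x : ℕ → UnitSphere d, ∫⁻ G, runningTime c A ℓ δ (G, x)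
      ∂(Measure.infinitePi fun _ : ℕ => gaussianMatrix d ℓ) ≤
        ENNReal.ofReal (1 + (base : ℝ) + V 0 0) := by
    intro x
    refine (lintegral_mono fun G => hpoint (G, x)).trans ?_
    have hm : ∀ j, Measurable fun G : ℕ → Fin d → Fin ℓ → ℝ => ENNReal.ofReal
        (roundCost c ℓ δ bufs (progress (accepted c δ x bufs) G j) j) := fun j =>
      (measurable_of_countable fun f => ENNReal.ofReal (roundCost c ℓ δ bufs f j)).comp
        (measurable_progress (hacc x) j)
    rw [lintegral_add_left measurable_const, lintegral_const, measure_univ, mul_one,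
      lintegral_tsum fun j => (hm j).aemeasurable,
      ENNReal.ofReal_add (by positivity) (hV 0 0)]
    refine add_le_add (le_of_eq ?_) (tsum_lintegral_progress_le _ (hacc x) (fun f k =>
      measure_not_accepts_le hℓ hℓd c hc _ δ k (x k)) V _ hV (fun f k => Nat.cast_nonneg _)
      hmono hstep)
    rw [← ENNReal.ofReal_natCast]
    push_cast
    rfl
  refine (lintegral_mono hinner).trans ?_
  rw [lintegral_const, measure_univ, mul_one]

end Measurability

/-! ### Deterministic properties of the sequence of full buffers. -/

section Flushes

variable {d : ℕ}

theorem nnz_ofRows_le (rows : List (Fin d → ℝ)) : nnz (ofRows rows) ≤ rows.length * d := by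
  rw [nnz_ofRows]
  induction rows with
  | nil => simp
  | cons a rows ih =>
    simp only [List.map_cons, List.sum_cons, List.length_cons]
    have := nnzVec_le a
    linarith

theorem mem_flushes (ℓ : ℕ) (L rows : List (Fin d → ℝ)) (hrows : rows.length < d)
    (b : List (Fin d → ℝ)) (hb : b ∈ flushes ℓ L rows) :
    IsFull ℓ b ∧ 0 < b.length ∧ b.length ≤ d ∧ b.length ≤ rows.length + L.length := by
  induction L generalizing rows with
  | nil => simp [flushes] at hb
  | cons a L ih =>
    rw [flushes] at hb
    split_ifs at hb with hfull
    · rcases List.mem_cons.1 hb with rfl | hb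
      · refine ⟨hfull, ?_, ?_, ?_⟩ <;> simp only [List.length_append, List.length_cons,
          List.length_nil] <;> omega
      · obtain ⟨h₁, h₂, h₃, h₄⟩ := ih [] (by simp only [List.length_nil]; omega) hb
        refine ⟨h₁, h₂, h₃, ?_⟩
        simp only [List.length_cons, List.length_nil] at *
        omega
    · have hlt : (rows ++ [a]).length < d := by
        have : (rows ++ [a]).length ≠ d := fun h => hfull (Or.inr h)
        simp only [List.length_append, List.length_cons, List.length_nil] at *
        omega
      obtain ⟨h₁, h₂, h₃, h₄⟩ := ih _ hlt hb
      refine ⟨h₁, h₂, h₃, ?_⟩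
      simp only [List.length_append, List.length_cons, List.length_nil] at *
      omega

/-- Each row enters at most one flushed buffer. The weight `w` is later the number of nonzero
entries, or 1 to count rows. -/
theorem sum_flushes_le (ℓ : ℕ) (w : (Fin d → ℝ) → ℕ) (L rows : List (Fin d → ℝ)) :
    ((flushes ℓ L rows).map fun b => (b.map w).sum).sum ≤ (rows.map w).sum + (L.map w).sum := by
  induction L generalizing rows with
  | nil => simp [flushes]
  | cons a L ih =>
    rw [flushes]
    split_ifs with hfull
    · have := ih []
      simp only [List.map_cons, List.sum_cons, List.map_append, List.sum_append, List.map_nil,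
        List.sum_nil] at *
      omega
    · have := ih (rows ++ [a])
      simp only [List.map_cons, List.sum_cons, List.map_append, List.sum_append, List.map_nil,
        List.sum_nil] at *
      omega

theorem length_flushes_le (ℓ : ℕ) (L rows : List (Fin d → ℝ)) :
    (flushes ℓ L rows).length ≤ L.length := by
  induction L generalizing rows with
  | nil => simp [flushes]
  | cons a L ih =>
    rw [flushes]
    split_ifs with hfull
    · simpa using ih []
    · exact (ih _).trans (by simp)

theorem sum_range_getD {α : Type*} (l : List α) (f : α → ℝ) (x : α) :
    ∑ g ∈ Finset.range l.length, f (l.getD g x) = (l.map f).sum := by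
  induction l with
  | nil => simp
  | cons a l ih =>
    rw [List.length_cons, Finset.sum_range_succ', List.map_cons, List.sum_cons, ← ih, add_comm]
    simp

end Flushes

/-! ### Costs of the subroutines in terms of the workload of a full buffer. -/

section Arithmetic

/-- The bound on the running time that a matrix with `m` rows and `N` nonzero entries accounts for,
up to a constant; `Λ` stands for `log (n / δ)`. -/
noncomputable def workload (d ℓ : ℕ) (Λ : ℝ) (m N : ℕ) : ℝ :=
  N * ℓ * Real.log d + N * Λ + m * ℓ ^ 2 + m * ℓ * Λ

theorem powerRounds_le (c : Constants) (hc : 0 ≤ c.simIter) {m : ℕ} (hm : 0 < m) :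
    (powerRounds c m : ℝ) ≤ (8 * c.simIter + 1) * (1 + Real.log m) := by
  have hm' : (1 : ℝ) ≤ m := by exact_mod_cast hm
  have hlog := Real.log_nonneg hm'
  have h4 : Real.log 4 ≤ 2 := by
    have : Real.log 4 = 2 * Real.log 2 := by
      rw [show (4 : ℝ) = 2 ^ 2 by norm_num, Real.log_pow]; norm_num
    linarith [Real.log_two_lt_d9]
  have h0 : 0 ≤ Real.log 4 := Real.log_nonneg (by norm_num)
  have e : Real.log (m / (1 / 4)) = Real.log m + Real.log 4 := by
    rw [← Real.log_mul (by positivity) (by norm_num)]; congr 1; ring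
  unfold powerRounds
  refine (Nat.ceil_lt_add_one (by rw [e]; positivity)).le.trans ?_
  rw [e]
  have := mul_le_mul_of_nonneg_left h4 hc
  nlinarith [mul_nonneg hc hlog]

theorem verifyRounds_le (c : Constants) (hc : 0 ≤ c.verify) {d n : ℕ} (hd : 0 < d) (hn : 0 < n)
    {δ : ℝ} (hδ : 0 < δ) (hδ1 : δ < 1) (k : ℕ) :
    (verifyRounds c d δ k : ℝ) ≤
      c.verify * (1 + Real.log d + 2 * Real.log (n / δ) + 2 * (k / n)) + 1 := by
  have hn' : (1 : ℝ) ≤ n := by exact_mod_cast hn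
  have hd' : (1 : ℝ) ≤ d := by exact_mod_cast hd
  have hk : (0 : ℝ) < (k + 1 : ℕ) := by positivity
  have hδ' : Real.log δ < 0 := Real.log_neg hδ hδ1
  have hlogn := Real.log_nonneg hn'
  have e : Real.log (d / (δ / (2 * ((k + 1 : ℕ) : ℝ) ^ 2))) =
      Real.log d + Real.log 2 + 2 * Real.log (k + 1 : ℕ) - Real.log δ := by
    rw [div_div_eq_mul_div, Real.log_div (by positivity) hδ.ne', Real.log_mul (by positivity)
      (by positivity), Real.log_mul (by norm_num) (by positivity), Real.log_pow]
    push_cast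
    ring
  -- From log y ≤ y − 1 at y = (k+1)/n. The logarithmic growth in the call number becomes linear
  -- with slope 1/n, which keeps the potential below explicit.
  have hkn : Real.log (k + 1 : ℕ) ≤ Real.log n + k / n := by
    have h := Real.log_le_sub_one_of_pos (div_pos hk (by positivity : (0 : ℝ) < n))
    rw [Real.log_div hk.ne' (by positivity)] at h
    have h' : ((k + 1 : ℕ) : ℝ) / n - 1 ≤ k / n := by
      push_cast
      rw [add_div]
      have : 1 / (n : ℝ) ≤ 1 := by rw [div_le_one (by positivity)]; exact hn'
      linarith
    linarith
  have hlogk : 0 ≤ Real.log (k + 1 : ℕ) := Real.log_natCast_nonneg _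
  have hlogd := Real.log_nonneg hd'
  unfold verifyRounds
  refine (Nat.ceil_lt_add_one (mul_nonneg hc ?_)).le.trans ?_
  · rw [e]; linarith [Real.log_nonneg (by norm_num : (1 : ℝ) ≤ 2)]
  · rw [e, Real.log_div (by positivity) hδ.ne']
    gcongr
    linarith [Real.log_two_lt_d9]

theorem gramSchmidtTime_le (m ℓ : ℕ) (hm : 0 < m) : gramSchmidtTime m ℓ ≤ 8 * (m * ℓ ^ 2) := by
  unfold gramSchmidtTime
  calc _ ≤ ∑ _j ∈ Finset.range ℓ, 8 * (m * ℓ) := by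
        refine Finset.sum_le_sum fun j hj => ?_
        have hj' : j + 1 ≤ ℓ := Finset.mem_range.1 hj
        nlinarith [Nat.mul_le_mul_left m hj']
    _ = _ := by simp; ring

variable {d ℓ m N n : ℕ} {δ : ℝ}

/-- For d ≥ 2 the factor log d is at least log 2 > 1/2. For d = 1 it vanishes, but then ℓ = 1 and N
≤ m, so the term mℓ² takes over. -/
theorem nnz_mul_le_workload (hℓ : 0 < ℓ) (hℓd : ℓ ≤ d) (hN : N ≤ m * d) {Λ : ℝ} (hΛ : 0 ≤ Λ) :
    (N * ℓ : ℝ) ≤ 2 * workload d ℓ Λ m N := by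
  have hlog : 0 ≤ Real.log d := Real.log_natCast_nonneg d
  unfold workload
  rcases Nat.lt_or_ge 1 d with h | h
  · have h2 : Real.log 2 ≤ Real.log d := Real.log_le_log two_pos (by exact_mod_cast h)
    have h3 : (N * ℓ : ℝ) * 1 ≤ N * ℓ * (2 * Real.log d) := by
      gcongr
      linarith [Real.log_two_gt_d9]
    have : (0 : ℝ) ≤ N * Λ + m * ℓ ^ 2 + m * ℓ * Λ := by positivity
    linarith
  · obtain rfl : ℓ = 1 := by omega
    obtain rfl : d = 1 := by omega
    have hN' : (N : ℝ) ≤ m := by exact_mod_cast (by simpa using hN)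
    have : (0 : ℝ) ≤ N * Λ + m * Λ := by positivity
    have : (0 : ℝ) ≤ m := by positivity
    simp only [Nat.cast_one, Real.log_one]
    linarith

theorem mul_sq_le_workload {Λ : ℝ} (hΛ : 0 ≤ Λ) : (m * ℓ ^ 2 : ℝ) ≤ workload d ℓ Λ m N := by
  have hlog : 0 ≤ Real.log d := Real.log_natCast_nonneg d
  unfold workload
  have : (0 : ℝ) ≤ N * ℓ * Real.log d + N * Λ + m * ℓ * Λ := by positivity
  linarith

theorem workload_nonneg {Λ : ℝ} (hΛ : 0 ≤ Λ) : 0 ≤ workload d ℓ Λ m N :=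
  le_trans (by positivity) (mul_sq_le_workload hΛ)

theorem log_div_nonneg (hn : 0 < n) (hδ : 0 < δ) (hδ1 : δ < 1) : 0 ≤ Real.log (n / δ) := by
  refine Real.log_nonneg ?_
  rw [one_le_div hδ]
  have : (1 : ℝ) ≤ n := by exact_mod_cast hn
  linarith

theorem denseShrinkTime_le (K : ℕ) (hm : 0 < m) (hℓ : 0 < ℓ) (hℓd : ℓ ≤ d) (hN : N ≤ m * d)
    (hfull : ℓ * d ≤ N + m * ℓ) {Λ : ℝ} (hΛ : 0 ≤ Λ) :
    (denseShrinkTime K d ℓ (ℓ + ℓ) + 1 : ℝ) ≤ (12 * K + 8) * workload d ℓ Λ m N := by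
  have hU₁ := nnz_mul_le_workload hℓ hℓd hN hΛ
  have hU₂ := mul_sq_le_workload (d := d) (ℓ := ℓ) (m := m) (N := N) hΛ
  set U := workload d ℓ Λ m N
  have hm' : (1 : ℝ) ≤ m := by exact_mod_cast hm
  have hℓ' : (1 : ℝ) ≤ ℓ := by exact_mod_cast hℓ
  have hfull' : (ℓ * d : ℝ) ≤ N + m * ℓ := by exact_mod_cast hfull
  have hmin : ((min (ℓ + ℓ) d : ℕ) : ℝ) ≤ 2 * ℓ := by
    have : min (ℓ + ℓ) d ≤ 2 * ℓ := by omega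
    exact_mod_cast this
  have h₁ : (ℓ * d * ℓ : ℝ) ≤ 3 * U := by
    have := mul_le_mul_of_nonneg_right hfull' (by positivity : (0 : ℝ) ≤ ℓ)
    linarith
  have h₂ : (ℓ * d : ℝ) ≤ ℓ * d * ℓ := le_mul_of_one_le_right (by positivity) hℓ'
  have h₃ : (ℓ : ℝ) ≤ m * ℓ ^ 2 := by nlinarith
  have h₄ : (K * ((ℓ + ℓ : ℕ) * d * (min (ℓ + ℓ) d : ℕ)) : ℝ) ≤ 12 * K * U := by
    calc (K * ((ℓ + ℓ : ℕ) * d * (min (ℓ + ℓ) d : ℕ)) : ℝ)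
        ≤ K * ((ℓ + ℓ : ℕ) * d * (2 * ℓ)) := by gcongr
      _ = K * (4 * (ℓ * d * ℓ)) := by push_cast; ring
      _ ≤ K * (4 * (3 * U)) := by gcongr
      _ = _ := by ring
  unfold denseShrinkTime
  push_cast at h₄ ⊢
  linarith

/-- Time of a round for a full buffer with `m` rows and `N` nonzero entries. -/
theorem roundTime_le (c : Constants) (hc : 0 ≤ c.simIter) (hv : 0 ≤ c.verify) (hm : 0 < m)
    (hmd : m ≤ d) (hmn : m ≤ n) (hℓ : 0 < ℓ) (hℓd : ℓ ≤ d) (hN : N ≤ m * d)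
    (hfull : ℓ * d ≤ N ∨ m = d) (hδ : 0 < δ) (hδ1 : δ < 1) (k : ℕ) :
    (roundTime c d ℓ m N δ k : ℝ) ≤
      (160 * c.simIter + 3 * c.svd + 77 * c.verify + 129) *
        workload d ℓ (Real.log (n / δ)) m N * (1 + k / n) := by
  have hn : 0 < n := hm.trans_le hmn
  have hd : 0 < d := hm.trans_le hmd
  have hΛ := log_div_nonneg hn hδ hδ1
  have hU₁ := nnz_mul_le_workload hℓ hℓd hN hΛ
  have hU₂ := mul_sq_le_workload (d := d) (ℓ := ℓ) (m := m) (N := N) hΛ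
  have hU₀ := workload_nonneg (d := d) (ℓ := ℓ) (m := m) (N := N) hΛ
  have hUdef : workload d ℓ (Real.log (n / δ)) m N = N * ℓ * Real.log d + N * Real.log (n / δ) +
    m * ℓ ^ 2 + m * ℓ * Real.log (n / δ) := rfl
  set U := workload d ℓ (Real.log (n / δ)) m N
  have hm' : (1 : ℝ) ≤ m := by exact_mod_cast hm
  have hℓ' : (1 : ℝ) ≤ ℓ := by exact_mod_cast hℓ
  have hd' : (1 : ℝ) ≤ d := by exact_mod_cast hd
  have hn' : (1 : ℝ) ≤ n := by exact_mod_cast hn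
  have hN0 : (0 : ℝ) ≤ N := N.cast_nonneg
  have hlogd : 0 ≤ Real.log d := Real.log_natCast_nonneg d
  have hlogm : 0 ≤ Real.log m := Real.log_natCast_nonneg m
  have hlogmd : Real.log m ≤ Real.log d :=
    Real.log_le_log (by positivity) (by exact_mod_cast hmd)
  have hlogn : Real.log n ≤ Real.log (n / δ) := by
    refine Real.log_le_log (by positivity) ?_
    rw [le_div_iff₀ hδ]
    exact mul_le_of_le_one_right (by positivity) hδ1.le
  have hlogmn : Real.log m ≤ Real.log (n / δ) :=
    (Real.log_le_log (by positivity) (by exact_mod_cast hmn)).trans hlogn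
  set Λ := Real.log (n / δ)
  set lm := Real.log m
  set ld := Real.log d
  have hfull' : (ℓ * d : ℝ) ≤ N + m * ℓ := by
    rcases hfull with h | h
    · have : (ℓ * d : ℝ) ≤ N := by exact_mod_cast h
      have : (0 : ℝ) ≤ m * ℓ := by positivity
      linarith
    · rw [h]; linarith [mul_comm (ℓ : ℝ) d]
  have hmℓ : (m * ℓ : ℝ) ≤ m * ℓ ^ 2 := by
    have : (ℓ : ℝ) ≤ ℓ ^ 2 := by nlinarith
    gcongr
  have hm₁ : (m : ℝ) ≤ m * ℓ := le_mul_of_one_le_right (by positivity) hℓ'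
  have hℓ₁ : (ℓ : ℝ) ≤ m * ℓ := le_mul_of_one_le_left (by positivity) hm'
  have hd₁ : (d : ℝ) ≤ ℓ * d := le_mul_of_one_le_left (by positivity) hℓ'
  have hN₁ : (N : ℝ) ≤ N * ℓ := le_mul_of_one_le_right hN0 hℓ'
  have hNΛ : 0 ≤ (N : ℝ) * Λ := by positivity
  have hmΛ : 0 ≤ (m * ℓ : ℝ) * Λ := by positivity
  have hNd : 0 ≤ (N * ℓ : ℝ) * ld := by positivity
  have hm2 : (0 : ℝ) ≤ m * ℓ ^ 2 := by positivity
  -- the weight of a round of VerifySpectral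
  set W : ℝ := N + m * ℓ with hW
  have hW0 : 0 ≤ W := by positivity
  have hW₁ : W ≤ 3 * U := by linarith
  have hW₂ : W * ld ≤ 2 * U := by
    have h₁ : (N : ℝ) * ld ≤ N * ℓ * ld := by gcongr
    -- The product mℓ log d does not occur in `workload`. If N ≥ ℓd, then m ≤ d gives mℓ ≤ N; if m =
    -- d, then log d = log m ≤ log(n/δ).
    have h₂ : (m * ℓ : ℝ) * ld ≤ N * ld + m * ℓ * Λ := by
      rcases hfull with h | h
      · have : (m * ℓ : ℝ) ≤ N := by
          exact_mod_cast (Nat.mul_le_mul_right ℓ hmd).trans ((mul_comm d ℓ).le.trans h)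
        have := mul_le_mul_of_nonneg_right this hlogd
        linarith
      · have : ld = lm := by simp only [ld, lm, h]
        have h₃ : (m * ℓ : ℝ) * ld ≤ m * ℓ * Λ := by rw [this]; gcongr
        have : (0 : ℝ) ≤ N * ld := by positivity
        linarith
    rw [hW, add_mul]
    linarith
  have hW₃ : W * Λ ≤ U := by rw [hW, add_mul]; linarith
  have hlm : (N * ℓ + m * ℓ : ℝ) * lm ≤ U := by
    have h₁ : (N * ℓ : ℝ) * lm ≤ N * ℓ * ld := by gcongr
    have h₂ : (m * ℓ : ℝ) * lm ≤ m * ℓ * Λ := by gcongr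
    rw [add_mul]
    linarith
  -- SimultaneousIteration
  have hpow : (powerRounds c m * (1 + (ℓ * (2 * N + m) + ℓ * (2 * N + d))) : ℝ) ≤
      (160 * c.simIter + 20) * U := by
    calc (powerRounds c m * (1 + (ℓ * (2 * N + m) + ℓ * (2 * N + d))) : ℝ)
        ≤ ((8 * c.simIter + 1) * (1 + lm)) * (5 * (N * ℓ + m * ℓ)) := by
          refine mul_le_mul (powerRounds_le c hc hm) ?_ (by positivity) (by positivity)
          have : (ℓ * (2 * N + m) + ℓ * (2 * N + d) : ℝ) = 4 * (N * ℓ) + m * ℓ + ℓ * d := by ring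
          rw [this]
          linarith [mul_nonneg hN0 (by positivity : (0 : ℝ) ≤ ℓ)]
      _ = (8 * c.simIter + 1) * (5 * ((N * ℓ + m * ℓ) + (N * ℓ + m * ℓ) * lm)) := by ring
      _ ≤ (8 * c.simIter + 1) * (5 * (3 * U + U)) := by
          gcongr
          linarith
      _ = _ := by ring
  -- VerifySpectral
  have hver : (verifyRounds c d δ k *
      (1 + (2 * N + m + (2 * N + d) + 2 * (ℓ * d) + 2 * (ℓ * d) + 2 * d)) : ℝ) ≤
      (77 * c.verify + 33) * U * (1 + k / n) := by
    have hk : (0 : ℝ) ≤ k / n := by positivity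
    calc (verifyRounds c d δ k *
        (1 + (2 * N + m + (2 * N + d) + 2 * (ℓ * d) + 2 * (ℓ * d) + 2 * d)) : ℝ)
        ≤ (c.verify * (1 + ld + 2 * Λ + 2 * (k / n)) + 1) * (11 * W) := by
          refine mul_le_mul (verifyRounds_le c hv hd hn hδ hδ1 k) ?_ (by positivity)
            (by positivity)
          linarith
      _ = 11 * (c.verify * (W + W * ld + 2 * (W * Λ) + 2 * (W * (k / n))) + W) := by ring
      _ ≤ 11 * (c.verify * (3 * U + 2 * U + 2 * U + 2 * (3 * U * (k / n))) + 3 * U) := by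
          gcongr
      _ = 77 * (c.verify * U) + 33 * U + 66 * (c.verify * U) * (k / n) := by ring
      _ ≤ 77 * (c.verify * U) + 33 * U + 77 * (c.verify * U) * (k / n) + 33 * U * (k / n) := by
          have h₁ : 0 ≤ c.verify * U * (k / n) := by positivity
          have h₂ : 0 ≤ U * (k / n) := by positivity
          nlinarith
      _ = _ := by ring
  have hgs : (gramSchmidtTime m ℓ : ℝ) ≤ 8 * (m * ℓ ^ 2) := by
    exact_mod_cast gramSchmidtTime_le m ℓ hm
  have hsvd : (c.svd * (ℓ * d * (min ℓ d : ℕ)) : ℝ) ≤ 3 * c.svd * U := by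
    rw [min_eq_left hℓd]
    have := mul_le_mul_of_nonneg_right hfull' (by positivity : (0 : ℝ) ≤ ℓ)
    have e : W * ℓ = N * ℓ + m * ℓ ^ 2 := by rw [hW]; ring
    calc (c.svd * (ℓ * d * ℓ) : ℝ) ≤ c.svd * (3 * U) :=
          mul_le_mul_of_nonneg_left (by linarith) (Nat.cast_nonneg _)
      _ = _ := by ring
  have hrest : (160 * c.simIter + 3 * c.svd + 96) * U ≤
      (160 * c.simIter + 3 * c.svd + 96) * U * (1 + k / n) :=
    le_mul_of_one_le_right (by positivity) (by linarith [show (0 : ℝ) ≤ k / n by positivity])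
  have hsplit : (160 * c.simIter + 3 * c.svd + 77 * c.verify + 129) * U * (1 + k / n) =
      (160 * c.simIter + 3 * c.svd + 96) * U * (1 + k / n) +
        (77 * c.verify + 33) * U * (1 + k / n) := by ring
  rw [hsplit]
  refine le_trans ?_ (add_le_add hrest hver)
  unfold roundTime sparseShrinkTime simultaneousIterationTime verifyTime
  push_cast at hpow hsvd ⊢
  have e₁ : (ℓ * (2 * N + m) : ℝ) = 2 * (N * ℓ) + m * ℓ := by ring
  have e₂ : (ℓ * (2 * N + d) : ℝ) = 2 * (N * ℓ) + ℓ * d := by ring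
  have e₃ : (d * ℓ : ℝ) = ℓ * d := by ring
  rw [e₁, e₂] at hpow ⊢
  rw [e₃]
  linarith

end Arithmetic

/-! ### The potential, the expected time, and the theorem. -/

section Main

variable {d ℓ n : ℕ}

theorem nnz_eq_sum_ofFn (A : Matrix (Fin n) (Fin d) ℝ) :
    nnz A = ((List.ofFn fun i => A i).map nnzVec).sum := by
  rw [List.map_ofFn, List.sum_ofFn]
  rfl

theorem expected_runningTime_le [NeZero d] (hn : 0 < n) (hℓ : 0 < ℓ) (hℓd : ℓ ≤ d) (c : Constants)
    (hc : 3 ≤ c.simIter) (hv : 0 ≤ c.verify) (A : Matrix (Fin n) (Fin d) ℝ) {δ : ℝ} (hδ : 0 < δ)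
    (hδ1 : δ < 1) :
    ∫⁻ ω, runningTime c A ℓ δ ω ∂(tapeMeasure d ℓ) ≤
      ENNReal.ofReal ((960 * c.simIter + 30 * c.svd + 462 * c.verify + 800) *
        workload d ℓ (Real.log (n / δ)) n (nnz A)) := by
  set L := List.ofFn fun i => A i with hL
  set bufs := flushes ℓ L [] with hbufs
  set Λ := Real.log (n / δ) with hΛdef
  have hΛ : 0 ≤ Λ := log_div_nonneg hn hδ hδ1
  have hn' : (1 : ℝ) ≤ n := by exact_mod_cast hn
  have hd : 0 < d := hℓ.trans_le hℓd
  have hLlen : L.length = n := by simp [hL]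
  have hF : bufs.length ≤ n := (length_flushes_le ℓ L []).trans hLlen.le
  set U : List (Fin d → ℝ) → ℝ := fun b => workload d ℓ Λ b.length (nnz (ofRows b)) with hU
  have hU0 : ∀ b, 0 ≤ U b := fun b => workload_nonneg hΛ
  set D : ℝ := 160 * c.simIter + 3 * c.svd + 77 * c.verify + 129 with hD
  have hD0 : 0 ≤ D := by positivity
  have hmem : ∀ b ∈ bufs, IsFull ℓ b ∧ 0 < b.length ∧ b.length ≤ d ∧ b.length ≤ n := by
    intro b hb
    obtain ⟨h₁, h₂, h₃, h₄⟩ := mem_flushes ℓ L [] (by simpa using hd) b hb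
    exact ⟨h₁, h₂, h₃, by simpa [hLlen] using h₄⟩
  have hUsum : (bufs.map U).sum ≤ workload d ℓ Λ n (nnz A) := by
    have h₁ := sum_flushes_le ℓ nnzVec L []
    have h₂ := sum_flushes_le ℓ (fun _ => 1) L []
    rw [← hbufs, ← nnz_eq_sum_ofFn] at h₁
    rw [← hbufs] at h₂
    simp only [List.map_nil, List.sum_nil, zero_add, List.map_const', List.sum_replicate,
      smul_eq_mul, mul_one, hLlen, ← nnz_ofRows] at h₁ h₂
    have e : ∀ l : List (List (Fin d → ℝ)), (l.map U).sum =
        ((l.map fun b => nnz (ofRows b)).sum : ℕ) * (ℓ * Real.log d + Λ) +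
          ((l.map fun b => b.length).sum : ℕ) * (ℓ ^ 2 + ℓ * Λ) := by
      intro l
      induction l with
      | nil => simp
      | cons b l ih =>
        rw [List.map_cons, List.sum_cons, ih, List.map_cons, List.sum_cons, List.map_cons,
          List.sum_cons, Nat.cast_add, Nat.cast_add]
        simp only [hU, workload]
        ring
    have h₁' : (((bufs.map fun b => nnz (ofRows b)).sum : ℕ) : ℝ) ≤ nnz A := by
      exact_mod_cast h₁
    have h₂' : (((bufs.map fun b => b.length).sum : ℕ) : ℝ) ≤ n := by exact_mod_cast h₂
    have hlogd : 0 ≤ Real.log d := Real.log_natCast_nonneg d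
    rw [e]
    calc _ ≤ (nnz A : ℝ) * (ℓ * Real.log d + Λ) + n * (ℓ ^ 2 + ℓ * Λ) := by gcongr
      _ = _ := by unfold workload; ring
  let a : ℕ → ℝ := fun g => D * U (bufs.getD g []) / n
  have ha : ∀ g, 0 ≤ a g := fun g => by have := hU0 (bufs.getD g []); positivity
  -- The expected remaining cost if a round for buffer g at call index k costs a_g(n + k) and
  -- succeeds with probability exactly 1/2. Buffer g is then reached at index k + 2(g − f) on
  -- average, and since ∑ 2^(−j) = ∑ j 2^(−j) = 2, an expected start κ costs a_g(2n + 2κ + 2).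
  let V : ℕ → ℕ → ℝ := fun f k => ∑ g ∈ Finset.Ico f bufs.length,
    a g * (2 * n + 2 * k + 4 * ((g : ℝ) - f) + 2)
  have hcost : ∀ f k, f < bufs.length → (roundCost c ℓ δ bufs f k : ℝ) ≤ a f * (n + k) := by
    intro f k hf
    rw [roundCost, if_pos hf]
    have hb : bufs.getD f [] ∈ bufs := by
      rw [List.getD_eq_getElem _ _ hf]; exact List.getElem_mem hf
    obtain ⟨h₁, h₂, h₃, h₄⟩ := hmem _ hb
    refine (roundTime_le c (by linarith) hv h₂ h₃ h₄ hℓ hℓd (nnz_ofRows_le _) h₁ hδ hδ1 k).trans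
      (le_of_eq ?_)
    simp only [a]
    field_simp
    rfl
  have hV : ∀ f k, 0 ≤ V f k := by
    intro f k
    refine Finset.sum_nonneg fun g hg => mul_nonneg (ha g) ?_
    have : (f : ℝ) ≤ g := by exact_mod_cast (Finset.mem_Ico.1 hg).1
    have : (0 : ℝ) ≤ k := k.cast_nonneg
    linarith
  have hmono : ∀ f k, V (f + 1) (k + 1) ≤ V f (k + 1) := by
    intro f k
    calc V (f + 1) (k + 1) ≤ ∑ g ∈ Finset.Ico (f + 1) bufs.length,
          a g * (2 * n + 2 * (k + 1 : ℕ) + 4 * ((g : ℝ) - f) + 2) := by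
          refine Finset.sum_le_sum fun g _ => mul_le_mul_of_nonneg_left ?_ (ha g)
          push_cast
          linarith
      _ ≤ V f (k + 1) := by
          refine Finset.sum_le_sum_of_subset_of_nonneg
            (Finset.Ico_subset_Ico_left (Nat.le_succ f)) fun g hg _ => mul_nonneg (ha g) ?_
          have : (f : ℝ) ≤ g := by exact_mod_cast (Finset.mem_Ico.1 hg).1
          push_cast
          linarith [k.cast_nonneg (α := ℝ)]
  have hstep : ∀ f k, (roundCost c ℓ δ bufs f k : ℝ) +
      (V (f + 1) (k + 1) + V f (k + 1)) / 2 ≤ V f k := by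
    intro f k
    rcases lt_or_ge f bufs.length with hf | hf
    · have h := hcost f k hf
      simp only [V]
      rw [Finset.sum_eq_sum_Ico_succ_bot hf, Finset.sum_eq_sum_Ico_succ_bot hf]
      -- For a later buffer, averaging success and failure raises 2k by 2 and lowers 4(g − f) by 2,
      -- so its term is unchanged.
      have e : (∑ g ∈ Finset.Ico (f + 1) bufs.length,
            a g * (2 * n + 2 * (k + 1 : ℕ) + 4 * ((g : ℝ) - (f + 1 : ℕ)) + 2) +
          ∑ g ∈ Finset.Ico (f + 1) bufs.length,
            a g * (2 * n + 2 * (k + 1 : ℕ) + 4 * ((g : ℝ) - f) + 2)) =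
          2 * ∑ g ∈ Finset.Ico (f + 1) bufs.length,
            a g * (2 * n + 2 * k + 4 * ((g : ℝ) - f) + 2) := by
        rw [← Finset.sum_add_distrib, Finset.mul_sum]
        refine Finset.sum_congr rfl fun g _ => ?_
        push_cast
        ring
      push_cast at e ⊢
      linarith
    · simp [V, roundCost, Finset.Ico_eq_empty_of_le hf, not_lt.2 hf,
        Finset.Ico_eq_empty_of_le (hf.trans (Nat.le_succ f))]
  have hV0 : V 0 0 ≤ 6 * D * workload d ℓ Λ n (nnz A) := by
    calc V 0 0 ≤ ∑ g ∈ Finset.range bufs.length, 6 * D * U (bufs.getD g []) := by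
          simp only [V, Finset.range_eq_Ico]
          refine Finset.sum_le_sum fun g hg => ?_
          -- There are at most n flushes, so 4g + 2 ≤ 4n and each bracket is at most 6n.
          have hg' : ((g + 1 : ℕ) : ℝ) ≤ n := by
            exact_mod_cast (Finset.mem_Ico.1 hg).2.trans_le hF
          push_cast at hg'
          calc a g * (2 * n + 2 * (0 : ℕ) + 4 * ((g : ℝ) - (0 : ℕ)) + 2) ≤ a g * (6 * n) := by
                refine mul_le_mul_of_nonneg_left ?_ (ha g)
                push_cast
                linarith
            _ = _ := by simp only [a]; field_simp
      _ = 6 * D * (bufs.map U).sum := by rw [← Finset.mul_sum, sum_range_getD]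
      _ ≤ _ := by gcongr
  have hdense : (bufs.length * (denseShrinkTime c.svd d ℓ (ℓ + ℓ) + 1) : ℝ) ≤
      (12 * c.svd + 8) * workload d ℓ Λ n (nnz A) := by
    have h : ∀ b ∈ bufs, (denseShrinkTime c.svd d ℓ (ℓ + ℓ) + 1 : ℝ) ≤ (12 * c.svd + 8) * U b := by
      intro b hb
      obtain ⟨h₁, h₂, h₃, h₄⟩ := hmem b hb
      refine denseShrinkTime_le c.svd h₂ hℓ hℓd (nnz_ofRows_le b) ?_ hΛ
      rcases h₁ with h | h
      · omega
      · have : b.length * ℓ = ℓ * d := by rw [h, mul_comm]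
        omega
    have h' := List.sum_le_sum h
    simp only [List.map_const', List.sum_replicate, nsmul_eq_mul, List.sum_map_mul_left] at h'
    exact h'.trans (by gcongr)
  have hbase : ((((L.map fun a => rowWords a + 5).sum : ℕ)) : ℝ) ≤ 10 * workload d ℓ Λ n (nnz A) := by
    have e : ∀ L : List (Fin d → ℝ), (L.map fun a => rowWords a + 5).sum =
        2 * (L.map nnzVec).sum + 6 * L.length := by
      intro L
      induction L with
      | nil => simp
      | cons a L ih =>
        rw [List.map_cons, List.sum_cons, ih, List.map_cons, List.sum_cons, List.length_cons,
          rowWords]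
        ring
    rw [e, ← nnz_eq_sum_ofFn, hLlen]
    have hNle : nnz A ≤ n * d := by
      have := nnz_ofRows_le L
      rwa [nnz_ofRows, ← nnz_eq_sum_ofFn, hLlen] at this
    have h₁ := nnz_mul_le_workload hℓ hℓd hNle hΛ
    have h₂ := mul_sq_le_workload (d := d) (ℓ := ℓ) (m := n) (N := nnz A) hΛ
    have hℓ' : (1 : ℝ) ≤ ℓ := by exact_mod_cast hℓ
    have h₃ : (nnz A : ℝ) ≤ nnz A * ℓ := le_mul_of_one_le_right (Nat.cast_nonneg _) hℓ'
    have h₄ : (n : ℝ) ≤ n * ℓ ^ 2 := le_mul_of_one_le_right (Nat.cast_nonneg _)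
      (one_le_pow₀ hℓ')
    push_cast
    linarith
  have hone : 1 ≤ workload d ℓ Λ n (nnz A) := by
    refine le_trans ?_ (mul_sq_le_workload hΛ)
    have hℓ' : (1 : ℝ) ≤ ℓ := by exact_mod_cast hℓ
    exact one_le_mul_of_one_le_of_one_le hn' (one_le_pow₀ hℓ')
  -- The absolute terms add up to 6 · 129 + 8 + 10 + 1 = 793 ≤ 800, and the coefficients of the SVD
  -- constant to 6 · 3 + 12 = 30.
  refine (lintegral_runningTime_le hℓ hℓd c hc A δ bufs hbufs V hV hmono hstep).trans
    (ENNReal.ofReal_le_ofReal ?_)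
  rw [← hL, Nat.cast_add, Nat.cast_mul, Nat.cast_add, Nat.cast_one]
  rw [hD] at hV0
  have : 0 ≤ (c.svd : ℝ) * workload d ℓ Λ n (nnz A) := by positivity
  nlinarith

end Main

end SparseFD

theorem mainTheorem6 :
    (∃ c₀ : ℝ, 0 < c₀ ∧
      ∀ c : SparseFD.Constants, c₀ ≤ c.simIter → 0 < c.verify →
        ∃ C : ℝ, 0 < C ∧
          ∀ (n d ℓ : ℕ) [NeZero d] (A : Matrix (Fin n) (Fin d) ℝ) (δ : ℝ),
            0 < n → 0 < ℓ → ℓ ≤ d → 0 < δ → δ < 1 →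
              AEMeasurable (SparseFD.runningTime c A ℓ δ) (SparseFD.tapeMeasure d ℓ) ∧
              ∫⁻ ω, SparseFD.runningTime c A ℓ δ ω ∂(SparseFD.tapeMeasure d ℓ) ≤
                ENNReal.ofReal (C *
                  ((SparseFD.nnz A : ℝ) * (ℓ : ℝ) * Real.log (d : ℝ)
                    + (SparseFD.nnz A : ℝ) * Real.log ((n : ℝ) / δ)
                    + (n : ℝ) * (ℓ : ℝ) ^ 2
                    + (n : ℝ) * (ℓ : ℝ) * Real.log ((n : ℝ) / δ)))) ∧
    (∀ c : SparseFD.Constants,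
      ∃ C : ℝ, 0 < C ∧
        ∀ (n d ℓ : ℕ) (A : Matrix (Fin n) (Fin d) ℝ) (δ : ℝ),
          0 < n → 0 < ℓ → ℓ ≤ d → 0 < δ → δ < 1 →
            ∀ ω : SparseFD.Tape d ℓ,
              SparseFD.memoryFootprint c A ℓ δ ω ≤
                ENNReal.ofReal (C * ((d : ℝ) * (ℓ : ℝ)))) := by
  refine ⟨⟨3, by norm_num, fun c hc hv => ⟨960 * c.simIter + 30 * c.svd + 462 * c.verify + 800,
    by positivity, fun n d ℓ _ A δ hn hℓ hℓd hδ hδ1 => ⟨?_, ?_⟩⟩⟩, fun c =>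
    ⟨3 * c.svd + 40, by positivity, fun n d ℓ A δ _ hℓ hℓd _ _ ω =>
      SparseFD.memoryFootprint_le c A δ (hℓ.trans_le hℓd) hℓ ω⟩⟩
  · exact (SparseFD.measurable_runningTime hℓ hℓd c A δ).aemeasurable
  · exact SparseFD.expected_runningTime_le hn hℓ hℓd c hc hv.le A hδ hδ1
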